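/- Let $n\ge 2$ and $1\le k\le n-1$, and let $s_1,\dots,s_{n-1}$ be the simple reflections $s_i=(i\ \,i{+}1)$ of $S_n$, with length function $\ell$. Let $\mathcal H=\mathcal H_n$ be the Iwahori–Hecke algebra of $S_n$ over $\mathbb Z[\xi]$, generated by $\tilde T_{s_1},\dots,\tilde T_{s_{n-1}}$ subject to the braid relations and $\tilde T_{s_i}^2=1+\xi\tilde T_{s_i}$, with its standard $\mathbb Z[\xi]$-basis $\{\tilde T_w\mid w\in S_n\}$, where $\tilde T_w$ is the product of the generators along a reduced expression for $w$. For a composition $\lambda=(\lambda_1,\dots,\lambda_r)$ of $n$ let $S_\lambda=S_{\lambda_1}\times\dots\times S_{\lambda_r}\le S_n$ be the parabolic subgroup generated by the $s_i$ with $i\notin\{\lambda_1,\lambda_1+\lambda_2,\dots\}$, let $w_\lambda$ be the product of these $s_i$ in increasing order of $i$, and let $\lambda-1$ be the composition obtained from $\lambda$ by replacing each component $\lambda_i>1$ by the two components $\lambda_i-1,1$. For parabolic subgroups $H\le G$ of $S_n$ and $h\in\mathcal H$ the relative norm is $\mathcal N_{G,H}(h)=\sum_{d}\tilde T_{d^{-1}}h\tilde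 T_d$, where $d$ runs over the elements of $G$ that have minimal length in their coset $Hd$. Put $\eta_\lambda=\mathcal N_{S_{\lambda-1},1}(\tilde T_{w_\lambda})$, and $b_\alpha=\mathcal N_{S_n,S_\alpha}(\eta_\alpha)$ for a partition $\alpha$ of $n$ (viewed as a weakly decreasing composition). Let $\pi:\mathcal H\to\mathcal H$ be the $\mathbb Z[\xi]$-linear projection with $\pi(\tilde T_w)=\tilde T_w$ if $w\in S_{(k,n-k)}$ and $\pi(\tilde T_w)=0$ otherwise. Let $\Lambda_{(k,n-k)}(\alpha)$ be the set of pairs $(\mu,\nu)$ of a partition $\mu$ of $k$ and a partition $\nu$ of $n-k$ whose components together (with multiplicity) are the components of $\alpha$; for such a pair, $S_{(\mu,\nu)}$ and $\eta_{(\mu,\nu)}$ are formed from the composition of $n$ obtained by juxtaposing $\mu$ and $\nu$. Then for every partition $\alpha$ of $n$ there are nonnegative integers $z_{\mu,\nu}$ with $$\pi(b_\alpha)=\sum_{(\mu,\nu)\in\Lambda_{(k,n-k)}(\alpha)}z_{\mu,\nu}\,\mathcal N_{S_{(k,n-k)},S_{(\mu,\nu)}}(\eta_{(\mu,\nu)}).$$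 Moreover, whenever nonnegative integers $z_{\mu,\nu}$ satisfy this equation, then for every $(\mu,\nu)\in\Lambda_{(k,n-k)}(\alpha)$ $$z_{\mu,\nu}=[N_{S_n}(S_{(\mu,\nu)}):N_{S_{(k,n-k)}}(S_{(\mu,\nu)})].$$ -/

import Mathlib

namespace NormBasis

/-! ### The symmetric group and its simple reflections -/

/-- The smaller of the two points exchanged by the `i`-th simple reflection. -/
def lo {n : ℕ} (i : Fin (n - 1)) : Fin n := ⟨i, by omega⟩

/-- The larger of the two points exchanged by the `i`-th simple reflection. -/
def hi {n : ℕ} (i : Fin (n - 1)) : Fin n := ⟨i + 1, by omega⟩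

/-- The simple reflection exchanging two adjacent letters of `{0, …, n - 1}`; the index `i`
is zero-based. -/
def simpleRefl {n : ℕ} (i : Fin (n - 1)) : Equiv.Perm (Fin n) := Equiv.swap (lo i) (hi i)

/-- The element of the symmetric group expressed by a word in the simple reflections. -/
def wordProd {n : ℕ} (l : List (Fin (n - 1))) : Equiv.Perm (Fin n) := (l.map simpleRefl).prod

/-- The length: the minimal number of simple reflections in an expression for `w`. -/
noncomputable def len {n : ℕ} (w : Equiv.Perm (Fin n)) : ℕ :=
  sInf {r : ℕ | ∃ l : List (Fin (n - 1)), wordProd l = w ∧ l.length = r}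

theorem wordProd_cons {n : ℕ} (i : Fin (n - 1)) (l : List (Fin (n - 1))) :
    wordProd (i :: l) = simpleRefl i * wordProd l := by
  simp [wordProd]

theorem exists_word {n : ℕ} (w : Equiv.Perm (Fin n)) :
    ∃ l : List (Fin (n - 1)), wordProd l = w := by
  cases n with
  | zero => exact ⟨[], Subsingleton.elim _ _⟩
  | succ n =>
    have hw : w ∈ Submonoid.closure
        (Set.range fun i : Fin n => Equiv.swap i.castSucc i.succ) := by
      rw [Equiv.Perm.mclosure_swap_castSucc_succ]; trivial
    induction hw using Submonoid.closure_induction_left with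
    | one => exact ⟨[], rfl⟩
    | mul_left x hx y hy ih =>
      obtain ⟨i, rfl⟩ := hx
      obtain ⟨l, rfl⟩ := ih
      exact ⟨i :: l, wordProd_cons (n := n + 1) i l⟩

/-- Every element has a reduced expression. -/
theorem exists_reduced {n : ℕ} (w : Equiv.Perm (Fin n)) :
    ∃ l : List (Fin (n - 1)), wordProd l = w ∧ l.length = len w := by
  obtain ⟨l, hl⟩ := exists_word w
  exact Nat.sInf_mem (s := {r : ℕ | ∃ l : List (Fin (n - 1)), wordProd l = w ∧ l.length = r})
    ⟨l.length, l, hl, rfl⟩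

theorem len_le {n : ℕ} {w : Equiv.Perm (Fin n)} {l : List (Fin (n - 1))} (h : wordProd l = w) :
    len w ≤ l.length :=
  Nat.sInf_le ⟨l, h, rfl⟩

/-- A reduced expression of `w`. -/
noncomputable def reducedWord {n : ℕ} (w : Equiv.Perm (Fin n)) : List (Fin (n - 1)) :=
  (exists_reduced w).choose

theorem wordProd_reducedWord {n : ℕ} (w : Equiv.Perm (Fin n)) : wordProd (reducedWord w) = w :=
  (exists_reduced w).choose_spec.1

theorem length_reducedWord {n : ℕ} (w : Equiv.Perm (Fin n)) : (reducedWord w).length = len w :=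
  (exists_reduced w).choose_spec.2

/-! ### Left descents -/

/-- `i` is a left descent of `w`. -/
def Desc {n : ℕ} (i : Fin (n - 1)) (w : Equiv.Perm (Fin n)) : Prop := w⁻¹ (hi i) < w⁻¹ (lo i)

instance {n : ℕ} (i : Fin (n - 1)) (w : Equiv.Perm (Fin n)) : Decidable (Desc i w) :=
  inferInstanceAs (Decidable (_ < _))

theorem lo_lt_hi {n : ℕ} (i : Fin (n - 1)) : (lo i : Fin n) < hi i := by
  simp [lo, hi]

theorem simpleRefl_mul_self {n : ℕ} (i : Fin (n - 1)) :
    (simpleRefl i : Equiv.Perm (Fin n)) * simpleRefl i = 1 := by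
  simp [simpleRefl]

theorem simpleRefl_inv {n : ℕ} (i : Fin (n - 1)) :
    (simpleRefl i : Equiv.Perm (Fin n))⁻¹ = simpleRefl i := by
  simp [simpleRefl]

theorem simpleRefl_mul_cancel {n : ℕ} (i : Fin (n - 1)) (w : Equiv.Perm (Fin n)) :
    simpleRefl i * (simpleRefl i * w) = w := by
  rw [← mul_assoc, simpleRefl_mul_self, one_mul]

theorem exchange {n : ℕ} (l : List (Fin (n - 1))) :
    ∀ a b : Fin n, a < b → (wordProd l)⁻¹ b < (wordProd l)⁻¹ a →
      ∃ l' : List (Fin (n - 1)), l'.length + 1 = l.length ∧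
        wordProd l' = Equiv.swap a b * wordProd l := by
  induction l with
  | nil =>
    intro a b hab h
    simp only [wordProd, List.map_nil, List.prod_nil, inv_one, Equiv.Perm.one_apply] at h
    exact absurd h (not_lt.mpr hab.le)
  | cons j l ih =>
    intro a b hab h
    rw [wordProd_cons, mul_inv_rev, simpleRefl_inv, Equiv.Perm.mul_apply,
      Equiv.Perm.mul_apply] at h
    rcases lt_trichotomy (simpleRefl j a) (simpleRefl j b) with hlt | heq | hgt
    · obtain ⟨l', h1, h2⟩ := ih _ _ hlt h
      refine ⟨j :: l', by simp [h1], ?_⟩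
      rw [wordProd_cons, wordProd_cons, h2, Equiv.swap_apply_apply, simpleRefl_inv]
      simp only [mul_assoc]
      rw [simpleRefl_mul_cancel]
    · exact absurd ((simpleRefl j).injective heq) hab.ne
    · have hja : a = lo j ∧ b = hi j := by
        simp only [simpleRefl, Equiv.swap_apply_def, lo, hi, Fin.ext_iff, Fin.lt_def] at *
        split_ifs at hgt <;> simp_all <;> omega
      refine ⟨l, by simp, ?_⟩
      rw [wordProd_cons, hja.1, hja.2]
      exact (simpleRefl_mul_cancel j _).symm

theorem len_simpleRefl_mul_le {n : ℕ} (i : Fin (n - 1)) (w : Equiv.Perm (Fin n)) :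
    len (simpleRefl i * w) ≤ len w + 1 := by
  obtain ⟨l, h1, h2⟩ := exists_reduced w
  have := len_le (l := i :: l) (w := simpleRefl i * w) (by rw [wordProd_cons, h1])
  simpa [h2] using this

theorem Desc.len_eq {n : ℕ} {i : Fin (n - 1)} {w : Equiv.Perm (Fin n)} (h : Desc i w) :
    len (simpleRefl i * w) + 1 = len w := by
  obtain ⟨l, h1, h2⟩ := exists_reduced w
  subst h1
  obtain ⟨l', h3, h4⟩ := exchange l (lo i) (hi i) (lo_lt_hi i) h
  have h5 := len_le h4
  have h6 := len_simpleRefl_mul_le i (simpleRefl i * wordProd l)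
  rw [simpleRefl_mul_cancel] at h6
  have h7 : len (simpleRefl i * wordProd l) ≤ l'.length := h5
  omega

theorem desc_simpleRefl_mul {n : ℕ} (i : Fin (n - 1)) (w : Equiv.Perm (Fin n)) :
    Desc i (simpleRefl i * w) ↔ ¬ Desc i w := by
  have hne : w⁻¹ (lo i) ≠ w⁻¹ (hi i) := fun h => (lo_lt_hi i).ne (w⁻¹.injective h)
  simp only [Desc, mul_inv_rev, simpleRefl_inv, Equiv.Perm.mul_apply]
  simp only [simpleRefl, Equiv.swap_apply_left, Equiv.swap_apply_right, not_lt]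
  exact ⟨fun h => h.le, fun h => lt_of_le_of_ne h hne⟩

theorem len_of_not_desc {n : ℕ} {i : Fin (n - 1)} {w : Equiv.Perm (Fin n)} (h : ¬ Desc i w) :
    len (simpleRefl i * w) = len w + 1 := by
  have := ((desc_simpleRefl_mul i w).mpr h).len_eq
  rw [simpleRefl_mul_cancel] at this
  exact this.symm

theorem desc_of_len {n : ℕ} {i : Fin (n - 1)} {w : Equiv.Perm (Fin n)}
    (h : len (simpleRefl i * w) < len w) : Desc i w := by
  by_contra hd
  have := len_of_not_desc hd
  omega

/-! ### The Iwahori-Hecke algebra -/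

/-- The defining relations of the Iwahori-Hecke algebra of `S_n` over `ℤ[ξ]`. -/
inductive HeckeRel (n : ℕ) :
    FreeAlgebra (Polynomial ℤ) (Fin (n - 1)) → FreeAlgebra (Polynomial ℤ) (Fin (n - 1)) → Prop
  | comm (i j : Fin (n - 1)) (h : (i : ℕ) + 2 ≤ j) :
      HeckeRel n (FreeAlgebra.ι _ i * FreeAlgebra.ι _ j) (FreeAlgebra.ι _ j * FreeAlgebra.ι _ i)
  | braid (i j : Fin (n - 1)) (h : (i : ℕ) + 1 = j) :
      HeckeRel n (FreeAlgebra.ι _ i * FreeAlgebra.ι _ j * FreeAlgebra.ι _ i)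
        (FreeAlgebra.ι _ j * FreeAlgebra.ι _ i * FreeAlgebra.ι _ j)
  | quad (i : Fin (n - 1)) :
      HeckeRel n (FreeAlgebra.ι _ i * FreeAlgebra.ι _ i)
        (1 + (Polynomial.X : Polynomial ℤ) • FreeAlgebra.ι _ i)

/-- The Iwahori-Hecke algebra of `S_n` over `ℤ[ξ]` in normalized generators, where `ξ` is the
indeterminate `Polynomial.X`. -/
abbrev Hecke (n : ℕ) : Type := RingQuot (HeckeRel n)

/-- The generator attached to the `i`-th simple reflection. -/
noncomputable def gen {n : ℕ} (i : Fin (n - 1)) : Hecke n :=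
  RingQuot.mkAlgHom (Polynomial ℤ) (HeckeRel n) (FreeAlgebra.ι _ i)

/-- The product of generators along a word. -/
noncomputable def genProd {n : ℕ} (l : List (Fin (n - 1))) : Hecke n := (l.map gen).prod

/-- The element `T_w`: the product of the generators along a reduced expression for `w`.
It does not depend on the reduced expression, see `genProd_eq_T`. -/
noncomputable def T {n : ℕ} (w : Equiv.Perm (Fin n)) : Hecke n := genProd (reducedWord w)

theorem gen_comm {n : ℕ} (i j : Fin (n - 1)) (h : (i : ℕ) + 2 ≤ j) :
    (gen i : Hecke n) * gen j = gen j * gen i := by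
  simpa [gen] using RingQuot.mkAlgHom_rel (Polynomial ℤ) (HeckeRel.comm i j h)

theorem gen_braid {n : ℕ} (i j : Fin (n - 1)) (h : (i : ℕ) + 1 = j) :
    (gen i : Hecke n) * gen j * gen i = gen j * gen i * gen j := by
  simpa [gen] using RingQuot.mkAlgHom_rel (Polynomial ℤ) (HeckeRel.braid i j h)

theorem gen_quad {n : ℕ} (i : Fin (n - 1)) :
    (gen i : Hecke n) * gen i = 1 + (Polynomial.X : Polynomial ℤ) • gen i := by
  simpa [gen] using RingQuot.mkAlgHom_rel (Polynomial ℤ) (HeckeRel.quad i)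

theorem genProd_cons {n : ℕ} (i : Fin (n - 1)) (l : List (Fin (n - 1))) :
    (genProd (i :: l) : Hecke n) = gen i * genProd l := by
  simp [genProd]

theorem desc_far {n : ℕ} {i j : Fin (n - 1)} (h : (i : ℕ) + 2 ≤ j) (w : Equiv.Perm (Fin n)) :
    Desc j (simpleRefl i * w) ↔ Desc j w := by
  simp only [Desc, mul_inv_rev, simpleRefl_inv, Equiv.Perm.mul_apply]
  rw [simpleRefl, Equiv.swap_apply_of_ne_of_ne, Equiv.swap_apply_of_ne_of_ne] <;>
    simp [lo, hi, Fin.ext_iff] <;> omega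

theorem desc_far' {n : ℕ} {i j : Fin (n - 1)} (h : (i : ℕ) + 2 ≤ j) (w : Equiv.Perm (Fin n)) :
    Desc i (simpleRefl j * w) ↔ Desc i w := by
  simp only [Desc, mul_inv_rev, simpleRefl_inv, Equiv.Perm.mul_apply]
  rw [simpleRefl, Equiv.swap_apply_of_ne_of_ne, Equiv.swap_apply_of_ne_of_ne] <;>
    simp [lo, hi, Fin.ext_iff] <;> omega

theorem simpleRefl_comm {n : ℕ} {i j : Fin (n - 1)} (h : (i : ℕ) + 2 ≤ j) :
    (simpleRefl i : Equiv.Perm (Fin n)) * simpleRefl j = simpleRefl j * simpleRefl i := by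
  refine (Equiv.Perm.Disjoint.commute ?_)
  intro x
  by_cases hx : x = lo i ∨ x = hi i
  · right
    refine Equiv.swap_apply_of_ne_of_ne ?_ ?_ <;>
      rcases hx with rfl | rfl <;> simp [lo, hi, Fin.ext_iff] <;> omega
  · left
    push Not at hx
    exact Equiv.swap_apply_of_ne_of_ne hx.1 hx.2

theorem simpleRefl_braid {n : ℕ} {i j : Fin (n - 1)} (h : (i : ℕ) + 1 = j) :
    (simpleRefl i : Equiv.Perm (Fin n)) * (simpleRefl j * simpleRefl i) =
      simpleRefl j * (simpleRefl i * simpleRefl j) := by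
  have hij : (hi i : Fin n) = lo j := by simp [lo, hi, h]
  have h1 : (lo i : Fin n) ≠ lo j := by simp [lo]; omega
  have h2 : (lo i : Fin n) ≠ hi j := by simp [lo, hi]; omega
  have h3 : (lo j : Fin n) ≠ hi j := by simp [lo, hi]
  ext x
  congr 1
  simp only [simpleRefl, Equiv.Perm.mul_apply, hij]
  by_cases hx1 : x = lo i
  · subst hx1
    simp [Equiv.swap_apply_of_ne_of_ne, h1, h2, h2.symm, h3.symm]
  by_cases hx2 : x = lo j
  · subst hx2
    simp [Equiv.swap_apply_of_ne_of_ne, h1, h2, h2.symm, h3.symm]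
  by_cases hx3 : x = hi j
  · subst hx3
    simp [Equiv.swap_apply_of_ne_of_ne, h1, h2, h2.symm, h3.symm]
  simp [Equiv.swap_apply_of_ne_of_ne, hx1, hx2, hx3]

/-- The values controlling the descents at two neighbouring simple reflections. -/
theorem desc_near {n : ℕ} {i j : Fin (n - 1)} (h : (i : ℕ) + 1 = j) (w : Equiv.Perm (Fin n)) :
    (Desc i w ↔ w⁻¹ (lo j) < w⁻¹ (lo i)) ∧
    (Desc j w ↔ w⁻¹ (hi j) < w⁻¹ (lo j)) ∧
    (Desc j (simpleRefl i * w) ↔ w⁻¹ (hi j) < w⁻¹ (lo i)) ∧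
    (Desc i (simpleRefl j * w) ↔ w⁻¹ (hi j) < w⁻¹ (lo i)) ∧
    (Desc i (simpleRefl j * (simpleRefl i * w)) ↔ w⁻¹ (hi j) < w⁻¹ (lo j)) ∧
    (Desc j (simpleRefl i * (simpleRefl j * w)) ↔ w⁻¹ (lo j) < w⁻¹ (lo i)) := by
  have hij : (hi i : Fin n) = lo j := by simp [lo, hi, h]
  have h1 : (lo i : Fin n) ≠ lo j := by simp [lo]; omega
  have h2 : (lo i : Fin n) ≠ hi j := by simp [lo, hi]; omega
  have h3 : (lo j : Fin n) ≠ hi j := by simp [lo, hi]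
  simp [Desc, simpleRefl, hij, Equiv.swap_apply_of_ne_of_ne, h1, h2, h2.symm, h3.symm]

/-- Two reduced expressions of the same element give the same product of generators. -/
theorem genProd_eq_of_reduced {n : ℕ} (m : ℕ) : ∀ l l' : List (Fin (n - 1)),
    l.length = m → l'.length = m → wordProd l = wordProd l' → len (wordProd l) = m →
    (genProd l : Hecke n) = genProd l' := by
  induction m using Nat.strong_induction_on with
  | _ m ih =>
  intro l l' hl hl' hw hlen
  match l, l' with
  | [], [] => rfl
  | [], _ :: _ => simp at hl hl'; omega
  | _ :: _, [] => simp at hl hl'; omega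
  | i :: l, j :: l' =>
    obtain ⟨w, hwdef⟩ : ∃ w, w = wordProd (i :: l) := ⟨_, rfl⟩
    rw [← hwdef] at hw hlen
    simp only [List.length_cons] at hl hl'
    have hli : wordProd l = simpleRefl i * w := by
      rw [hwdef, wordProd_cons, simpleRefl_mul_cancel]
    have hlj : wordProd l' = simpleRefl j * w := by
      rw [hw, wordProd_cons, simpleRefl_mul_cancel]
    have hleni : len (simpleRefl i * w) = m - 1 := by
      have h1 := len_le hli
      have h2 := len_simpleRefl_mul_le i (simpleRefl i * w)
      rw [simpleRefl_mul_cancel] at h2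
      omega
    have hlenj : len (simpleRefl j * w) = m - 1 := by
      have h1 := len_le hlj
      have h2 := len_simpleRefl_mul_le j (simpleRefl j * w)
      rw [simpleRefl_mul_cancel] at h2
      omega
    have hdi : Desc i w := desc_of_len (by omega)
    have hdj : Desc j w := desc_of_len (by omega)
    -- replace the tails by convenient reduced expressions
    have key : ∀ r : List (Fin (n - 1)), wordProd r = simpleRefl i * w → r.length = m - 1 →
        (genProd l : Hecke n) = genProd r := fun r h1 h2 =>
      ih (m - 1) (by omega) l r (by omega) h2 (by rw [hli, h1]) (by rw [hli, hleni])
    have key' : ∀ r : List (Fin (n - 1)), wordProd r = simpleRefl j * w → r.length = m - 1 →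
        (genProd l' : Hecke n) = genProd r := fun r h1 h2 =>
      ih (m - 1) (by omega) l' r (by omega) h2 (by rw [hlj, h1]) (by rw [hlj, hlenj])
    have far : ∀ a b : Fin (n - 1), (a : ℕ) + 2 ≤ b → Desc a w → Desc b w → len w = m →
        ∃ r : List (Fin (n - 1)), wordProd (b :: r) = simpleRefl a * w ∧
          wordProd (a :: r) = simpleRefl b * w ∧ r.length + 2 = m := by
      intro a b hab ha hb hm
      obtain ⟨r, h1, h2⟩ := exists_reduced (simpleRefl b * (simpleRefl a * w))
      have h3 := ha.len_eq
      have h4 := ((desc_far hab w).mpr hb).len_eq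
      refine ⟨r, ?_, ?_, by omega⟩
      · rw [wordProd_cons, h1, simpleRefl_mul_cancel]
      · rw [wordProd_cons, h1, ← mul_assoc (simpleRefl b), ← simpleRefl_comm hab, mul_assoc,
          simpleRefl_mul_cancel]
    have near : ∀ a b : Fin (n - 1), (a : ℕ) + 1 = b → Desc a w → Desc b w → len w = m →
        ∃ r : List (Fin (n - 1)), wordProd (b :: a :: r) = simpleRefl a * w ∧
          wordProd (a :: b :: r) = simpleRefl b * w ∧ r.length + 3 = m := by
      intro a b hab ha hb hm
      obtain ⟨d1, d2, d3, d4, d5, d6⟩ := desc_near hab w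
      obtain ⟨r, h1, h2⟩ :=
        exists_reduced (simpleRefl a * (simpleRefl b * (simpleRefl a * w)))
      have h3 := ha.len_eq
      have h4 := (d3.mpr ((d2.mp hb).trans (d1.mp ha))).len_eq
      have h5 := (d5.mpr (d2.mp hb)).len_eq
      refine ⟨r, ?_, ?_, by omega⟩
      · rw [wordProd_cons, wordProd_cons, h1, simpleRefl_mul_cancel, simpleRefl_mul_cancel]
      · have hbr : simpleRefl a * (simpleRefl b * (simpleRefl a * w)) =
            simpleRefl b * (simpleRefl a * (simpleRefl b * w)) := by
          have := congrArg (· * w) (simpleRefl_braid hab)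
          simpa only [mul_assoc] using this
        rw [wordProd_cons, wordProd_cons, h1, hbr, simpleRefl_mul_cancel,
          simpleRefl_mul_cancel]
    rw [genProd_cons, genProd_cons]
    have hcases : i = j ∨ (i : ℕ) + 2 ≤ j ∨ (j : ℕ) + 2 ≤ i ∨ (i : ℕ) + 1 = j ∨
        (j : ℕ) + 1 = i := by
      by_cases hij : i = j
      · exact Or.inl hij
      · have : (i : ℕ) ≠ j := fun h => hij (Fin.ext h)
        omega
    rcases hcases with rfl | h | h | h | h
    · rw [key l' hlj (by omega)]
    · obtain ⟨r, h1, h2, h3⟩ := far i j h hdi hdj hlen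
      rw [key _ h1 (by simp; omega), key' _ h2 (by simp; omega), genProd_cons, genProd_cons,
        ← mul_assoc, ← mul_assoc, gen_comm i j h]
    · obtain ⟨r, h1, h2, h3⟩ := far j i h hdj hdi hlen
      rw [key _ h2 (by simp; omega), key' _ h1 (by simp; omega), genProd_cons, genProd_cons,
        ← mul_assoc, ← mul_assoc, gen_comm j i h]
    · obtain ⟨r, h1, h2, h3⟩ := near i j h hdi hdj hlen
      rw [key _ h1 (by simp; omega), key' _ h2 (by simp; omega)]
      simp only [genProd_cons, ← mul_assoc]
      rw [gen_braid i j h]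
    · obtain ⟨r, h1, h2, h3⟩ := near j i h hdj hdi hlen
      rw [key _ h2 (by simp; omega), key' _ h1 (by simp; omega)]
      simp only [genProd_cons, ← mul_assoc]
      rw [gen_braid j i h]

/-- `T_w` is the product of the generators along any reduced expression for `w`. -/
theorem genProd_eq_T {n : ℕ} {w : Equiv.Perm (Fin n)} {l : List (Fin (n - 1))}
    (h : wordProd l = w) (hl : l.length = len w) : (genProd l : Hecke n) = T w :=
  genProd_eq_of_reduced (len w) _ _ hl (length_reducedWord w)
    (by rw [h, wordProd_reducedWord]) (by rw [h])

theorem gen_mul_T_of_not_desc {n : ℕ} {i : Fin (n - 1)} {w : Equiv.Perm (Fin n)}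
    (h : ¬ Desc i w) : (gen i : Hecke n) * T w = T (simpleRefl i * w) := by
  rw [T, ← genProd_cons]
  refine genProd_eq_T ?_ ?_
  · rw [wordProd_cons, wordProd_reducedWord]
  · rw [List.length_cons, length_reducedWord, len_of_not_desc h]

theorem gen_mul_T_of_desc {n : ℕ} {i : Fin (n - 1)} {w : Equiv.Perm (Fin n)}
    (h : Desc i w) :
    (gen i : Hecke n) * T w = T (simpleRefl i * w) + (Polynomial.X : Polynomial ℤ) • T w := by
  have h' : ¬ Desc i (simpleRefl i * w) := by
    rw [desc_simpleRefl_mul]; exact not_not.mpr h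
  have h1 := gen_mul_T_of_not_desc h'
  rw [simpleRefl_mul_cancel] at h1
  rw [← h1, ← mul_assoc, gen_quad, add_mul, one_mul, smul_mul_assoc]

theorem T_one {n : ℕ} : (T 1 : Hecke n) = 1 :=
  (genProd_eq_T (l := []) rfl
    (Nat.le_zero.mp (len_le (n := n) (l := []) (w := 1) rfl)).symm).symm

/-! ### The standard basis -/

/-- The operator on the free module on `S_n` by which a generator acts on the left. -/
noncomputable def leftOp {n : ℕ} (i : Fin (n - 1)) :
    Module.End (Polynomial ℤ) (Equiv.Perm (Fin n) →₀ Polynomial ℤ) :=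
  Finsupp.linearCombination (Polynomial ℤ) fun w =>
    Finsupp.single (simpleRefl i * w) (1 : Polynomial ℤ) +
      if Desc i w then (Polynomial.X : Polynomial ℤ) • Finsupp.single w (1 : Polynomial ℤ) else 0

theorem leftOp_single {n : ℕ} (i : Fin (n - 1)) (w : Equiv.Perm (Fin n)) :
    leftOp i (Finsupp.single w 1) = Finsupp.single (simpleRefl i * w) (1 : Polynomial ℤ) +
      if Desc i w then (Polynomial.X : Polynomial ℤ) • Finsupp.single w (1 : Polynomial ℤ)
      else 0 := by
  simp [leftOp, Finsupp.linearCombination_single]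

theorem leftOp_rel {n : ℕ} {x y : FreeAlgebra (Polynomial ℤ) (Fin (n - 1))}
    (h : HeckeRel n x y) :
    FreeAlgebra.lift (Polynomial ℤ) (leftOp (n := n)) x =
      FreeAlgebra.lift (Polynomial ℤ) (leftOp (n := n)) y := by
  have ext1 : ∀ f g : Module.End (Polynomial ℤ) (Equiv.Perm (Fin n) →₀ Polynomial ℤ),
      (∀ w, f (Finsupp.single w 1) = g (Finsupp.single w 1)) → f = g := fun f g h =>
    Finsupp.lhom_ext' fun w => LinearMap.ext_ring (h w)
  cases h with
  | comm i j h =>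
    refine ext1 _ _ fun w => ?_
    simp only [map_mul, FreeAlgebra.lift_ι_apply, Module.End.mul_apply, leftOp_single, map_add,
      desc_far h, desc_far' h, apply_ite (leftOp (n := n) _), map_smul, map_zero]
    simp only [← mul_assoc, simpleRefl_comm h]
    split_ifs <;> simp <;> abel
  | braid i j h =>
    refine ext1 _ _ fun w => ?_
    obtain ⟨d1, d2, d3, d4, d5, d6⟩ := desc_near h w
    have e1 := desc_simpleRefl_mul i w
    have e2 := desc_simpleRefl_mul j w
    have hbr : simpleRefl i * (simpleRefl j * (simpleRefl i * w)) =
        simpleRefl j * (simpleRefl i * (simpleRefl j * w)) := by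
      have := congrArg (· * w) (simpleRefl_braid h)
      simpa only [mul_assoc] using this
    have hne1 : w⁻¹ (lo i) ≠ w⁻¹ (lo j) := fun e => by
      have := w⁻¹.injective e; simp [lo] at this; omega
    have hne2 : w⁻¹ (lo j) ≠ w⁻¹ (hi j) := fun e => (lo_lt_hi j).ne (w⁻¹.injective e)
    have hne3 : w⁻¹ (lo i) ≠ w⁻¹ (hi j) := fun e => by
      have := w⁻¹.injective e; simp [lo, hi] at this; omega
    simp only [map_mul, FreeAlgebra.lift_ι_apply, Module.End.mul_apply, leftOp_single, map_add,
      apply_ite (leftOp (n := n) _), map_smul, map_zero, e1, e2, d1, d2, d3, d4, d5, d6, hbr,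
      simpleRefl_mul_cancel]
    rcases lt_or_gt_of_ne hne1 with c1 | c1 <;> rcases lt_or_gt_of_ne hne2 with c2 | c2 <;>
      rcases lt_or_gt_of_ne hne3 with c3 | c3 <;>
      first
        | (exfalso; omega)
        | (simp only [c1, c2, c3, c1.not_gt, c2.not_gt, c3.not_gt, not_true_eq_false,
            not_false_eq_true, if_true, if_false, smul_add, add_zero]
           try module)
  | quad i =>
    refine ext1 _ _ fun w => ?_
    have e1 := desc_simpleRefl_mul i w
    simp only [map_mul, FreeAlgebra.lift_ι_apply, Module.End.mul_apply, leftOp_single, map_add,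
      apply_ite (leftOp (n := n) _), map_smul, map_zero, e1, simpleRefl_mul_cancel, map_one,
      LinearMap.add_apply, LinearMap.smul_apply, Module.End.one_apply]
    split_ifs <;> simp

/-- The left regular representation in coordinates. -/
noncomputable def leftRep (n : ℕ) :
    Hecke n →ₐ[Polynomial ℤ] Module.End (Polynomial ℤ) (Equiv.Perm (Fin n) →₀ Polynomial ℤ) :=
  RingQuot.liftAlgHom (Polynomial ℤ)
    ⟨FreeAlgebra.lift (Polynomial ℤ) (leftOp (n := n)), fun _ _ h => leftOp_rel h⟩

theorem leftRep_gen {n : ℕ} (i : Fin (n - 1)) : leftRep n (gen i) = leftOp i := by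
  simp [leftRep, gen]

theorem leftRep_genProd {n : ℕ} (l : List (Fin (n - 1))) :
    l.length = len (wordProd l) →
    leftRep n (genProd l) (Finsupp.single 1 1) = Finsupp.single (wordProd l) 1 := by
  induction l with
  | nil => intro _; simp [genProd, wordProd]
  | cons i l ih =>
    intro h
    rw [wordProd_cons, List.length_cons] at h
    have h1 := len_simpleRefl_mul_le i (wordProd l)
    have h2 := len_le (l := l) rfl
    have h3 : ¬ Desc i (wordProd l) := fun hd => by
      have := hd.len_eq
      omega
    rw [genProd_cons, map_mul, Module.End.mul_apply, ih (by omega), leftRep_gen, leftOp_single,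
      if_neg h3, add_zero, wordProd_cons]

theorem leftRep_T {n : ℕ} (w : Equiv.Perm (Fin n)) :
    leftRep n (T w) (Finsupp.single 1 1) = Finsupp.single w 1 := by
  have h : (reducedWord w).length = len (wordProd (reducedWord w)) := by
    rw [wordProd_reducedWord, length_reducedWord]
  rw [T, leftRep_genProd _ h, wordProd_reducedWord]

theorem linearIndependent_T (n : ℕ) :
    LinearIndependent (Polynomial ℤ) (T : Equiv.Perm (Fin n) → Hecke n) := by
  let f : Hecke n →ₗ[Polynomial ℤ] (Equiv.Perm (Fin n) →₀ Polynomial ℤ) :=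
    (LinearMap.applyₗ (Finsupp.single 1 1)).comp (leftRep n).toLinearMap
  refine LinearIndependent.of_comp f ?_
  have h : f ∘ (T : Equiv.Perm (Fin n) → Hecke n) = Finsupp.basisSingleOne := by
    funext w
    simpa [f] using leftRep_T w
  rw [h]
  exact Finsupp.basisSingleOne.linearIndependent

theorem span_T (n : ℕ) :
    Submodule.span (Polynomial ℤ) (Set.range (T : Equiv.Perm (Fin n) → Hecke n)) = ⊤ := by
  set M := Submodule.span (Polynomial ℤ) (Set.range (T : Equiv.Perm (Fin n) → Hecke n)) with hM
  have hgen : ∀ i : Fin (n - 1), ∀ x ∈ M, (gen i : Hecke n) * x ∈ M := by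
    intro i x hx
    induction hx using Submodule.span_induction with
    | mem x hx =>
      obtain ⟨w, rfl⟩ := hx
      have hT : ∀ v : Equiv.Perm (Fin n), (T v : Hecke n) ∈ M := fun v =>
        Submodule.subset_span ⟨v, rfl⟩
      by_cases hd : Desc i w
      · rw [gen_mul_T_of_desc hd]
        exact M.add_mem (hT _) (M.smul_mem _ (hT _))
      · rw [gen_mul_T_of_not_desc hd]
        exact hT _
    | zero => simp
    | add x y _ _ hx hy => rw [mul_add]; exact M.add_mem hx hy
    | smul a x _ hx => rw [mul_smul_comm]; exact M.smul_mem _ hx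
  have hall : ∀ h : FreeAlgebra (Polynomial ℤ) (Fin (n - 1)), ∀ x ∈ M,
      RingQuot.mkAlgHom (Polynomial ℤ) (HeckeRel n) h * x ∈ M := by
    intro h
    induction h using FreeAlgebra.induction with
    | grade0 r =>
      intro x hx
      rw [AlgHom.commutes, ← Algebra.smul_def]
      exact M.smul_mem _ hx
    | grade1 i => exact hgen i
    | mul a b ha hb => intro x hx; rw [map_mul, mul_assoc]; exact ha _ (hb _ hx)
    | add a b ha hb =>
      intro x hx
      rw [map_add, add_mul]
      exact M.add_mem (ha _ hx) (hb _ hx)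
  rw [eq_top_iff]
  intro y _
  obtain ⟨h, rfl⟩ := RingQuot.mkAlgHom_surjective (Polynomial ℤ) (HeckeRel n) y
  have h1 : (1 : Hecke n) ∈ M := T_one (n := n) ▸ Submodule.subset_span ⟨1, rfl⟩
  simpa using hall h 1 h1

/-- The standard basis `(T_w)` of the Hecke algebra over `ℤ[ξ]`, indexed by `w ∈ S_n`. -/
noncomputable def basisT (n : ℕ) :
    Module.Basis (Equiv.Perm (Fin n)) (Polynomial ℤ) (Hecke n) :=
  Module.Basis.mk (linearIndependent_T n) (span_T n).ge

theorem basisT_apply {n : ℕ} (w : Equiv.Perm (Fin n)) : basisT n w = T w := by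
  simp [basisT]

/-! ### Compositions, partitions and multipartitions -/

/-- Juxtaposition of compositions. -/
def append {k l : ℕ} (c : Composition k) (d : Composition l) : Composition (k + l) where
  blocks := c.blocks ++ d.blocks
  blocks_pos := by
    intro i h
    rcases List.mem_append.mp h with h | h
    · exact c.blocks_pos h
    · exact d.blocks_pos h
  blocks_sum := by simp

/-- The composition `(k, l)` of `k + l`. -/
def twoBlocks (k l : ℕ) (hk : 0 < k) (hl : 0 < l) : Composition (k + l) :=
  append (Composition.single k hk) (Composition.single l hl)

/-- The composition `λ - 1`, which replaces each component `a > 1` of `λ` by the two components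
`a - 1` and `1`. -/
def minusOne {n : ℕ} (c : Composition n) : Composition n where
  blocks := c.blocks.flatMap fun a => if 1 < a then [a - 1, 1] else [a]
  blocks_pos := by
    intro i h
    obtain ⟨a, ha, hi⟩ := List.mem_flatMap.mp h
    have := c.blocks_pos ha
    split_ifs at hi with h1 <;> simp at hi <;> omega
  blocks_sum := by
    have key : ∀ L : List ℕ,
        (L.flatMap fun a => if 1 < a then [a - 1, 1] else [a]).sum = L.sum := by
      intro L
      induction L with
      | nil => rfl
      | cons a L ih =>
        rw [List.flatMap_cons, List.sum_append, ih, List.sum_cons]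
        split_ifs with h1 <;> simp; omega
    rw [key, c.blocks_sum]

/-- A partition regarded as a composition with weakly decreasing components. -/
def ofPartition {n : ℕ} (p : n.Partition) : Composition n where
  blocks := p.parts.sort (· ≥ ·)
  blocks_pos := fun h => p.parts_pos ((Multiset.mem_sort _).mp h)
  blocks_sum := by
    rw [← Multiset.sum_coe, Multiset.sort_eq, p.parts_sum]

/-- The set of `(k, l)`-multipartitions of the partition `α` of `k + l`: the pairs `(μ, ν)` of a
partition `μ` of `k` and a partition `ν` of `l` whose components are together the components
of `α`. -/
def multipartitions (k l : ℕ) (α : (k + l).Partition) : Finset (k.Partition × l.Partition) :=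
  Finset.univ.filter fun θ => θ.1.parts + θ.2.parts = α.parts

/-- The derived composition of a `(k, l)`-multipartition. -/
def derived {k l : ℕ} (θ : k.Partition × l.Partition) : Composition (k + l) :=
  append (ofPartition θ.1) (ofPartition θ.2)

/-! ### Parabolic subgroups and projections -/

/-- The `i`-th simple reflection belongs to the parabolic subgroup `S_λ`, that is, the two points
it exchanges are not separated by the end of a block of `λ`. -/
def Interior {n : ℕ} (c : Composition n) (i : Fin (n - 1)) : Prop :=
  ∀ j : ℕ, c.sizeUpTo j ≠ (i : ℕ) + 1

/-- The parabolic subgroup `S_λ`. -/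
def parabolic {n : ℕ} (c : Composition n) : Subgroup (Equiv.Perm (Fin n)) :=
  Subgroup.closure (simpleRefl '' {i | Interior c i})

open Classical in
/-- The Coxeter element `w_λ` of `S_λ`: the product in increasing order of the simple reflections
in `S_λ`. -/
noncomputable def coxeterElement {n : ℕ} (c : Composition n) : Equiv.Perm (Fin n) :=
  wordProd ((List.finRange (n - 1)).filter fun i => decide (Interior c i))

open Classical in
/-- The projection `π_λ` onto the parabolic subalgebra `H_λ`, as a linear endomorphism of the
Hecke algebra: it fixes `T_w` for `w ∈ S_λ` and sends the other `T_w` to zero. -/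
noncomputable def proj {n : ℕ} (c : Composition n) : Hecke n →ₗ[Polynomial ℤ] Hecke n :=
  (basisT n).constr (Polynomial ℤ) fun w => if w ∈ parabolic c then T w else 0

/-! ### Relative norms -/

/-- `d` is a distinguished right coset representative of `H` in `G`: it lies in `G` and has
minimal length in the coset `H d`. -/
def Distinguished {n : ℕ} (G H : Subgroup (Equiv.Perm (Fin n))) (d : Equiv.Perm (Fin n)) : Prop :=
  d ∈ G ∧ ∀ u ∈ H, len d ≤ len (u * d)

open Classical in
/-- The relative norm of `h` from `H` to `G`, for parabolic subgroups `H ≤ G`. -/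
noncomputable def relNorm {n : ℕ} (G H : Subgroup (Equiv.Perm (Fin n))) (h : Hecke n) : Hecke n :=
  ∑ d ∈ Finset.univ.filter (fun d => Distinguished G H d), T d⁻¹ * h * T d

/-- The Coxeter class element `η_λ` of `H_λ`. -/
noncomputable def eta {n : ℕ} (c : Composition n) : Hecke n :=
  relNorm (parabolic (minusOne c)) ⊥ (T (coxeterElement c))

/-- The element `b_α` of the norm basis, the relative norm of `η_α` from `S_α` to `S_n`. -/
noncomputable def normElement {n : ℕ} (α : n.Partition) : Hecke n :=
  relNorm ⊤ (parabolic (ofPartition α)) (eta (ofPartition α))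

/-- The normalizer of `H` in `G`, for subgroups `H ≤ G`. -/
def normalizerIn {n : ℕ} (G H : Subgroup (Equiv.Perm (Fin n))) :
    Subgroup (Equiv.Perm (Fin n)) :=
  Subgroup.normalizer (H : Set (Equiv.Perm (Fin n))) ⊓ G

end NormBasis

/-!
Write `W_J` for the parabolic subgroup of `S_n` generated by the `s_i` with `i ∈ J`, write `η_J`
for its Coxeter class element, and let `Λ` and `J` be the sets belonging to `(k, l)` and to `α`.

*The Coxeter class element.* Splitting the norm that defines `η_J` along the chain of truncations
of `J` shows that `η_J` is the product of the Jucys–Murphy elements of the blocks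
(`etaSet_eq_jmProd`). Two properties follow. First, `η_J` is central in the subalgebra of `W_J`
(`commute_etaSet`). Second, every `T_w` occurring in `η_J` has full support, that is, `w` lies in
no proper parabolic subgroup of `W_J` (`etaSet_mem_supported`).

*The Mackey formula.* Sort the distinguished representatives of `W_J` in `S_n` by double cosets
`W_J d W_Λ`; this writes `π(b_α)` as a sum over distinguished double coset representatives `d`.
The trace form sees only the group element in `π(T_{d⁻¹} T_w T_d)`: the projection is
`T_{d⁻¹ w d}` if `d⁻¹ w d ∈ W_Λ`, and zero otherwise (`projSet_conj_T`). An element `w` of full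
support is conjugated into `W_Λ` only if all of `W_J` is, so only those `d` survive for which
`d⁻¹ W_J d ⊆ W_Λ`. For these, `d⁻¹ W_J d` is again a standard parabolic subgroup `W_K`, and the
contribution of `d` is the relative norm of `η_K` (`projSet_normSet`).

*Independence of the representative.* If `e ∈ W_Λ` maps the blocks of `J` to those of `K`, then
conjugation by `T_{e⁻¹}` maps the subalgebra of `W_J` to that of `W_K` and `η_J` to `η_K`. A
relative norm of a central element is formed with a pair of dual bases over the subalgebra and
does not depend on their choice; so the two relative norms agree (`BlockIso.normSet_eq`). Hence
the contribution of `d` depends only on the class of `d⁻¹ W_J d` under `W_Λ`. These classes are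
in bijection with the multipartitions (`exists_hasType`, `eq_of_carriesBlocks`), and the number
of `d` in a class is the index of the normalizers (`card_hasType`), which proves existence with
the asserted coefficients.

*Uniqueness.* At `ξ = 0` the Hecke algebra becomes the group ring, and the coefficient at the
Coxeter element of `(μ, ν)` is positive for the relative norm belonging to `(μ, ν)` and zero for
all others (`evalCoord_normSet_pos`, `evalCoord_normSet_eq_zero`), because a Coxeter element
determines its parabolic subgroup through its orbits. So the coefficients are determined by
`π(b_α)`.
-/

namespace NormBasis

/-! ### Lengths and multiplication of basis elements -/

variable {n : ℕ}

@[simp] theorem lo_val (i : Fin (n - 1)) : ((lo i : Fin n) : ℕ) = i := rfl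

@[simp] theorem hi_val (i : Fin (n - 1)) : ((hi i : Fin n) : ℕ) = i + 1 := rfl

theorem simpleRefl_apply_val (i : Fin (n - 1)) (x : Fin n) :
    ((simpleRefl i x : Fin n) : ℕ) =
      if (x : ℕ) = i then (i : ℕ) + 1 else if (x : ℕ) = i + 1 then (i : ℕ) else x := by
  simp only [simpleRefl, Equiv.swap_apply_def, Fin.ext_iff, lo_val, hi_val]
  split_ifs <;> simp

theorem simpleRefl_lo (i : Fin (n - 1)) : simpleRefl i (lo i : Fin n) = hi i := by
  simp [simpleRefl]

theorem simpleRefl_hi (i : Fin (n - 1)) : simpleRefl i (hi i : Fin n) = lo i := by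
  simp [simpleRefl]

theorem simpleRefl_mem_stab {i : Fin (n - 1)} {m : ℕ} (h : (i : ℕ) ≠ m) (x : Fin n) :
    (x : ℕ) ≤ m ↔ ((simpleRefl i x : Fin n) : ℕ) ≤ m := by
  rw [simpleRefl_apply_val]; split_ifs <;> omega

theorem wordProd_append (l l' : List (Fin (n - 1))) :
    wordProd (l ++ l') = wordProd l * wordProd l' := by
  simp [wordProd]

theorem genProd_append (l l' : List (Fin (n - 1))) :
    (genProd (l ++ l') : Hecke n) = genProd l * genProd l' := by
  simp [genProd]

theorem wordProd_reverse (l : List (Fin (n - 1))) : wordProd l.reverse = (wordProd l)⁻¹ := by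
  induction l with
  | nil => simp [wordProd]
  | cons i l ih =>
    rw [List.reverse_cons, wordProd_append, ih, wordProd_cons i l, mul_inv_rev, simpleRefl_inv]
    simp [wordProd]

theorem len_inv (w : Equiv.Perm (Fin n)) : len w⁻¹ = len w := by
  have key : ∀ v : Equiv.Perm (Fin n), len v⁻¹ ≤ len v := fun v => by
    obtain ⟨l, h1, h2⟩ := exists_reduced v
    have := len_le (l := l.reverse) (w := v⁻¹) (by rw [wordProd_reverse, h1])
    simpa [h2] using this
  exact le_antisymm (key w) (by simpa using key w⁻¹)

theorem len_one : len (1 : Equiv.Perm (Fin n)) = 0 :=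
  Nat.le_zero.mp (len_le (l := []) rfl)

theorem T_mul_T_of_len {x y : Equiv.Perm (Fin n)} (h : len (x * y) = len x + len y) :
    (T x : Hecke n) * T y = T (x * y) := by
  rw [T, T, ← genProd_append]
  refine genProd_eq_T ?_ ?_
  · rw [wordProd_append, wordProd_reducedWord, wordProd_reducedWord]
  · rw [List.length_append, length_reducedWord, length_reducedWord, h]

theorem gen_eq_T (i : Fin (n - 1)) : (gen i : Hecke n) = T (simpleRefl i) := by
  have h : ¬ Desc i (1 : Equiv.Perm (Fin n)) := by
    simp only [Desc, inv_one, Equiv.Perm.one_apply, not_lt]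
    exact (lo_lt_hi i).le
  have := gen_mul_T_of_not_desc h
  rwa [T_one, mul_one, mul_one] at this

theorem len_simpleRefl (i : Fin (n - 1)) : len (simpleRefl i : Equiv.Perm (Fin n)) = 1 := by
  have h : ¬ Desc i (1 : Equiv.Perm (Fin n)) := by
    simp only [Desc, inv_one, Equiv.Perm.one_apply, not_lt]
    exact (lo_lt_hi i).le
  have := len_of_not_desc h
  rwa [mul_one, len_one] at this

theorem not_desc_iff (i : Fin (n - 1)) (w : Equiv.Perm (Fin n)) :
    ¬ Desc i w ↔ w⁻¹ (lo i) < w⁻¹ (hi i) := by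
  have hne : w⁻¹ (lo i) ≠ w⁻¹ (hi i) := fun h => (lo_lt_hi i).ne (w⁻¹.injective h)
  simp only [Desc, not_lt]
  exact ⟨fun h => lt_of_le_of_ne h hne, fun h => h.le⟩

theorem len_mul_simpleRefl {i : Fin (n - 1)} {w : Equiv.Perm (Fin n)} (h : w (lo i) < w (hi i)) :
    len (w * simpleRefl i) = len w + 1 := by
  have h1 : ¬ Desc i w⁻¹ := by rw [not_desc_iff]; simpa using h
  have := len_of_not_desc h1
  rw [← len_inv, mul_inv_rev, simpleRefl_inv, this, len_inv]

theorem T_mul_gen {i : Fin (n - 1)} {w : Equiv.Perm (Fin n)} (h : w (lo i) < w (hi i)) :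
    (T w : Hecke n) * gen i = T (w * simpleRefl i) := by
  rw [gen_eq_T]
  exact T_mul_T_of_len (by rw [len_mul_simpleRefl h, len_simpleRefl])

theorem T_mul_gen_of_gt {i : Fin (n - 1)} {w : Equiv.Perm (Fin n)} (h : w (hi i) < w (lo i)) :
    (T w : Hecke n) * gen i =
      T (w * simpleRefl i) + (Polynomial.X : Polynomial ℤ) • T w := by
  have h' : (w * simpleRefl i) (lo i) < (w * simpleRefl i) (hi i) := by
    simpa [simpleRefl_lo, simpleRefl_hi] using h
  have h1 := T_mul_gen h'
  rw [mul_assoc, simpleRefl_mul_self, mul_one] at h1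
  rw [← h1, mul_assoc, gen_quad, mul_add, mul_one, mul_smul_comm]

theorem exists_desc {w : Equiv.Perm (Fin n)} (h : w ≠ 1) : ∃ i : Fin (n - 1), Desc i w := by
  obtain ⟨l, h1, h2⟩ := exists_reduced w
  match l with
  | [] => exact absurd h1.symm h
  | i :: l =>
    refine ⟨i, desc_of_len ?_⟩
    have : wordProd l = simpleRefl i * w := by rw [← h1, wordProd_cons, simpleRefl_mul_cancel]
    have h3 := len_le this
    simp only [List.length_cons] at h2
    omega

/-! ### Parabolic subgroups as stabilizers -/

/-- Two points lie in the same block of the set `J` of simple reflections: they are not separated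
by any cut between `i` and `i + 1` with `i ∉ J`. Sets of simple reflections are encoded as sets of
natural numbers, of which only the elements `i` with `i + 1 < n` matter. -/
def SameBlock (J : Set ℕ) (x y : Fin n) : Prop := ∀ i, i ∉ J → ((x : ℕ) ≤ i ↔ (y : ℕ) ≤ i)

theorem SameBlock.refl (J : Set ℕ) (x : Fin n) : SameBlock J x x := fun _ _ => Iff.rfl

theorem SameBlock.symm {J : Set ℕ} {x y : Fin n} (h : SameBlock J x y) : SameBlock J y x :=
  fun i hi => (h i hi).symm

theorem SameBlock.trans {J : Set ℕ} {x y z : Fin n} (h : SameBlock J x y)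
    (h' : SameBlock J y z) : SameBlock J x z :=
  fun i hi => (h i hi).trans (h' i hi)

theorem SameBlock.mono {J K : Set ℕ} (hJK : J ⊆ K) {x y : Fin n} (h : SameBlock J x y) :
    SameBlock K x y := fun i hi => h i fun h' => hi (hJK h')

theorem sameBlock_iff_of_le {J : Set ℕ} {x y : Fin n} (hxy : x ≤ y) :
    SameBlock J x y ↔ ∀ i : ℕ, (x : ℕ) ≤ i → i < y → i ∈ J := by
  have hxy' : (x : ℕ) ≤ y := hxy
  constructor
  · intro h i h1 h2
    by_contra hi
    have := (h i hi).mp h1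
    omega
  · intro h i hi
    constructor
    · intro h1
      by_contra h2
      exact hi (h i h1 (by omega))
    · intro h1; omega

theorem sameBlock_lo_hi {J : Set ℕ} {i : Fin (n - 1)} :
    SameBlock J (lo i : Fin n) (hi i) ↔ (i : ℕ) ∈ J := by
  rw [sameBlock_iff_of_le (lo_lt_hi i).le]
  simp only [lo_val, hi_val]
  constructor
  · intro h; exact h i le_rfl (by omega)
  · intro h j h1 h2
    have : j = i := by omega
    rwa [this]

/-- The parabolic subgroup generated by the simple reflections in `J`, described as the group of
permutations that preserve the blocks of `J`; see `parab_eq_closure`. -/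
def parab (n : ℕ) (J : Set ℕ) : Subgroup (Equiv.Perm (Fin n)) where
  carrier := {w | ∀ x, SameBlock J x (w x)}
  one_mem' := fun x => SameBlock.refl J x
  mul_mem' := fun {a b} ha hb x => (hb x).trans (ha (b x))
  inv_mem' := fun {a} ha x => by
    simpa using (ha (a⁻¹ x)).symm

theorem mem_parab {J : Set ℕ} {w : Equiv.Perm (Fin n)} :
    w ∈ parab n J ↔ ∀ x, SameBlock J x (w x) := Iff.rfl

theorem parab_mono {J K : Set ℕ} (h : J ⊆ K) : parab n J ≤ parab n K :=
  fun _ hw x => (hw x).mono h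

theorem swap_mem_parab {J : Set ℕ} {x y : Fin n} (h : SameBlock J x y) :
    Equiv.swap x y ∈ parab n J := by
  intro z
  rw [Equiv.swap_apply_def]
  split_ifs with h1 h2
  · rw [h1]; exact h
  · rw [h2]; exact h.symm
  · exact SameBlock.refl J z

theorem simpleRefl_mem_parab {J : Set ℕ} {i : Fin (n - 1)} :
    simpleRefl i ∈ parab n J ↔ (i : ℕ) ∈ J := by
  constructor
  · intro h
    have := h (lo i)
    rwa [simpleRefl_lo, sameBlock_lo_hi] at this
  · intro h
    exact swap_mem_parab (sameBlock_lo_hi.mpr h)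

theorem mem_of_desc {J : Set ℕ} {w : Equiv.Perm (Fin n)} (hw : w ∈ parab n J) {i : Fin (n - 1)}
    (h : Desc i w) : (i : ℕ) ∈ J := by
  by_contra hi'
  have hw' := (parab n J).inv_mem hw
  have h1 := (hw' (lo i) i hi').mp (by simp)
  have h2 := mt (hw' (hi i) i hi').mpr (by simp)
  have h3 : ((w⁻¹ (hi i) : Fin n) : ℕ) < w⁻¹ (lo i) := h
  omega

/-- Induction over a parabolic subgroup along reduced expressions. -/
theorem parab_induction {J : Set ℕ} {p : Equiv.Perm (Fin n) → Prop} (one : p 1)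
    (mul : ∀ (i : Fin (n - 1)) (w : Equiv.Perm (Fin n)), (i : ℕ) ∈ J → w ∈ parab n J →
      ¬ Desc i w → p w → p (simpleRefl i * w)) :
    ∀ w ∈ parab n J, p w := by
  have key : ∀ m : ℕ, ∀ w ∈ parab n J, len w = m → p w := by
    intro m
    induction m with
    | zero =>
      intro w hw hm
      by_cases h1 : w = 1
      · rwa [h1]
      · obtain ⟨i, hi'⟩ := exists_desc h1
        have := hi'.len_eq
        omega
    | succ m ih =>
      intro w hw hm
      by_cases h1 : w = 1
      · rwa [h1]
      · obtain ⟨i, hi'⟩ := exists_desc h1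
        have hJ := mem_of_desc hw hi'
        have h2 : simpleRefl i * w ∈ parab n J :=
          (parab n J).mul_mem (simpleRefl_mem_parab.mpr hJ) hw
        have h3 := mul i (simpleRefl i * w) hJ h2
          (by rw [desc_simpleRefl_mul]; exact not_not.mpr hi')
          (ih _ h2 (by have := hi'.len_eq; omega))
        rwa [simpleRefl_mul_cancel] at h3
  intro w hw
  exact key _ w hw rfl

theorem parab_eq_closure (J : Set ℕ) :
    parab n J = Subgroup.closure (simpleRefl '' {i : Fin (n - 1) | (i : ℕ) ∈ J}) := by
  apply le_antisymm
  · intro w hw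
    refine parab_induction (p := fun w => w ∈ Subgroup.closure _) (Subgroup.one_mem _) ?_ w hw
    intro i w hi' _ _ ih
    exact Subgroup.mul_mem _ (Subgroup.subset_closure ⟨i, hi', rfl⟩) ih
  · rw [Subgroup.closure_le]
    rintro _ ⟨i, hi', rfl⟩
    exact simpleRefl_mem_parab.mpr hi'

theorem parab_univ : parab n Set.univ = ⊤ := by
  rw [eq_top_iff]
  intro w _ x i hi'
  exact absurd (Set.mem_univ i) hi'

/-! ### Distinguished coset representatives -/

/-- No simple reflection in `J` shortens `d` from the left; equivalently, `d` is the shortest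
element of its coset of the parabolic subgroup of `J`, see `distinguished_iff`. -/
def LeftMin (J : Set ℕ) (d : Equiv.Perm (Fin n)) : Prop :=
  ∀ i : Fin (n - 1), (i : ℕ) ∈ J → ¬ Desc i d

/-- The inverse of a distinguished coset representative is increasing on every block. -/
theorem LeftMin.lt {J : Set ℕ} {d : Equiv.Perm (Fin n)} (hd : LeftMin J d) {x y : Fin n}
    (hxy : x < y) (h : SameBlock J x y) : d⁻¹ x < d⁻¹ y := by
  obtain ⟨x, hx⟩ := x
  obtain ⟨y, hy⟩ := y
  rw [sameBlock_iff_of_le hxy.le] at h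
  simp only [Fin.mk_lt_mk] at hxy h
  induction y with
  | zero => omega
  | succ y ih =>
    have h1 := (not_desc_iff _ _).mp (hd ⟨y, by omega⟩ (h y (by omega) (by omega)))
    rcases Nat.lt_or_ge x y with h2 | h2
    · exact (ih (by omega) (fun i h3 h4 => h i h3 (by omega)) h2).trans h1
    · have : x = y := by omega
      subst this
      exact h1

theorem LeftMin.not_desc_mul {J : Set ℕ} {d u : Equiv.Perm (Fin n)} (hd : LeftMin J d)
    (hu : u ∈ parab n J) {i : Fin (n - 1)} (hi' : (i : ℕ) ∈ J) (h : ¬ Desc i u) :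
    ¬ Desc i (u * d) := by
  rw [not_desc_iff] at h ⊢
  simp only [mul_inv_rev, Equiv.Perm.mul_apply]
  refine hd.lt h ?_
  have hu' := (parab n J).inv_mem hu
  exact ((hu' (lo i)).symm.trans (sameBlock_lo_hi.mpr hi')).trans (hu' (hi i))

theorem LeftMin.len_mul {J : Set ℕ} {d : Equiv.Perm (Fin n)} (hd : LeftMin J d) :
    ∀ u ∈ parab n J, len (u * d) = len u + len d := by
  refine parab_induction (by rw [one_mul, len_one, zero_add]) ?_
  intro i u hi' hu h ih
  rw [mul_assoc, len_of_not_desc (hd.not_desc_mul hu hi' h), ih, len_of_not_desc h]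
  omega

theorem LeftMin.len_inv_mul {J : Set ℕ} {d : Equiv.Perm (Fin n)} (hd : LeftMin J d)
    {u : Equiv.Perm (Fin n)} (hu : u ∈ parab n J) : len (d⁻¹ * u) = len d⁻¹ + len u := by
  have := hd.len_mul u⁻¹ ((parab n J).inv_mem hu)
  rw [← len_inv, mul_inv_rev, inv_inv, this, len_inv, len_inv, add_comm]

theorem LeftMin.T_mul {J : Set ℕ} {d : Equiv.Perm (Fin n)} (hd : LeftMin J d)
    {u : Equiv.Perm (Fin n)} (hu : u ∈ parab n J) : (T u : Hecke n) * T d = T (u * d) :=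
  T_mul_T_of_len (hd.len_mul u hu)

theorem LeftMin.T_inv_mul {J : Set ℕ} {d : Equiv.Perm (Fin n)} (hd : LeftMin J d)
    {u : Equiv.Perm (Fin n)} (hu : u ∈ parab n J) : (T d⁻¹ : Hecke n) * T u = T (d⁻¹ * u) :=
  T_mul_T_of_len (hd.len_inv_mul hu)

theorem distinguished_iff {G : Subgroup (Equiv.Perm (Fin n))} {J : Set ℕ}
    {d : Equiv.Perm (Fin n)} :
    Distinguished G (parab n J) d ↔ d ∈ G ∧ LeftMin J d := by
  refine and_congr_right fun _ => ⟨fun h i hi' hd => ?_, fun h u hu => ?_⟩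
  · have h1 := h _ (simpleRefl_mem_parab.mpr hi')
    have h2 := hd.len_eq
    omega
  · rw [h.len_mul u hu]
    omega

theorem LeftMin.eq_of_mul_eq {J : Set ℕ} {d d' u u' : Equiv.Perm (Fin n)} (hd : LeftMin J d)
    (hd' : LeftMin J d') (hu : u ∈ parab n J) (hu' : u' ∈ parab n J) (h : u * d = u' * d') :
    u = u' ∧ d = d' := by
  have e1 : d = u⁻¹ * u' * d' := by rw [mul_assoc, ← h, inv_mul_cancel_left]
  have e2 : d' = (u⁻¹ * u')⁻¹ * d := by rw [e1, inv_mul_cancel_left]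
  have hm := (parab n J).mul_mem ((parab n J).inv_mem hu) hu'
  have l1 := hd'.len_mul _ hm
  have l2 := hd.len_mul _ ((parab n J).inv_mem hm)
  rw [← e1] at l1
  rw [← e2] at l2
  have h0 : len (u⁻¹ * u') = 0 := by omega
  have h1 : u⁻¹ * u' = 1 := by
    by_contra hne
    obtain ⟨i, hi'⟩ := exists_desc hne
    have := hi'.len_eq
    omega
  rw [inv_mul_eq_one] at h1
  exact ⟨h1, by rw [h1] at h; exact mul_left_cancel h⟩

/-- Every element factors through a distinguished coset representative. -/
theorem exists_leftMin_mul (J : Set ℕ) (x : Equiv.Perm (Fin n)) :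
    ∃ u ∈ parab n J, ∃ d, LeftMin J d ∧ u * d = x := by
  have key : ∀ m : ℕ, ∀ x : Equiv.Perm (Fin n), len x = m →
      ∃ u ∈ parab n J, ∃ d, LeftMin J d ∧ u * d = x := by
    intro m
    induction m using Nat.strong_induction_on with
    | _ m ih =>
      intro x hx
      by_cases h : LeftMin J x
      · exact ⟨1, Subgroup.one_mem _, x, h, one_mul x⟩
      · simp only [LeftMin, not_forall, not_not] at h
        obtain ⟨i, hi', hd⟩ := h
        obtain ⟨u, hu, d, h1, h2⟩ := ih (len (simpleRefl i * x)) (by have := hd.len_eq; omega)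
          _ rfl
        refine ⟨simpleRefl i * u, Subgroup.mul_mem _ (simpleRefl_mem_parab.mpr hi') hu, d, h1, ?_⟩
        rw [mul_assoc, h2, simpleRefl_mul_cancel]
  exact key _ x rfl

/-! ### The symmetrizing trace -/

/-- The symmetrizing trace: the coefficient of the identity in the standard basis. -/
noncomputable def tau : Hecke n →ₗ[Polynomial ℤ] Polynomial ℤ := (basisT n).coord 1

theorem coord_T (v w : Equiv.Perm (Fin n)) :
    (basisT n).coord v (T w) = if w = v then 1 else 0 := by
  rw [← basisT_apply, Module.Basis.coord_apply, Module.Basis.repr_self, Finsupp.single_apply]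

theorem tau_T (w : Equiv.Perm (Fin n)) : tau (T w : Hecke n) = if w = 1 then 1 else 0 :=
  coord_T 1 w

/-- The bases `T_x` and `T_{x⁻¹}` are dual to each other with respect to the trace form. -/
theorem tau_T_mul_T (x y : Equiv.Perm (Fin n)) :
    tau ((T x : Hecke n) * T y) = if x * y = 1 then 1 else 0 := by
  have key : ∀ x ∈ parab n Set.univ, ∀ y : Equiv.Perm (Fin n),
      tau ((T x⁻¹ : Hecke n) * T y) = if x⁻¹ * y = 1 then 1 else 0 := by
    refine parab_induction ?_ ?_
    · intro y
      rw [inv_one, T_one, one_mul, one_mul, tau_T]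
    · intro i w _ _ hd ih y
      have hd' := (not_desc_iff _ _).mp hd
      rw [mul_inv_rev, simpleRefl_inv, ← T_mul_gen hd', mul_assoc, mul_assoc]
      by_cases hy : Desc i y
      · rw [gen_mul_T_of_desc hy, mul_add, map_add, ih, mul_smul_comm, map_smul, ih,
          if_neg (c := w⁻¹ * y = 1), smul_zero, add_zero]
        intro h
        rw [inv_mul_eq_one] at h
        exact hd (h ▸ hy)
      · rw [gen_mul_T_of_not_desc hy, ih]
  simpa using key x⁻¹ (by rw [parab_univ]; trivial) y

theorem linearMap_ext_T {M : Type*} [AddCommGroup M] [Module (Polynomial ℤ) M]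
    {f g : Hecke n →ₗ[Polynomial ℤ] M} (h : ∀ w, f (T w) = g (T w)) : f = g :=
  (basisT n).ext fun w => by rw [basisT_apply, h]

theorem tau_mul_comm (a b : Hecke n) : tau (a * b) = tau (b * a) := by
  have : (LinearMap.mul (Polynomial ℤ) (Hecke n)).compr₂ tau =
      (LinearMap.mul (Polynomial ℤ) (Hecke n)).flip.compr₂ tau := by
    refine linearMap_ext_T fun x => linearMap_ext_T fun y => ?_
    simp only [LinearMap.compr₂_apply, LinearMap.mul_apply', LinearMap.flip_apply, tau_T_mul_T]
    exact if_congr mul_eq_one_comm rfl rfl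
  exact congrArg (fun f => f a b) this

theorem coord_eq_tau (v : Equiv.Perm (Fin n)) (a : Hecke n) :
    (basisT n).coord v a = tau (a * T v⁻¹) := by
  have : (basisT n).coord v = tau ∘ₗ (LinearMap.mul (Polynomial ℤ) (Hecke n)).flip (T v⁻¹) := by
    refine linearMap_ext_T fun w => ?_
    rw [coord_T, LinearMap.comp_apply, LinearMap.flip_apply, LinearMap.mul_apply', tau_T_mul_T]
    simp only [mul_inv_eq_one]
  exact congrArg (fun f => f a) this

theorem ext_coord {a b : Hecke n} (h : ∀ v, (basisT n).coord v a = (basisT n).coord v b) :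
    a = b :=
  (basisT n).ext_elem h

/-! ### Jucys–Murphy elements and their product -/

/-- The generators indexed by natural numbers; the value is zero out of range. -/
noncomputable def gN (n i : ℕ) : Hecke n :=
  if h : i < n - 1 then gen ⟨i, h⟩ else 0

theorem gN_val (i : Fin (n - 1)) : gN n i = gen i := by
  simp [gN]

theorem gN_comm {i j : ℕ} (h : i + 2 ≤ j) : Commute (gN n i) (gN n j) := by
  unfold gN Commute SemiconjBy
  split_ifs with h1 h2
  · exact gen_comm _ _ h
  all_goals simp

theorem gN_braid (i : ℕ) :
    gN n i * gN n (i + 1) * gN n i = gN n (i + 1) * gN n i * gN n (i + 1) := by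
  unfold gN
  split_ifs with h1 h2
  · exact gen_braid _ _ rfl
  all_goals simp

theorem gN_quad {i : ℕ} (h : i + 1 < n) :
    gN n i * gN n i = 1 + (Polynomial.X : Polynomial ℤ) • gN n i := by
  have h1 : i < n - 1 := by omega
  rw [gN, dif_pos h1]
  exact gen_quad _

open Classical in
/-- The sum `h + g_{a-1} h g_{a-1} + g_{a-2} g_{a-1} h g_{a-1} g_{a-2} + ⋯`, continued as long as
the indices `a - 1, a - 2, …` lie in `J`. -/
noncomputable def chain (J : Set ℕ) : ℕ → Hecke n → Hecke n
  | 0, h => h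
  | a + 1, h => h + if a ∈ J then chain J a (gN n a * h * gN n a) else 0

/-- The Jucys–Murphy element of the point `m + 1` in its block, for `m ∈ J`: the sum of the `T_t`
over the transpositions `t = (j, m + 1)` with `j ≤ m` such that `j, …, m - 1` lie in `J`. -/
noncomputable def jucysMurphy (n : ℕ) (J : Set ℕ) (m : ℕ) : Hecke n := chain J m (gN n m)

open Classical in
/-- The product of the Jucys–Murphy elements attached to the indices in `J` below `m`. -/
noncomputable def jmProd (n : ℕ) (J : Set ℕ) : ℕ → Hecke n
  | 0 => 1
  | m + 1 => jmProd n J m * if m ∈ J then jucysMurphy n J m else 1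

theorem jmProd_succ_of_mem {J : Set ℕ} {m : ℕ} (h : m ∈ J) :
    jmProd n J (m + 1) = jmProd n J m * jucysMurphy n J m := by
  simp [jmProd, h]

theorem jmProd_succ_of_notMem {J : Set ℕ} {m : ℕ} (h : m ∉ J) :
    jmProd n J (m + 1) = jmProd n J m := by
  simp [jmProd, h]

theorem chain_commute {J : Set ℕ} {x : Hecke n} (a : ℕ)
    (hx : ∀ i < a, i ∈ J → Commute x (gN n i)) :
    ∀ h, Commute x h → Commute x (chain J a h) := by
  induction a with
  | zero => intro h hh; exact hh
  | succ a ih =>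
    intro h hh
    rw [chain]
    refine hh.add_right ?_
    split_ifs with ha
    · have h1 := hx a (by omega) ha
      exact ih (fun i hi' => hx i (by omega)) _ ((h1.mul_right hh).mul_right h1)
    · exact Commute.zero_right _

theorem chain_mul_mul {J : Set ℕ} {x y : Hecke n} (a : ℕ)
    (hx : ∀ i < a, i ∈ J → Commute x (gN n i)) (hy : ∀ i < a, i ∈ J → Commute y (gN n i)) :
    ∀ h, chain J a (x * h * y) = x * chain J a h * y := by
  induction a with
  | zero => intro h; rfl
  | succ a ih =>
    intro h
    rw [chain, chain, mul_add, add_mul]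
    congr 1
    split_ifs with ha
    · rw [← ih (fun i hi' => hx i (by omega)) (fun i hi' => hy i (by omega))]
      have h1 := hx a (by omega) ha
      have h2 := hy a (by omega) ha
      congr 1
      simp only [mul_assoc]
      rw [h2.eq, ← mul_assoc, ← h1.eq, mul_assoc]
    · simp

/-- The recursion `L_{m+1} = g_{m+1} L_m g_{m+1} + g_{m+1}` inside a block. It follows from the
braid relation, because `g_{m+1}` commutes with the generators that occur in the remaining
conjugations. -/
theorem jucysMurphy_succ {J : Set ℕ} {m : ℕ} (h : m ∈ J) :
    jucysMurphy n J (m + 1) =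
      gN n (m + 1) * jucysMurphy n J m * gN n (m + 1) + gN n (m + 1) := by
  have hc : ∀ i < m, i ∈ J → Commute (gN n (m + 1)) (gN n i) := fun i hi' _ =>
    (gN_comm (by omega)).symm
  rw [jucysMurphy, chain, if_pos h, gN_braid, chain_mul_mul m hc hc, add_comm, jucysMurphy]

theorem jucysMurphy_succ_of_notMem {J : Set ℕ} {m : ℕ} (h : m ∉ J) :
    jucysMurphy n J (m + 1) = gN n (m + 1) := by
  rw [jucysMurphy, chain, if_neg h, add_zero]

theorem commute_jucysMurphy_of_gt {J : Set ℕ} {m j : ℕ} (h : m + 2 ≤ j) :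
    Commute (gN n j) (jucysMurphy n J m) :=
  chain_commute m (fun _ _ _ => (gN_comm (by omega)).symm) _ (gN_comm h).symm

/-- Both at the beginning of a block and inside it, a Jucys–Murphy element has the shape to which
`commute_conj_conj` applies. -/
theorem exists_jucysMurphy_eq (J : Set ℕ) (m : ℕ) :
    ∃ X : Hecke n, jucysMurphy n J m = gN n m * X * gN n m + gN n m ∧
      ∀ j, m + 1 ≤ j → Commute (gN n j) X := by
  cases m with
  | zero => exact ⟨0, by simp [jucysMurphy, chain], fun j _ => Commute.zero_right _⟩
  | succ m =>
    by_cases h : m ∈ J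
    · exact ⟨_, jucysMurphy_succ h, fun j hj => commute_jucysMurphy_of_gt (by omega)⟩
    · exact ⟨0, by simp [jucysMurphy_succ_of_notMem h], fun j _ => Commute.zero_right _⟩

/-- The rank two computation behind the commutation of `g_m` with the Jucys–Murphy element
`L_{m+1}`: here `a = g_m`, `b = g_{m+1}`, and `L_m = a x a + a`. -/
theorem commute_conj_conj {a b x : Hecke n} {r : Polynomial ℤ}
    (hq : a * a = 1 + r • a) (hb : a * b * a = b * a * b) (hx : Commute b x) :
    Commute a (b * (a * x * a + a) * b + b) := by
  have e1 : a * (b * (a * x * a + a) * b + b) =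
      b * a * x * (a * b * a) + a * (a * b * a) + a * b := by
    rw [hb]
    calc _ = (a * b * a) * x * (a * b) + a * (b * a * b) + a * b := by noncomm_ring
      _ = b * a * (b * x) * (a * b) + a * (b * a * b) + a * b := by rw [hb]; noncomm_ring
      _ = b * a * (x * b) * (a * b) + a * (b * a * b) + a * b := by rw [hx.eq]
      _ = _ := by noncomm_ring
  have e2 : (b * (a * x * a + a) * b + b) * a =
      b * a * x * (a * b * a) + (a * b * a) * a + b * a := by
    rw [hb]
    calc _ = b * a * x * (a * b * a) + (b * a * b) * a + b * a := by noncomm_ring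
      _ = _ := by rw [hb]
  have e3 : a * (a * b * a) = b * a + r • (a * b * a) := by
    calc _ = (a * a) * b * a := by noncomm_ring
      _ = _ := by rw [hq]; simp [add_mul, mul_assoc]
  have e4 : (a * b * a) * a = a * b + r • (a * b * a) := by
    calc _ = a * b * (a * a) := by noncomm_ring
      _ = _ := by rw [hq]; simp [mul_add, mul_assoc]
  rw [Commute, SemiconjBy, e1, e2, e3, e4]
  abel

/-- A Jucys–Murphy element commutes with the generators of its block that precede the last one
occurring in it. -/
theorem commute_jucysMurphy_of_lt {J : Set ℕ} {j : ℕ} (hj : j ∈ J) (hn : j + 1 < n) (m : ℕ)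
    (hm : j < m) : Commute (gN n j) (jucysMurphy n J m) := by
  induction m with
  | zero => omega
  | succ m ih =>
    rcases Nat.lt_or_ge j m with h1 | h1
    · have h2 : Commute (gN n j) (gN n (m + 1)) := gN_comm (by omega)
      by_cases h : m ∈ J
      · rw [jucysMurphy_succ h]
        exact ((h2.mul_right (ih h1)).mul_right h2).add_right h2
      · rwa [jucysMurphy_succ_of_notMem h]
    · have : j = m := by omega
      subst this
      obtain ⟨X, hX, hc⟩ := exists_jucysMurphy_eq (n := n) J j
      rw [jucysMurphy_succ hj, hX]
      exact commute_conj_conj (gN_quad hn) (gN_braid j) (hc _ le_rfl)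

theorem commute_jmProd_of_gt {J : Set ℕ} (m : ℕ) {j : ℕ} (h : m + 1 ≤ j) :
    Commute (gN n j) (jmProd n J m) := by
  induction m with
  | zero => exact Commute.one_right _
  | succ m ih =>
    by_cases hm : m ∈ J
    · rw [jmProd_succ_of_mem hm]
      exact (ih (by omega)).mul_right (commute_jucysMurphy_of_gt (by omega))
    · rw [jmProd_succ_of_notMem hm]
      exact ih (by omega)

/-- The product of the Jucys–Murphy elements commutes with the generators involved. The generator
`g_m` commutes with all factors but `L_{m-1}` and `L_m`, and it commutes with their product because
`L_m = g_m L_{m-1} g_m + g_m` commutes with `L_{m-1}`. -/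
theorem commute_jmProd {J : Set ℕ} (hJ : ∀ i ∈ J, i + 1 < n) (m : ℕ) {j : ℕ} (hj : j ∈ J)
    (h : j < m) : Commute (gN n j) (jmProd n J m) := by
  induction m with
  | zero => omega
  | succ m ih =>
    by_cases hm : m ∈ J
    swap
    · rw [jmProd_succ_of_notMem hm]
      have : j ≠ m := fun e => hm (e ▸ hj)
      exact ih (by omega)
    rw [jmProd_succ_of_mem hm]
    rcases Nat.lt_or_ge j m with h1 | h1
    · exact (ih h1).mul_right (commute_jucysMurphy_of_lt hj (hJ j hj) m h1)
    have : j = m := by omega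
    subst this
    cases j with
    | zero => simp [jmProd, jucysMurphy, chain]
    | succ j =>
      have hc : Commute (gN n (j + 1)) (jmProd n J j) := commute_jmProd_of_gt j le_rfl
      by_cases hm' : j ∈ J
      · rw [jmProd_succ_of_mem hm', mul_assoc]
        refine hc.mul_right ?_
        have h2 : Commute (jucysMurphy n J (j + 1)) (jucysMurphy n J j) :=
          chain_commute j
            (fun i hi' hiJ => (commute_jucysMurphy_of_lt hiJ (hJ i hiJ) _ (by omega)).symm) _
            (commute_jucysMurphy_of_lt hm' (hJ j hm') _ (by omega)).symm
        have h3 : jucysMurphy n J (j + 1) = _ := jucysMurphy_succ hm'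
        calc gN n (j + 1) * (jucysMurphy n J j * jucysMurphy n J (j + 1))
            = gN n (j + 1) * (jucysMurphy n J j *
              (gN n (j + 1) * jucysMurphy n J j * gN n (j + 1) + gN n (j + 1))) := by rw [h3]
          _ = (gN n (j + 1) * jucysMurphy n J j * gN n (j + 1) + gN n (j + 1)) *
              jucysMurphy n J j * gN n (j + 1) := by noncomm_ring
          _ = _ := by rw [← h3, h2.eq]
      · rw [jmProd_succ_of_notMem hm', jucysMurphy_succ_of_notMem hm']
        exact hc.mul_right (Commute.refl _)

/-! ### Supports -/

/-- The elements of the Hecke algebra in which only basis elements `T_w` with `w ∈ X` occur. -/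
def supported (X : Set (Equiv.Perm (Fin n))) : Submodule (Polynomial ℤ) (Hecke n) where
  carrier := {h | ∀ w, w ∉ X → (basisT n).coord w h = 0}
  zero_mem' := fun w _ => map_zero _
  add_mem' := fun ha hb w hw => by rw [map_add, ha w hw, hb w hw, add_zero]
  smul_mem' := fun r a ha w hw => by rw [map_smul, ha w hw, smul_zero]

theorem T_mem_supported {X : Set (Equiv.Perm (Fin n))} {w : Equiv.Perm (Fin n)} (h : w ∈ X) :
    (T w : Hecke n) ∈ supported X := fun v hv => by
  rw [coord_T, if_neg]
  rintro rfl
  exact hv h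

theorem supported_mono {X Y : Set (Equiv.Perm (Fin n))} (h : X ⊆ Y) :
    supported X ≤ supported Y := fun _ ha w hw => ha w fun h' => hw (h h')

theorem sum_coord_smul_T (a : Hecke n) : ∑ w, (basisT n).coord w a • T w = a := by
  have := (basisT n).sum_repr a
  simp only [basisT_apply] at this
  exact this

theorem map_mem_of_supported {X : Set (Equiv.Perm (Fin n))} (f : Hecke n →ₗ[Polynomial ℤ] Hecke n)
    (N : Submodule (Polynomial ℤ) (Hecke n)) (hf : ∀ w ∈ X, f (T w) ∈ N) {a : Hecke n}
    (ha : a ∈ supported X) : f a ∈ N := by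
  rw [← sum_coord_smul_T a, map_sum]
  refine Submodule.sum_mem _ fun w _ => ?_
  rw [map_smul]
  by_cases hw : w ∈ X
  · exact N.smul_mem _ (hf w hw)
  · rw [ha w hw, zero_smul]
    exact N.zero_mem

theorem mul_T_mem_supported {X Y : Set (Equiv.Perm (Fin n))} {b : Hecke n}
    (h : ∀ w ∈ X, (T w : Hecke n) * b ∈ supported Y) {a : Hecke n} (ha : a ∈ supported X) :
    a * b ∈ supported Y :=
  map_mem_of_supported ((LinearMap.mul (Polynomial ℤ) (Hecke n)).flip b) _ h ha

theorem mul_gen_mem_supported {X : Set (Equiv.Perm (Fin n))} {i : Fin (n - 1)}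
    (h : ∀ w ∈ X, w * simpleRefl i ∈ X) {a : Hecke n} (ha : a ∈ supported X) :
    a * gen i ∈ supported X := by
  refine mul_T_mem_supported (fun w hw => ?_) ha
  rcases lt_trichotomy (w (lo i)) (w (hi i)) with h1 | h1 | h1
  · rw [T_mul_gen h1]; exact T_mem_supported (h w hw)
  · exact absurd (w.injective h1) (lo_lt_hi i).ne
  · rw [T_mul_gen_of_gt h1]
    exact add_mem (T_mem_supported (h w hw)) (Submodule.smul_mem _ _ (T_mem_supported hw))

theorem gen_mul_mem_supported {X : Set (Equiv.Perm (Fin n))} {i : Fin (n - 1)}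
    (h : ∀ w ∈ X, simpleRefl i * w ∈ X) {a : Hecke n} (ha : a ∈ supported X) :
    gen i * a ∈ supported X := by
  refine map_mem_of_supported (LinearMap.mul (Polynomial ℤ) (Hecke n) (gen i)) _ (fun w hw => ?_)
    ha
  rw [LinearMap.mul_apply']
  by_cases h1 : Desc i w
  · rw [gen_mul_T_of_desc h1]
    exact add_mem (T_mem_supported (h w hw)) (Submodule.smul_mem _ _ (T_mem_supported hw))
  · rw [gen_mul_T_of_not_desc h1]; exact T_mem_supported (h w hw)

/-- The permutation preserves the initial segment `{x | x ≤ i}`. -/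
def Stab (i : ℕ) (w : Equiv.Perm (Fin n)) : Prop :=
  ∀ x : Fin n, (x : ℕ) ≤ i ↔ (w x : ℕ) ≤ i

theorem stab_mul_simpleRefl {m : ℕ} {i : Fin (n - 1)} (h : (i : ℕ) ≠ m)
    (w : Equiv.Perm (Fin n)) : Stab m (w * simpleRefl i) ↔ Stab m w := by
  constructor
  · intro hw x
    have := hw (simpleRefl i x)
    rw [← simpleRefl_mem_stab h, ← Equiv.Perm.mul_apply, mul_assoc, simpleRefl_mul_self,
      mul_one] at this
    exact this
  · intro hw x
    rw [Equiv.Perm.mul_apply, ← hw, ← simpleRefl_mem_stab h]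

theorem mul_gN_mem_notStab {m i : ℕ} (h : i ≠ m) {a : Hecke n}
    (ha : a ∈ supported {w : Equiv.Perm (Fin n) | ¬ Stab m w}) :
    a * gN n i ∈ supported {w : Equiv.Perm (Fin n) | ¬ Stab m w} := by
  unfold gN
  split_ifs with hi'
  · refine mul_gen_mem_supported (fun w hw => ?_) ha
    rw [Set.mem_ofPred_eq, stab_mul_simpleRefl (i := ⟨i, hi'⟩) h]
    exact hw
  · rw [mul_zero]; exact zero_mem _

theorem mul_gN_mem_parab {J : Set ℕ} {i : ℕ} (h : i ∈ J) {a : Hecke n}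
    (ha : a ∈ supported (parab n J : Set (Equiv.Perm (Fin n)))) :
    a * gN n i ∈ supported (parab n J : Set (Equiv.Perm (Fin n))) := by
  unfold gN
  split_ifs with hi'
  · refine mul_gen_mem_supported (fun w hw => ?_) ha
    exact (parab n J).mul_mem hw (simpleRefl_mem_parab.mpr h)
  · rw [mul_zero]; exact zero_mem _

theorem mem_parab_Iio {m : ℕ} {w : Equiv.Perm (Fin n)} :
    w ∈ parab n (Set.Iio m) ↔ ∀ i, m ≤ i → Stab i w := by
  simp only [mem_parab, SameBlock, Set.mem_Iio, not_lt, Stab]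
  exact ⟨fun h i hi' x => h x i hi', fun h x i hi' => h i hi' x⟩

theorem fix_of_mem_parab_Iio {m : ℕ} {w : Equiv.Perm (Fin n)} (hw : w ∈ parab n (Set.Iio m))
    (x : Fin n) (hx : m < (x : ℕ)) : w x = x := by
  rw [mem_parab_Iio] at hw
  have h1 := (hw x hx.le x).mp le_rfl
  have h2 := mt (hw (x - 1) (by omega) x).mpr (by omega)
  exact Fin.ext (by omega)

/-- If all elements in the support of `E` move the segment `{x | x ≤ i}`, or if `i = m`, then so do
all elements in the support of the product of `E` with a chain. Indeed, the term of the chain that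
involves the generators from `a` to `m` either does not involve `g_i`, and the property is inherited
from `E`, or has `a ≤ i`, and then the elements in question send `a` to `m + 1`.
The two hypotheses on `h` express this dichotomy for the first term of the chain. -/
theorem mul_chain_mem_notStab {J : Set ℕ} {m i : ℕ} (hi' : i ≤ m) {E : Hecke n}
    (hE : E ∈ supported (parab n (Set.Iio m) : Set (Equiv.Perm (Fin n))))
    (hEi : i < m → E ∈ supported {w : Equiv.Perm (Fin n) | ¬ Stab i w}) (a : ℕ) (ha : a ≤ m) :
    ∀ h : Hecke n,
      (∀ y ∈ supported (parab n (Set.Iio m) : Set (Equiv.Perm (Fin n))), y * h ∈ supported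
        {w : Equiv.Perm (Fin n) | (∀ x : Fin n, (x : ℕ) = a → (w x : ℕ) = m + 1) ∧
          w ∈ parab n (Set.Iio (m + 1))}) →
      (i < a → ∀ y ∈ supported {w : Equiv.Perm (Fin n) | ¬ Stab i w},
        y * h ∈ supported {w : Equiv.Perm (Fin n) | ¬ Stab i w}) →
      m + 1 < n → E * chain J a h ∈ supported {w : Equiv.Perm (Fin n) | ¬ Stab i w} := by
  have last : ∀ h : Hecke n, ∀ b ≤ m, m + 1 < n →
      (∀ y ∈ supported (parab n (Set.Iio m) : Set (Equiv.Perm (Fin n))), y * h ∈ supported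
        {w : Equiv.Perm (Fin n) | (∀ x : Fin n, (x : ℕ) = b → (w x : ℕ) = m + 1) ∧
          w ∈ parab n (Set.Iio (m + 1))}) →
      (i < b → ∀ y ∈ supported {w : Equiv.Perm (Fin n) | ¬ Stab i w},
        y * h ∈ supported {w : Equiv.Perm (Fin n) | ¬ Stab i w}) →
      E * h ∈ supported {w : Equiv.Perm (Fin n) | ¬ Stab i w} := by
    intro h b hb hn h1 h2
    rcases Nat.lt_or_ge i b with h3 | h3
    · exact h2 h3 E (hEi (by omega))
    · refine supported_mono ?_ (h1 E hE)
      rintro w ⟨hw, -⟩ hs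
      have := (hs ⟨b, by omega⟩).mp h3
      have := hw ⟨b, by omega⟩ rfl
      omega
  induction a with
  | zero => intro h h1 h2 hn; exact last h 0 ha hn h1 h2
  | succ a ih =>
    intro h h1 h2 hn
    rw [chain, mul_add]
    refine add_mem (last h _ ha hn h1 h2) ?_
    split_ifs with haJ
    swap
    · rw [mul_zero]; exact zero_mem _
    refine ih (by omega) _ ?_ ?_ hn
    · intro y hy
      have h3 := h1 _ (mul_gN_mem_parab (i := a) (by simp; omega) hy)
      rw [← mul_assoc, ← mul_assoc]
      refine mul_T_mem_supported (fun w hw => ?_) h3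
      have hmem : w (⟨a, by omega⟩ : Fin n) < w ⟨a + 1, by omega⟩ := by
        have h4 := hw.1 ⟨a + 1, by omega⟩ rfl
        have h5 := (mem_parab_Iio.mp hw.2 (m + 1) le_rfl ⟨a, by omega⟩).mp (by simp; omega)
        have h6 : w (⟨a, by omega⟩ : Fin n) ≠ w ⟨a + 1, by omega⟩ := fun e => by
          have := w.injective e
          simp at this
        have h7 : ((w (⟨a, by omega⟩ : Fin n) : Fin n) : ℕ) ≠ w ⟨a + 1, by omega⟩ := fun e =>
          h6 (Fin.ext e)
        rw [Fin.lt_def]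
        omega
      have hlt : a < n - 1 := by omega
      rw [gN, dif_pos hlt, T_mul_gen hmem]
      refine T_mem_supported ⟨fun x hx => ?_, ?_⟩
      · have : x = lo ⟨a, hlt⟩ := Fin.ext hx
        rw [this, Equiv.Perm.mul_apply, simpleRefl_lo]
        exact hw.1 _ rfl
      · exact Subgroup.mul_mem _ hw.2 (simpleRefl_mem_parab.mpr (by simp; omega))
    · intro hia y hy
      rw [← mul_assoc, ← mul_assoc]
      exact mul_gN_mem_notStab (by omega) (h2 (by omega) _ (mul_gN_mem_notStab (by omega) hy))

theorem chain_mem_parab {J K : Set ℕ} (a : ℕ) (haJ : ∀ i < a, i ∈ J → i ∈ K) :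
    ∀ h : Hecke n, (∀ y ∈ supported (parab n K : Set (Equiv.Perm (Fin n))),
      y * h ∈ supported (parab n K : Set (Equiv.Perm (Fin n)))) →
    ∀ y ∈ supported (parab n K : Set (Equiv.Perm (Fin n))),
      y * chain J a h ∈ supported (parab n K : Set (Equiv.Perm (Fin n))) := by
  induction a with
  | zero => intro h hh; exact hh
  | succ a ih =>
    intro h hh y hy
    rw [chain, mul_add]
    refine add_mem (hh y hy) ?_
    split_ifs with ha
    swap
    · rw [mul_zero]; exact zero_mem _
    refine ih (fun i hi' => haJ i (by omega)) _ (fun y hy => ?_) y hy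
    have haK := haJ a (by omega) ha
    rw [← mul_assoc, ← mul_assoc]
    exact mul_gN_mem_parab haK (hh _ (mul_gN_mem_parab haK hy))

theorem jmProd_mem_parab (J : Set ℕ) (m : ℕ) : ∀ K : Set ℕ, (∀ i < m, i ∈ J → i ∈ K) →
    jmProd n J m ∈ supported (parab n K : Set (Equiv.Perm (Fin n))) := by
  induction m with
  | zero =>
    intro K _
    rw [jmProd, ← T_one]
    exact T_mem_supported (one_mem (parab n K))
  | succ m ih =>
    intro K hK
    have h1 := ih K fun i hi' => hK i (by omega)
    by_cases hm : m ∈ J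
    · rw [jmProd_succ_of_mem hm]
      exact chain_mem_parab m (fun i hi' => hK i (by omega)) _
        (fun y hy => mul_gN_mem_parab (hK m (by omega) hm) hy) _ h1
    · rwa [jmProd_succ_of_notMem hm]

/-- No basis element occurring in the product of the Jucys–Murphy elements lies in the parabolic
subgroup generated by the simple reflections other than `s_i`, for `i ∈ J`. -/
theorem jmProd_mem_notStab (J : Set ℕ) (m : ℕ) (hm : m < n) (i : ℕ) (hi' : i < m)
    (hiJ : i ∈ J) : jmProd n J m ∈ supported {w : Equiv.Perm (Fin n) | ¬ Stab i w} := by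
  induction m with
  | zero => omega
  | succ m ih =>
    by_cases hmJ : m ∈ J
    swap
    · rw [jmProd_succ_of_notMem hmJ]
      have : i ≠ m := fun e => hmJ (e ▸ hiJ)
      exact ih (by omega) (by omega)
    rw [jmProd_succ_of_mem hmJ]
    have hlt : m < n - 1 := by omega
    refine mul_chain_mem_notStab (m := m) (by omega)
      (jmProd_mem_parab J m _ fun i h _ => h) (fun h => ih (by omega) h) m le_rfl _ ?_ ?_ hm
    · intro y hy
      refine mul_T_mem_supported (fun w hw => ?_) hy
      have h1 := mem_parab_Iio.mp hw m le_rfl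
      have h2 := (h1 (lo ⟨m, hlt⟩)).mp (by simp)
      have h3 := mt (h1 (hi ⟨m, hlt⟩)).mpr (by simp)
      rw [gN, dif_pos hlt, T_mul_gen (by rw [Fin.lt_def]; omega)]
      refine T_mem_supported ⟨fun x hx => ?_, ?_⟩
      · have : x = lo ⟨m, hlt⟩ := Fin.ext hx
        rw [this, Equiv.Perm.mul_apply, simpleRefl_lo, fix_of_mem_parab_Iio hw _ (by simp)]
        rfl
      · exact Subgroup.mul_mem _ (parab_mono (Set.Iio_subset_Iio (Nat.le_succ m)) hw)
          (simpleRefl_mem_parab.mpr (by simp))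
    · intro h y hy
      exact mul_gN_mem_notStab (by omega) hy

/-! ### Coxeter elements -/

/-- `w` is the Coxeter element of the parabolic subgroup of `J` that sends every point, except for
the last point of a block, to the next point. -/
def IsCox (J : Set ℕ) (w : Equiv.Perm (Fin n)) : Prop :=
  w ∈ parab n J ∧ ∀ i : Fin (n - 1), (i : ℕ) ∈ J → w (lo i) = hi i

theorem IsCox.unique {J : Set ℕ} {w w' : Equiv.Perm (Fin n)} (h : IsCox J w) (h' : IsCox J w') :
    w = w' := by
  obtain ⟨v, hv⟩ : ∃ v, v = w⁻¹ * w' := ⟨_, rfl⟩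
  have hvJ : v ∈ parab n J := hv ▸ (parab n J).mul_mem ((parab n J).inv_mem h.1) h'.1
  have hfix : ∀ i : Fin (n - 1), (i : ℕ) ∈ J → v (lo i) = lo i := fun i hi' => by
    rw [hv, Equiv.Perm.mul_apply, h'.2 i hi', ← h.2 i hi']
    simp
  -- a point that is moved by `v` is the last one of its block, hence fixed after all
  have key : ∀ x y : Fin n, v x ≠ x → x < y → ¬ SameBlock J x y := by
    intro x y hx hxy hs
    have hlt : (x : ℕ) < n - 1 := by have := y.2; have : (x : ℕ) < y := hxy; omega
    exact hx (hfix ⟨x, hlt⟩ ((sameBlock_iff_of_le hxy.le).mp hs x le_rfl hxy))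
  have hv1 : v = 1 := by
    ext x
    by_contra hne
    have hx : v x ≠ x := fun e => hne (by rw [e]; rfl)
    rcases lt_or_gt_of_ne hx with h1 | h1
    · exact key (v x) x (fun e => hx (v.injective e)) h1 (hvJ x).symm
    · exact key x (v x) hx h1 (hvJ x)
  rw [hv1] at hv
  exact (inv_mul_eq_one.mp hv.symm)

/-- The product in increasing order of distinct simple reflections is the Coxeter element of the
parabolic subgroup that they generate. -/
theorem isCox_wordProd (l : List (Fin (n - 1))) (hl : l.Pairwise (· < ·)) :
    IsCox {i : ℕ | ∃ j ∈ l, (j : ℕ) = i} (wordProd l) := by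
  induction l with
  | nil => exact ⟨by rw [wordProd]; exact one_mem _, fun i ⟨j, hj, _⟩ => by simp at hj⟩
  | cons a l ih =>
    rw [List.pairwise_cons] at hl
    obtain ⟨h1, h2⟩ := ih hl.2
    rw [wordProd_cons]
    refine ⟨Subgroup.mul_mem _ (simpleRefl_mem_parab.mpr ⟨a, by simp, rfl⟩)
      (parab_mono ?_ h1), ?_⟩
    · rintro i ⟨j, hj, rfl⟩
      exact ⟨j, List.mem_cons_of_mem _ hj, rfl⟩
    · rintro i ⟨j, hj, hji⟩
      have hji' : j = i := Fin.ext hji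
      subst hji'
      rw [Equiv.Perm.mul_apply]
      rcases List.mem_cons.mp hj with rfl | hj
      · have h3 : ∀ k : ℕ, k ≤ j → k ∉ {i : ℕ | ∃ j ∈ l, (j : ℕ) = i} := by
          rintro k hk ⟨j', hj', rfl⟩
          have : (j : ℕ) < j' := hl.1 j' hj'
          omega
        have h4 := (h1 (lo j) j (h3 _ le_rfl)).mp (by simp)
        have h5 : wordProd l (lo j) = lo j := by
          refine Fin.ext ?_
          rw [lo_val]
          by_contra hne
          have := (h1 (lo j) ((j : ℕ) - 1) (h3 _ (by omega))).mpr (by omega)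
          simp at this
          omega
        rw [h5, simpleRefl_lo]
      · rw [h2 j ⟨j, hj, rfl⟩]
        have : (a : ℕ) < j := hl.1 j hj
        refine Fin.ext ?_
        rw [simpleRefl_apply_val, hi_val]
        split_ifs <;> omega

/-- The indices of the simple reflections in the parabolic subgroup of a composition. -/
def interior (c : Composition n) : Set ℕ :=
  {i | i + 1 < n ∧ ∀ j : ℕ, c.sizeUpTo j ≠ i + 1}

theorem mem_interior_iff (c : Composition n) (i : Fin (n - 1)) :
    (i : ℕ) ∈ interior c ↔ Interior c i := by
  have := i.2
  exact ⟨fun h => h.2, fun h => ⟨by omega, h⟩⟩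

theorem parabolic_eq (c : Composition n) : parabolic c = parab n (interior c) := by
  rw [parab_eq_closure, parabolic]
  simp only [mem_interior_iff]

theorem isCox_wordProd_filter (J : Set ℕ) [DecidablePred fun i : Fin (n - 1) => (i : ℕ) ∈ J] :
    IsCox J (wordProd ((List.finRange (n - 1)).filter fun i : Fin (n - 1) => (i : ℕ) ∈ J)) := by
  obtain ⟨h1, h2⟩ := isCox_wordProd
    ((List.finRange (n - 1)).filter fun i : Fin (n - 1) => (i : ℕ) ∈ J)
    ((List.pairwise_lt_finRange _).filter _)
  refine ⟨parab_mono ?_ h1, fun i hi' => h2 i ⟨i, by simpa using hi', rfl⟩⟩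
  rintro i ⟨j, hj, rfl⟩
  simpa using hj

open Classical in
/-- The Coxeter element of the parabolic subgroup of `J`: the product in increasing order of the
simple reflections in `J`. -/
noncomputable def coxOf (n : ℕ) (J : Set ℕ) : Equiv.Perm (Fin n) :=
  wordProd ((List.finRange (n - 1)).filter fun i : Fin (n - 1) => (i : ℕ) ∈ J)

theorem isCox_coxOf (J : Set ℕ) : IsCox J (coxOf n J) := by
  classical
  exact isCox_wordProd_filter J

theorem coxeterElement_eq (c : Composition n) : coxeterElement c = coxOf n (interior c) := by
  rw [coxeterElement, coxOf]
  congr 1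
  exact List.filter_congr fun i _ => decide_eq_decide.mpr (mem_interior_iff c i).symm

/-! ### The Coxeter class element as a product of Jucys–Murphy elements -/

/-- The elements of `J` below `m`. -/
def trunc (J : Set ℕ) (m : ℕ) : Set ℕ := {i | i ∈ J ∧ i < m}

/-- The set obtained from `J` by removing the last simple reflection of every block. -/
def shrink (J : Set ℕ) : Set ℕ := {i | i ∈ J ∧ i + 1 ∈ J}

theorem trunc_subset_Iio (J : Set ℕ) (m : ℕ) : trunc J m ⊆ Set.Iio m := fun _ h => h.2

theorem trunc_eq_of_notMem {J : Set ℕ} {m : ℕ} (h : m ∉ J) : trunc J (m + 1) = trunc J m := by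
  ext i
  simp only [trunc, Set.mem_ofPred_eq]
  refine and_congr_right fun hi' => ?_
  have : i ≠ m := fun e => h (e ▸ hi')
  omega

/-- Appending the next simple reflection to a Coxeter element. -/
theorem isCox_mul_simpleRefl {J : Set ℕ} {i : Fin (n - 1)} (hi' : (i : ℕ) ∈ J)
    {w : Equiv.Perm (Fin n)} (hw : IsCox (trunc J i) w) :
    IsCox (trunc J (i + 1)) (w * simpleRefl i) ∧ w (lo i) < w (hi i) := by
  have h0 := parab_mono (trunc_subset_Iio J i) hw.1
  have h1 : w (hi i) = hi i := fix_of_mem_parab_Iio h0 _ (by simp)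
  have hsub : trunc J (i : ℕ) ⊆ trunc J (i + 1) := fun j hj => ⟨hj.1, by have := hj.2; omega⟩
  have hmem : (i : ℕ) ∈ trunc J (i + 1) := ⟨hi', Nat.lt_succ_self _⟩
  refine ⟨⟨Subgroup.mul_mem _ (parab_mono hsub hw.1) (simpleRefl_mem_parab.mpr hmem),
    fun j hj => ?_⟩, ?_⟩
  · rw [Equiv.Perm.mul_apply]
    by_cases hji : j = i
    · subst hji
      rw [simpleRefl_lo, h1]
    · have hlt : (j : ℕ) < i := by
        have := hj.2
        have : (j : ℕ) ≠ i := fun e => hji (Fin.ext e)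
        omega
      have h2 : simpleRefl i (lo j : Fin n) = lo j := by
        refine Fin.ext ?_
        rw [simpleRefl_apply_val, lo_val]
        split_ifs <;> omega
      rw [h2, hw.2 j ⟨hj.1, hlt⟩]
  · rw [h1, Fin.lt_def]
    have := (mem_parab_Iio.mp h0 i le_rfl (lo i)).mp (by simp)
    rw [hi_val]
    omega

open Classical in
/-- The norm of `h` from the trivial subgroup to the parabolic subgroup of `J`. -/
noncomputable def normOne (J : Set ℕ) (h : Hecke n) : Hecke n :=
  ∑ u ∈ Finset.univ.filter (fun u => u ∈ parab n J), T u⁻¹ * h * T u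

theorem distinguished_bot {G : Subgroup (Equiv.Perm (Fin n))} {d : Equiv.Perm (Fin n)} :
    Distinguished G ⊥ d ↔ d ∈ G := by
  refine ⟨fun h => h.1, fun h => ⟨h, fun u hu => ?_⟩⟩
  rw [Subgroup.mem_bot.mp hu, one_mul]

open Classical in
/-- Summation over a parabolic subgroup, coset by coset. -/
theorem sum_parab_eq {M : Type*} [AddCommMonoid M] {A B : Set ℕ} (hAB : B ⊆ A)
    (F : Equiv.Perm (Fin n) → M) :
    ∑ x ∈ Finset.univ.filter (fun x => x ∈ parab n A), F x =
      ∑ d ∈ Finset.univ.filter (fun d => d ∈ parab n A ∧ LeftMin B d),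
        ∑ u ∈ Finset.univ.filter (fun u => u ∈ parab n B), F (u * d) := by
  rw [← Finset.sum_product']
  symm
  refine Finset.sum_bij (fun p _ => p.2 * p.1) ?_ ?_ ?_ ?_
  · rintro ⟨d, u⟩ h
    simp only [Finset.mem_product, Finset.mem_filter, Finset.mem_univ, true_and] at h ⊢
    exact Subgroup.mul_mem _ (parab_mono hAB h.2) h.1.1
  · rintro ⟨d, u⟩ h ⟨d', u'⟩ h' e
    simp only [Finset.mem_product, Finset.mem_filter, Finset.mem_univ, true_and] at h h'
    obtain ⟨h1, h2⟩ := h.1.2.eq_of_mul_eq h'.1.2 h.2 h'.2 e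
    rw [h1, h2]
  · intro x hx
    simp only [Finset.mem_filter, Finset.mem_univ, true_and] at hx
    obtain ⟨u, hu, d, hd, rfl⟩ := exists_leftMin_mul B x
    refine ⟨(d, u), ?_, rfl⟩
    simp only [Finset.mem_product, Finset.mem_filter, Finset.mem_univ, true_and]
    refine ⟨⟨?_, hd⟩, hu⟩
    have := Subgroup.mul_mem _ (Subgroup.inv_mem _ (parab_mono hAB hu)) hx
    rwa [inv_mul_cancel_left] at this
  · intro p _
    rfl

theorem T_inv_conj_mul {J : Set ℕ} {d : Equiv.Perm (Fin n)} (hd : LeftMin J d)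
    {u : Equiv.Perm (Fin n)} (hu : u ∈ parab n J) (h : Hecke n) :
    T (u * d)⁻¹ * h * T (u * d) = T d⁻¹ * (T u⁻¹ * h * T u) * T d := by
  rw [← hd.T_mul hu, mul_inv_rev, ← hd.T_inv_mul ((parab n J).inv_mem hu)]
  simp only [mul_assoc]

/-- The distinguished representatives of `trunc A a` in `trunc A (a + 1)` are `1` and the products
of `s_a` with the representatives of `trunc A (a - 1)` in `trunc A a`; hence they are `1` and
`s_a s_{a-1} ⋯ s_j` for those `j` for which `j, …, a` lie in `A`. -/
theorem chain_rep_iff {A : Set ℕ} {a : Fin (n - 1)} (ha : (a : ℕ) ∈ A)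
    {d : Equiv.Perm (Fin n)} :
    (d ∈ parab n (trunc A (a + 1)) ∧ LeftMin (trunc A a) d) ↔
      d = 1 ∨ (simpleRefl a * d ∈ parab n (trunc A a) ∧
        LeftMin (trunc A (a - 1)) (simpleRefl a * d)) := by
  have fix : ∀ x : Fin n, (x : ℕ) < a → simpleRefl a x = x := fun x hx => by
    refine Fin.ext ?_
    rw [simpleRefl_apply_val]
    split_ifs <;> omega
  have hfar : ∀ i : Fin (n - 1), (i : ℕ) < a - 1 →
      (Desc i (simpleRefl a * d) ↔ Desc i d) := fun i hi' => by
    simp only [Desc, mul_inv_rev, simpleRefl_inv, Equiv.Perm.mul_apply]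
    rw [fix _ (by simp; omega), fix _ (by simp; omega)]
  constructor
  · rintro ⟨h1, h2⟩
    by_cases hd : d = 1
    · exact Or.inl hd
    right
    obtain ⟨i, hi'⟩ := exists_desc hd
    have hiA := mem_of_desc h1 hi'
    have hia : i = a := by
      by_contra hne
      have : (i : ℕ) ≠ a := fun e => hne (Fin.ext e)
      have := hiA.2
      exact h2 i ⟨hiA.1, by omega⟩ hi'
    subst hia
    have hinv := (parab n (trunc A (i + 1))).inv_mem h1
    -- the point `i` is sent to `i + 1` by `d⁻¹`
    have hp : d (hi i) = lo i := by
      obtain ⟨p, hp⟩ : ∃ p, p = d (hi i) := ⟨_, rfl⟩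
      have hle : d⁻¹ (lo i) ≤ hi i := by
        have := (hinv (lo i) (i + 1) (fun h => by have := h.2; omega)).mp (by simp)
        rw [Fin.le_def]; exact this
      have hpd : d⁻¹ p = hi i := by rw [hp]; simp
      have hp1 : (p : ℕ) ≤ i + 1 := by
        have := (h1 (hi i) (i + 1) (fun h => by have := h.2; omega)).mp (by simp)
        rwa [← hp] at this
      rw [← hp]
      rcases lt_trichotomy p (lo i) with h3 | h3 | h3
      · exfalso
        have hsb : SameBlock (trunc A i) p (lo i) := by
          rw [sameBlock_iff_of_le h3.le]
          intro j hj1 hj2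
          have h4 : SameBlock (trunc A (i + 1)) p (hi i) := by
            rw [hp]; exact (h1 (hi i)).symm
          rw [sameBlock_iff_of_le (h3.le.trans (lo_lt_hi i).le)] at h4
          have h5 : j < i := hj2
          exact ⟨(h4 j hj1 (by rw [hi_val]; omega)).1, h5⟩
        have := h2.lt h3 hsb
        rw [hpd] at this
        exact absurd this (not_lt.mpr hle)
      · exact h3
      · exfalso
        have h4 : p = hi i := by
          have h5 : (i : ℕ) < p := h3
          exact Fin.ext (by rw [hi_val]; omega)
        have h5 : d⁻¹ (hi i) < d⁻¹ (lo i) := hi'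
        rw [← h4, hpd] at h5
        exact absurd h5 (not_lt.mpr hle)
    have hmem : simpleRefl i * d ∈ parab n (trunc A (i + 1)) :=
      Subgroup.mul_mem _ (simpleRefl_mem_parab.mpr ⟨ha, Nat.lt_succ_self _⟩) h1
    have hfix : (simpleRefl i * d) (hi i) = hi i := by
      rw [Equiv.Perm.mul_apply, hp, simpleRefl_lo]
    refine ⟨fun x j hj => ?_, fun j hj => ?_⟩
    · by_cases hji : j = i
      · subst hji
        have h3 := hmem x (i + 1) (fun h => by have := h.2; omega)
        have h4 : (x : ℕ) = i + 1 ↔ (((simpleRefl i * d) x : Fin n) : ℕ) = i + 1 := by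
          constructor
          · intro e
            have : x = hi i := Fin.ext e
            rw [this, hfix, hi_val]
          · intro e
            have : (simpleRefl i * d) x = (simpleRefl i * d) (hi i) := by
              rw [hfix]; exact Fin.ext e
            rw [(simpleRefl i * d).injective this, hi_val]
        omega
      · exact hmem x j fun h => hj ⟨h.1, by have := h.2; omega⟩
    · rw [hfar j hj.2]
      exact h2 j ⟨hj.1, by have := hj.2; omega⟩
  · rintro (rfl | ⟨h1, h2⟩)
    · refine ⟨one_mem _, fun i _ => ?_⟩
      rw [not_desc_iff]
      exact lo_lt_hi i
    · have hmono : trunc A (a : ℕ) ⊆ trunc A (a + 1) := fun j hj => ⟨hj.1, by have := hj.2; omega⟩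
      refine ⟨?_, fun i hi' => ?_⟩
      · have := Subgroup.mul_mem _
          (simpleRefl_mem_parab.mpr (⟨ha, Nat.lt_succ_self _⟩ : (a : ℕ) ∈ trunc A (a + 1)))
          (parab_mono hmono h1)
        rwa [simpleRefl_mul_cancel] at this
      · rcases Nat.lt_or_ge i (a - 1) with h3 | h3
        · rw [← hfar i h3]
          exact h2 i ⟨hi'.1, h3⟩
        · have hlt := hi'.2
          have e : d = simpleRefl a * (simpleRefl a * d) := (simpleRefl_mul_cancel _ _).symm
          have hinv := mem_parab_Iio.mp (parab_mono (trunc_subset_Iio A a)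
            ((parab n (trunc A a)).inv_mem h1)) a le_rfl
          have hhi : (hi i : Fin n) = lo a := Fin.ext (by rw [hi_val, lo_val]; omega)
          rw [e, not_desc_iff, mul_inv_rev, simpleRefl_inv, Equiv.Perm.mul_apply,
            Equiv.Perm.mul_apply, hhi, simpleRefl_lo, fix _ hlt, Fin.lt_def]
          have h4 := (hinv (lo i)).mp (by rw [lo_val]; omega)
          have h5 := mt (hinv (hi a)).mpr (by rw [hi_val]; omega)
          omega

open Classical in
/-- A chain is a relative norm between the parabolic subgroups of two successive truncations. -/
theorem sum_chain_rep (A : Set ℕ) (a : ℕ) (ha : a ≤ n - 1) : ∀ h : Hecke n,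
    ∑ d ∈ Finset.univ.filter (fun d => d ∈ parab n (trunc A a) ∧ LeftMin (trunc A (a - 1)) d),
      T d⁻¹ * h * T d = chain A a h := by
  have one : ∀ d : Equiv.Perm (Fin n), ∀ B : Set ℕ, d ∈ parab n B ∧ LeftMin B d ↔ d = 1 := by
    intro d B
    constructor
    · rintro ⟨h1, h2⟩
      by_contra hne
      obtain ⟨i, hi'⟩ := exists_desc hne
      exact h2 i (mem_of_desc h1 hi') hi'
    · rintro rfl
      refine ⟨one_mem _, fun i _ => ?_⟩
      rw [not_desc_iff]
      exact lo_lt_hi i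
  induction a with
  | zero =>
    intro h
    simp only [Nat.zero_sub, one, Finset.filter_eq', Finset.mem_univ, if_true,
      Finset.sum_singleton, inv_one, T_one, one_mul, mul_one, chain]
  | succ a ih =>
    intro h
    by_cases haA : a ∈ A
    · have hlt : a < n - 1 := by omega
      have hrep := fun d : Equiv.Perm (Fin n) => chain_rep_iff (a := ⟨a, hlt⟩) haA (d := d)
      simp only [Nat.add_sub_cancel, hrep]
      rw [Finset.filter_or, Finset.sum_union, chain, if_pos haA]
      · congr 1
        · simp [Finset.filter_eq', T_one]
        · rw [← ih (by omega)]
          refine Finset.sum_bij (fun d _ => simpleRefl ⟨a, hlt⟩ * d) ?_ ?_ ?_ ?_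
          · intro d hd; simpa using hd
          · intro d _ d' _ e; exact mul_left_cancel e
          · intro d hd
            refine ⟨simpleRefl ⟨a, hlt⟩ * d, ?_, simpleRefl_mul_cancel _ _⟩
            simpa only [Finset.mem_filter, Finset.mem_univ, true_and, simpleRefl_mul_cancel]
              using hd
          · intro d hd
            simp only [Finset.mem_filter, Finset.mem_univ, true_and] at hd
            obtain ⟨d', hd'⟩ : ∃ d', d' = simpleRefl ⟨a, hlt⟩ * d := ⟨_, rfl⟩
            have e : d = simpleRefl ⟨a, hlt⟩ * d' := by rw [hd', simpleRefl_mul_cancel]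
            rw [← hd'] at hd ⊢
            have hinv := mem_parab_Iio.mp (parab_mono (trunc_subset_Iio A a)
              ((parab n (trunc A a)).inv_mem hd.1)) a le_rfl
            have h4 := (hinv (lo ⟨a, hlt⟩)).mp (by simp)
            have h5 := mt (hinv (hi ⟨a, hlt⟩)).mpr (by simp)
            have hlt' : d'⁻¹ (lo ⟨a, hlt⟩) < d'⁻¹ (hi ⟨a, hlt⟩) := by rw [Fin.lt_def]; omega
            have hnd : ¬ Desc ⟨a, hlt⟩ d' := (not_desc_iff _ _).mpr hlt'
            rw [e, mul_inv_rev, simpleRefl_inv, ← T_mul_gen hlt', ← gen_mul_T_of_not_desc hnd,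
              gN, dif_pos hlt]
            simp only [mul_assoc]
      · rw [Finset.disjoint_left]
        intro d h1 h2
        simp only [Finset.mem_filter, Finset.mem_univ, true_and] at h1 h2
        subst h1
        have := h2.1
        rw [mul_one, simpleRefl_mem_parab] at this
        exact absurd this.2 (lt_irrefl _)
    · simp only [Nat.add_sub_cancel, trunc_eq_of_notMem haA, one, Finset.filter_eq',
        Finset.mem_univ, if_true, Finset.sum_singleton, inv_one, T_one, one_mul, mul_one, chain,
        if_neg haA, add_zero]

theorem chain_shrink {J K : Set ℕ} (hJK : ∀ i, i ∈ K ↔ i ∈ J ∧ i + 1 ∈ J) (a : ℕ) (ha : a ∈ J) :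
    ∀ h : Hecke n, chain K a h = chain J a h := by
  induction a with
  | zero => intro h; rfl
  | succ a ih =>
    intro h
    rw [chain, chain]
    by_cases haJ : a ∈ J
    · rw [if_pos haJ, if_pos ((hJK a).mpr ⟨haJ, ha⟩), ih haJ]
    · rw [if_neg haJ, if_neg fun h => haJ ((hJK a).mp h).1]

theorem chain_congr {J K : Set ℕ} (a : ℕ) (hJK : ∀ i < a, i ∈ K ↔ i ∈ J) :
    ∀ h : Hecke n, chain K a h = chain J a h := by
  induction a with
  | zero => intro h; rfl
  | succ a ih =>
    intro h
    have ha := hJK a (Nat.lt_succ_self a)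
    rw [chain, chain]
    by_cases haJ : a ∈ J
    · rw [if_pos haJ, if_pos (ha.mpr haJ), ih fun i hi' => hJK i (by omega)]
    · rw [if_neg haJ, if_neg (mt ha.mp haJ)]

theorem commute_T_of_mem {J : Set ℕ} {x : Hecke n}
    (hx : ∀ i : Fin (n - 1), (i : ℕ) ∈ J → Commute (gen i) x) :
    ∀ w ∈ parab n J, Commute (T w) x := by
  refine parab_induction (by rw [T_one]; exact Commute.one_left _) ?_
  intro i w hi' _ hd ih
  rw [← gen_mul_T_of_not_desc hd]
  exact (hx i hi').mul_left ih

/-- The norm of a Coxeter element is a product of Jucys–Murphy elements. The induction step splits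
the norm at the parabolic subgroup of the preceding truncation: the Coxeter element loses its last
generator `g_m`, which commutes with the inner sum, the inner sum becomes the preceding product,
which commutes with the representatives of the outer sum, and the outer sum turns `g_m` into the
last Jucys–Murphy element. -/
theorem normOne_eq_jmProd (J : Set ℕ) (m : ℕ) (hm : m ≤ n - 1)
    {w : Equiv.Perm (Fin n)} (hw : IsCox (trunc J m) w) :
    normOne (shrink (trunc J m)) (T w) = jmProd n J m := by
  classical
  induction m generalizing w with
  | zero =>
    have h1 : shrink (trunc J 0) = trunc J 0 := by
      ext i; simp [shrink, trunc]
    have h2 : parab n (trunc J 0) = ⊥ := by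
      have : {i : Fin (n - 1) | (i : ℕ) ∈ trunc J 0} = ∅ := by ext i; simp [trunc]
      rw [parab_eq_closure, this, Set.image_empty, Subgroup.closure_empty]
    have h3 : w = 1 := by simpa [h2] using hw.1
    rw [normOne, h1, h2, h3]
    simp [Subgroup.mem_bot, Finset.filter_eq', T_one, jmProd]
  | succ m ih =>
    by_cases hmJ : m ∈ J
    swap
    · rw [trunc_eq_of_notMem hmJ] at hw ⊢
      rw [jmProd_succ_of_notMem hmJ]
      exact ih (by omega) hw
    have hlt : m < n - 1 := by omega
    obtain ⟨v, hv⟩ : ∃ v : Equiv.Perm (Fin n), IsCox (trunc J m) v :=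
      ⟨_, isCox_coxOf _⟩
    obtain ⟨h1, h2⟩ := isCox_mul_simpleRefl (i := ⟨m, hlt⟩) hmJ hv
    have hwv : w = v * simpleRefl ⟨m, hlt⟩ := hw.unique h1
    have hT : (T w : Hecke n) = T v * gN n m := by
      rw [hwv, ← T_mul_gen h2, gN, dif_pos hlt]
    obtain ⟨A, hA⟩ : ∃ A, A = shrink (trunc J (m + 1)) := ⟨_, rfl⟩
    have hAm : trunc A m = A := by
      ext i
      simp only [hA, trunc, shrink, Set.mem_ofPred_eq]
      constructor
      · exact fun h => h.1
      · exact fun h => ⟨h, by omega⟩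
    have hAm' : trunc A (m - 1) = shrink (trunc J m) := by
      ext i
      simp only [hA, trunc, shrink, Set.mem_ofPred_eq]
      constructor
      · exact fun h => ⟨⟨h.1.1.1, by omega⟩, h.1.2.1, by omega⟩
      · exact fun h => ⟨⟨⟨h.1.1, by omega⟩, h.2.1, by omega⟩, by omega⟩
    have hsub : trunc A (m - 1) ⊆ A := fun i hi' => hi'.1
    -- the last generator commutes with the smaller parabolic subgroup
    have hcomm : ∀ u ∈ parab n (shrink (trunc J m)), Commute (T u) (gN n m) := by
      refine commute_T_of_mem fun i hi' => ?_
      rw [← gN_val]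
      exact gN_comm (by have := hi'.2.2; omega)
    have hinner : normOne (shrink (trunc J m)) (T w) = jmProd n J m * gN n m := by
      rw [← ih (by omega) hv, normOne, normOne, Finset.sum_mul]
      refine Finset.sum_congr rfl fun u hu => ?_
      simp only [Finset.mem_filter, Finset.mem_univ, true_and] at hu
      rw [hT]
      simp only [mul_assoc]
      rw [(hcomm u hu).eq]
    rw [← hA, normOne, sum_parab_eq hsub]
    have hstep : ∀ d ∈ Finset.univ.filter (fun d => d ∈ parab n A ∧ LeftMin (trunc A (m - 1)) d),
        (∑ u ∈ Finset.univ.filter (fun u => u ∈ parab n (trunc A (m - 1))),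
          T (u * d)⁻¹ * T w * T (u * d)) =
        (jmProd n J m : Hecke n) * (T d⁻¹ * gN n m * T d) := by
      intro d hd
      simp only [Finset.mem_filter, Finset.mem_univ, true_and] at hd
      have e1 : ∀ u ∈ Finset.univ.filter (fun u => u ∈ parab n (trunc A (m - 1))),
          (T (u * d)⁻¹ * T w * T (u * d) : Hecke n) = T d⁻¹ * (T u⁻¹ * T w * T u) * T d := by
        intro u hu
        simp only [Finset.mem_filter, Finset.mem_univ, true_and] at hu
        exact T_inv_conj_mul hd.2 hu _
      rw [Finset.sum_congr rfl e1, ← Finset.sum_mul, ← Finset.mul_sum]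
      have hinner' : ∑ u ∈ Finset.univ.filter (fun u => u ∈ parab n (trunc A (m - 1))),
          (T u⁻¹ * T w * T u : Hecke n) = jmProd n J m * gN n m := by
        rw [← hinner, normOne, hAm']
      rw [hinner']
      have hc : Commute (T d⁻¹) (jmProd n J m) := by
        refine commute_T_of_mem (J := A) (fun i hi' => ?_) _ ((parab n A).inv_mem hd.1)
        rw [hA] at hi'
        have hmem := hi'.1.1
        have hlt' := hi'.2.2
        have htr : jmProd n (trunc J (m + 1)) m = jmProd n J m := by
          have : ∀ k ≤ m, jmProd n (trunc J (m + 1)) k = jmProd n J k := by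
            intro k hk
            induction k with
            | zero => rfl
            | succ k ihk =>
              rw [jmProd, jmProd, ihk (by omega), jucysMurphy, jucysMurphy,
                chain_congr (J := J) k fun i hi' => by simp [trunc]; omega]
              have : k ∈ trunc J (m + 1) ↔ k ∈ J := by simp [trunc]; omega
              simp only [this]
          exact this m le_rfl
        rw [← htr, ← gN_val]
        exact commute_jmProd (fun j hj => by have := hj.2; omega) m hi'.1 (by omega)
      simp only [← mul_assoc]
      rw [hc.eq]
    rw [Finset.sum_congr rfl hstep, ← Finset.mul_sum, jmProd_succ_of_mem hmJ]
    congr 1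
    have h3 := sum_chain_rep A m (by omega) (gN n m)
    rw [hAm] at h3
    rw [h3, jucysMurphy]
    rw [chain_shrink (J := trunc J (m + 1)) (fun i => by rw [hA]; rfl) m
      ⟨hmJ, Nat.lt_succ_self m⟩]
    exact chain_congr m (fun i hi' => by simp [trunc]; omega) _

/-- The partial sums of `λ - 1` are the partial sums of `λ` and their predecessors. -/
theorem exists_sizeUpTo_minusOne (c : Composition n) (m : ℕ) (hm : m < n) :
    (∃ j, (minusOne c).sizeUpTo j = m) ↔
      (∃ j, c.sizeUpTo j = m) ∨ ∃ j, c.sizeUpTo j = m + 1 := by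
  have key : ∀ L : List ℕ, (∀ a ∈ L, 0 < a) → ∀ m < L.sum,
      ((∃ j, ((L.flatMap fun a => if 1 < a then [a - 1, 1] else [a]).take j).sum = m) ↔
        (∃ j, (L.take j).sum = m) ∨ ∃ j, (L.take j).sum = m + 1) := by
    intro L
    induction L with
    | nil => intro _ m hm; simp at hm
    | cons a L ih =>
      intro hpos m hm
      have ha := hpos a (by simp)
      have ih' := ih fun b hb => hpos b (by simp [hb])
      rw [List.sum_cons] at hm
      have split : ∀ (P : ℕ → Prop), (∃ j, P j) ↔ P 0 ∨ ∃ j, P (j + 1) := fun P =>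
        ⟨fun ⟨j, hj⟩ => by
          cases j with
          | zero => exact Or.inl hj
          | succ j => exact Or.inr ⟨j, hj⟩,
         fun h => h.elim (fun h => ⟨0, h⟩) fun ⟨j, hj⟩ => ⟨j + 1, hj⟩⟩
      have shift : ∀ (L' : List ℕ) (b p : ℕ), (∃ j, b + (L'.take j).sum = p) ↔
          b ≤ p ∧ ∃ j, (L'.take j).sum = p - b := fun L' b p =>
        ⟨fun ⟨j, hj⟩ => ⟨by omega, j, by omega⟩, fun ⟨h, j, hj⟩ => ⟨j, by omega⟩⟩
      have zero : ∀ L' : List ℕ, ∃ j, (L'.take j).sum = 0 := fun L' => ⟨0, by simp⟩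
      rw [split fun j => ((a :: L).take j).sum = m, split fun j => ((a :: L).take j).sum = m + 1]
      rw [List.flatMap_cons]
      simp only [List.take_succ_cons, List.sum_cons, List.take_zero, List.sum_nil, shift L a]
      split_ifs with h1
      · simp only [List.cons_append, List.nil_append]
        rw [split, split]
        simp only [List.take_succ_cons, List.sum_cons, List.take_zero, List.sum_nil,
          ← add_assoc]
        rw [Nat.sub_add_cancel ha, shift]
        rcases Nat.lt_or_ge m a with h2 | h2
        · have h3 : ∀ Q : Prop, (a ≤ m ∧ Q) ↔ False := fun Q =>
            ⟨fun h => absurd h.1 (by omega), False.elim⟩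
          simp only [h3]
          rcases Nat.lt_or_ge (m + 1) a with h4 | h4
          · have h5 : ∀ Q : Prop, (a ≤ m + 1 ∧ Q) ↔ False := fun Q =>
              ⟨fun h => absurd h.1 (by omega), False.elim⟩
            simp only [h5]
            grind
          · have h5 : m + 1 - a = 0 := by omega
            simp only [h5, zero, and_true]
            omega
        · rw [ih' (m - a) (by omega), show m - a + 1 = m + 1 - a by omega]
          have h6 : a ≤ m + 1 := by omega
          simp only [h2, h6, true_and]
          grind
      · have ha1 : a = 1 := by omega
        subst ha1
        simp only [List.cons_append, List.nil_append]
        rw [split]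
        simp only [List.take_succ_cons, List.sum_cons, List.take_zero, List.sum_nil, shift]
        rcases Nat.eq_zero_or_pos m with h2 | h2
        · subst h2
          simp
        · rw [ih' (m - 1) (by omega), show m - 1 + 1 = m + 1 - 1 by omega]
          have h6 : 1 ≤ m + 1 := by omega
          have h7 : 1 ≤ m := h2
          simp only [h6, h7, true_and]
          grind
  exact key c.blocks (fun a ha => c.blocks_pos ha) m (by rwa [c.blocks_sum])

theorem interior_minusOne (c : Composition n) : interior (minusOne c) = shrink (interior c) := by
  ext i
  have hn : ∃ j, c.sizeUpTo j = n := ⟨c.length, c.sizeUpTo_length⟩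
  simp only [interior, shrink, Set.mem_ofPred_eq]
  by_cases h1 : i + 1 < n
  · have h2 := not_congr (exists_sizeUpTo_minusOne c (i + 1) h1)
    simp only [not_or, not_exists] at h2
    rw [h2]
    constructor
    · rintro ⟨-, h3, h4⟩
      refine ⟨⟨h1, h3⟩, ?_, h4⟩
      obtain ⟨j, hj⟩ := hn
      have := h4 j
      omega
    · rintro ⟨⟨_, h3⟩, _, h4⟩
      exact ⟨h1, h3, h4⟩
  · constructor
    · exact fun h => absurd h.1 h1
    · exact fun h => absurd h.1.1 h1

theorem relNorm_bot (J : Set ℕ) (h : Hecke n) : relNorm (parab n J) ⊥ h = normOne J h := by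
  classical
  rw [relNorm, normOne]
  refine Finset.sum_congr ?_ fun _ _ => rfl
  ext d
  simp only [Finset.mem_filter, Finset.mem_univ, true_and, distinguished_bot]

/-- The Coxeter class element of the parabolic subgroup of `J`. -/
noncomputable def etaSet (n : ℕ) (J : Set ℕ) : Hecke n := normOne (shrink J) (T (coxOf n J))

theorem eta_eq (c : Composition n) : eta c = etaSet n (interior c) := by
  rw [eta, parabolic_eq, interior_minusOne, relNorm_bot, coxeterElement_eq, etaSet]

theorem etaSet_eq_jmProd {J : Set ℕ} (hJ : ∀ i ∈ J, i + 1 < n) :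
    etaSet n J = jmProd n J (n - 1) := by
  have h : trunc J (n - 1) = J := by
    ext i
    simp only [trunc, Set.mem_ofPred_eq]
    exact ⟨fun h => h.1, fun h => ⟨h, by have := hJ i h; omega⟩⟩
  rw [etaSet, ← normOne_eq_jmProd J _ le_rfl (h.symm ▸ isCox_coxOf J), h]

/-- The Coxeter class element is central in the subalgebra of the parabolic subgroup. -/
theorem commute_etaSet {J : Set ℕ} (hJ : ∀ i ∈ J, i + 1 < n) :
    ∀ w ∈ parab n J, Commute (T w) (etaSet n J) := by
  refine commute_T_of_mem fun i hi' => ?_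
  rw [etaSet_eq_jmProd hJ, ← gN_val]
  exact commute_jmProd hJ _ hi' i.2

/-- Every `T_w` occurring in the Coxeter class element of the parabolic subgroup of `J` has full
support: `w` lies in this subgroup, but in none of its proper parabolic subgroups. -/
theorem etaSet_mem_supported {J : Set ℕ} (hJ : ∀ i ∈ J, i + 1 < n) :
    etaSet n J ∈ supported {w : Equiv.Perm (Fin n) |
      w ∈ parab n J ∧ ∀ i ∈ J, ¬ Stab i w} := by
  intro w hw
  rw [etaSet_eq_jmProd hJ]
  by_cases h1 : w ∈ parab n J
  · have h2 : ∃ i ∈ J, Stab i w := by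
      by_contra h
      push Not at h
      exact hw ⟨h1, h⟩
    obtain ⟨i, hi', hs⟩ := h2
    have := hJ i hi'
    exact jmProd_mem_notStab J (n - 1) (by omega) i (by omega) hi' w
      fun h => h hs
  · exact jmProd_mem_parab J (n - 1) _ (fun _ _ h => h) w h1

/-! ### Projections onto parabolic subalgebras -/

open Classical in
/-- The projection onto the subalgebra of the parabolic subgroup of `Λ`. -/
noncomputable def projSet (n : ℕ) (Λ : Set ℕ) : Hecke n →ₗ[Polynomial ℤ] Hecke n :=
  (basisT n).constr (Polynomial ℤ) fun w => if w ∈ parab n Λ then T w else 0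

theorem proj_eq (c : Composition n) : proj c = projSet n (interior c) := by
  rw [proj, projSet, parabolic_eq]

open Classical in
theorem projSet_T (Λ : Set ℕ) (w : Equiv.Perm (Fin n)) :
    projSet n Λ (T w) = if w ∈ parab n Λ then T w else 0 := by
  rw [projSet, ← basisT_apply, Module.Basis.constr_basis, basisT_apply]

theorem coord_projSet_of_mem {Λ : Set ℕ} {v : Equiv.Perm (Fin n)} (hv : v ∈ parab n Λ)
    (a : Hecke n) : (basisT n).coord v (projSet n Λ a) = (basisT n).coord v a := by
  have : (basisT n).coord v ∘ₗ projSet n Λ = (basisT n).coord v := by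
    refine linearMap_ext_T fun w => ?_
    rw [LinearMap.comp_apply, projSet_T]
    split_ifs with h
    · rfl
    · rw [map_zero, coord_T, if_neg]
      rintro rfl
      exact h hv
  exact congrArg (fun f => f a) this

theorem coord_projSet_of_notMem {Λ : Set ℕ} {v : Equiv.Perm (Fin n)} (hv : v ∉ parab n Λ)
    (a : Hecke n) : (basisT n).coord v (projSet n Λ a) = 0 := by
  have : (basisT n).coord v ∘ₗ projSet n Λ = 0 := by
    refine linearMap_ext_T fun w => ?_
    rw [LinearMap.comp_apply, projSet_T, LinearMap.zero_apply]
    split_ifs with h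
    · rw [coord_T, if_neg]
      rintro rfl
      exact hv h
    · exact map_zero _
  exact congrArg (fun f => f a) this

theorem projSet_gen_mul {Λ : Set ℕ} {i : Fin (n - 1)} (hi' : (i : ℕ) ∈ Λ) (a : Hecke n) :
    projSet n Λ (gen i * a) = gen i * projSet n Λ a := by
  have : projSet n Λ ∘ₗ LinearMap.mul (Polynomial ℤ) (Hecke n) (gen i) =
      LinearMap.mul (Polynomial ℤ) (Hecke n) (gen i) ∘ₗ projSet n Λ := by
    refine linearMap_ext_T (M := Hecke n) fun w => ?_
    have h1 : simpleRefl i * w ∈ parab n Λ ↔ w ∈ parab n Λ :=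
      Subgroup.mul_mem_cancel_left _ (simpleRefl_mem_parab.mpr hi')
    simp only [LinearMap.comp_apply, LinearMap.mul_apply']
    rw [projSet_T]
    by_cases hd : Desc i w
    · rw [gen_mul_T_of_desc hd, map_add, map_smul, projSet_T, projSet_T]
      by_cases h : w ∈ parab n Λ
      · rw [if_pos (h1.mpr h), if_pos h, gen_mul_T_of_desc hd]
      · rw [if_neg (mt h1.mp h), if_neg h, mul_zero, smul_zero, add_zero]
    · rw [gen_mul_T_of_not_desc hd, projSet_T]
      by_cases h : w ∈ parab n Λ
      · rw [if_pos (h1.mpr h), if_pos h, gen_mul_T_of_not_desc hd]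
      · rw [if_neg (mt h1.mp h), if_neg h, mul_zero]
  exact congrArg (fun f => f a) this

theorem projSet_mul_gen {Λ : Set ℕ} {i : Fin (n - 1)} (hi' : (i : ℕ) ∈ Λ) (a : Hecke n) :
    projSet n Λ (a * gen i) = projSet n Λ a * gen i := by
  have : projSet n Λ ∘ₗ (LinearMap.mul (Polynomial ℤ) (Hecke n)).flip (gen i) =
      (LinearMap.mul (Polynomial ℤ) (Hecke n)).flip (gen i) ∘ₗ projSet n Λ := by
    refine linearMap_ext_T (M := Hecke n) fun w => ?_
    have h1 : w * simpleRefl i ∈ parab n Λ ↔ w ∈ parab n Λ :=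
      Subgroup.mul_mem_cancel_right _ (simpleRefl_mem_parab.mpr hi')
    simp only [LinearMap.comp_apply, LinearMap.flip_apply, LinearMap.mul_apply']
    rw [projSet_T]
    rcases lt_trichotomy (w (lo i)) (w (hi i)) with hd | hd | hd
    · rw [T_mul_gen hd, projSet_T]
      by_cases h : w ∈ parab n Λ
      · rw [if_pos (h1.mpr h), if_pos h, T_mul_gen hd]
      · rw [if_neg (mt h1.mp h), if_neg h, zero_mul]
    · exact absurd (w.injective hd) (lo_lt_hi i).ne
    · rw [T_mul_gen_of_gt hd, map_add, map_smul, projSet_T, projSet_T]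
      by_cases h : w ∈ parab n Λ
      · rw [if_pos (h1.mpr h), if_pos h, T_mul_gen_of_gt hd]
      · rw [if_neg (mt h1.mp h), if_neg h, zero_mul, smul_zero, add_zero]
  exact congrArg (fun f => f a) this

theorem projSet_T_mul {Λ : Set ℕ} (a : Hecke n) : ∀ y ∈ parab n Λ,
    projSet n Λ (T y * a) = T y * projSet n Λ a := by
  refine parab_induction (by rw [T_one, one_mul, one_mul]) ?_
  intro i w hi' _ hd ih
  rw [← gen_mul_T_of_not_desc hd, mul_assoc, projSet_gen_mul hi', ih, mul_assoc]

theorem projSet_mul_T {Λ : Set ℕ} : ∀ y ∈ parab n Λ, ∀ a : Hecke n,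
    projSet n Λ (a * T y) = projSet n Λ a * T y := by
  refine parab_induction (fun a => by rw [T_one, mul_one, mul_one]) ?_
  intro i w hi' _ hd ih a
  rw [← gen_mul_T_of_not_desc hd, ← mul_assoc, ih, projSet_mul_gen hi', mul_assoc]

theorem eq_of_supported {X : Set (Equiv.Perm (Fin n))} {f g : Hecke n →ₗ[Polynomial ℤ] Hecke n}
    (h : ∀ w ∈ X, f (T w) = g (T w)) {a : Hecke n} (ha : a ∈ supported X) : f a = g a := by
  rw [← sum_coord_smul_T a, map_sum, map_sum]
  refine Finset.sum_congr rfl fun w _ => ?_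
  rw [map_smul, map_smul]
  by_cases hw : w ∈ X
  · rw [h w hw]
  · rw [ha w hw, zero_smul, zero_smul]

open Classical in
/-- The projection in terms of the trace form. -/
theorem projSet_eq_sum (J : Set ℕ) (a : Hecke n) :
    projSet n J a =
      ∑ w ∈ Finset.univ.filter (fun w => w ∈ parab n J), tau (a * T w⁻¹) • T w := by
  rw [← sum_coord_smul_T (projSet n J a), Finset.sum_filter]
  refine Finset.sum_congr rfl fun w _ => ?_
  split_ifs with h
  · rw [coord_projSet_of_mem h, coord_eq_tau]
  · rw [coord_projSet_of_notMem h, zero_smul]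

theorem isUnit_gen (i : Fin (n - 1)) : IsUnit (gen i : Hecke n) := by
  have h1 : (gen i : Hecke n) * (gen i + (-Polynomial.X : Polynomial ℤ) • 1) = 1 := by
    rw [mul_add, gen_quad, mul_smul_comm, mul_one, add_assoc, ← add_smul, add_neg_cancel,
      zero_smul, add_zero]
  have h2 : (gen i + (-Polynomial.X : Polynomial ℤ) • 1) * (gen i : Hecke n) = 1 := by
    rw [add_mul, gen_quad, smul_mul_assoc, one_mul, add_assoc, ← add_smul, add_neg_cancel,
      zero_smul, add_zero]
  exact ⟨⟨_, _, h1, h2⟩, rfl⟩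

theorem isUnit_T (w : Equiv.Perm (Fin n)) : IsUnit (T w : Hecke n) := by
  have key : ∀ w ∈ parab n Set.univ, IsUnit (T w : Hecke n) := by
    refine parab_induction (by rw [T_one]; exact isUnit_one) ?_
    intro i w _ _ hd ih
    rw [← gen_mul_T_of_not_desc hd]
    exact (isUnit_gen i).mul ih
  exact key w (by rw [parab_univ]; trivial)

/-! ### Block isomorphisms -/

/-- The permutation `e` carries the simple reflections in `J` order-preservingly to those in `K`:
it translates every block of `J` onto a block of `K`. -/
def BlockIso (e : Equiv.Perm (Fin n)) (J K : Set ℕ) : Prop :=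
  (∀ i : Fin (n - 1), (i : ℕ) ∈ J →
    ∃ j : Fin (n - 1), (j : ℕ) ∈ K ∧ e (lo i) = lo j ∧ e (hi i) = hi j) ∧
  ∀ j : Fin (n - 1), (j : ℕ) ∈ K →
    ∃ i : Fin (n - 1), (i : ℕ) ∈ J ∧ e (lo i) = lo j ∧ e (hi i) = hi j

namespace BlockIso

variable {e : Equiv.Perm (Fin n)} {J K : Set ℕ}

theorem symm (h : BlockIso e J K) : BlockIso e⁻¹ K J := by
  constructor
  · intro j hj
    obtain ⟨i, hi', h1, h2⟩ := h.2 j hj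
    exact ⟨i, hi', by rw [← h1]; simp, by rw [← h2]; simp⟩
  · intro i hi'
    obtain ⟨j, hj, h1, h2⟩ := h.1 i hi'
    exact ⟨j, hj, by rw [← h1]; simp, by rw [← h2]; simp⟩

theorem trans {f : Equiv.Perm (Fin n)} {M : Set ℕ} (h : BlockIso e J K) (h' : BlockIso f K M) :
    BlockIso (f * e) J M := by
  constructor
  · intro i hi'
    obtain ⟨j, hj, h1, h2⟩ := h.1 i hi'
    obtain ⟨m, hm, h3, h4⟩ := h'.1 j hj
    exact ⟨m, hm, by rw [Equiv.Perm.mul_apply, h1, h3], by rw [Equiv.Perm.mul_apply, h2, h4]⟩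
  · intro m hm
    obtain ⟨j, hj, h3, h4⟩ := h'.2 m hm
    obtain ⟨i, hi', h1, h2⟩ := h.2 j hj
    exact ⟨i, hi', by rw [Equiv.Perm.mul_apply, h1, h3], by rw [Equiv.Perm.mul_apply, h2, h4]⟩

theorem conj_mem (h : BlockIso e J K) : ∀ w ∈ parab n J, e * w * e⁻¹ ∈ parab n K := by
  refine parab_induction (by simp) ?_
  intro i w hi' _ _ ih
  obtain ⟨j, hj, h1, h2⟩ := h.1 i hi'
  have h3 : e * simpleRefl i * e⁻¹ = simpleRefl j := by
    rw [simpleRefl, ← Equiv.swap_apply_apply, h1, h2, simpleRefl]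
  have h4 : e * (simpleRefl i * w) * e⁻¹ = (e * simpleRefl i * e⁻¹) * (e * w * e⁻¹) := by group
  rw [h4, h3]
  exact Subgroup.mul_mem _ (simpleRefl_mem_parab.mpr hj) ih

theorem conj_mem_iff (h : BlockIso e J K) {w : Equiv.Perm (Fin n)} :
    e * w * e⁻¹ ∈ parab n K ↔ w ∈ parab n J := by
  refine ⟨fun hw => ?_, h.conj_mem w⟩
  have := h.symm.conj_mem _ hw
  rwa [inv_inv, show e⁻¹ * (e * w * e⁻¹) * e = w by group] at this

theorem leftMin_inv (h : BlockIso e J K) : LeftMin J e⁻¹ := by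
  intro i hi'
  obtain ⟨j, -, h1, h2⟩ := h.1 i hi'
  rw [not_desc_iff, inv_inv, h1, h2]
  exact lo_lt_hi j

theorem leftMin (h : BlockIso e J K) : LeftMin K e := by
  have := h.symm.leftMin_inv
  rwa [inv_inv] at this

/-- Conjugation by `T_{e⁻¹}` permutes basis elements, since both sides of
`w e⁻¹ = e⁻¹ (e w e⁻¹)` are products with additive lengths. -/
theorem T_mul_T_inv (h : BlockIso e J K) {w : Equiv.Perm (Fin n)} (hw : w ∈ parab n J) :
    (T w : Hecke n) * T e⁻¹ = T e⁻¹ * T (e * w * e⁻¹) := by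
  rw [h.leftMin_inv.T_mul hw, h.leftMin.T_inv_mul (h.conj_mem w hw)]
  congr 1
  group

theorem shrink (h : BlockIso e J K) (hJ : ∀ i ∈ J, i + 1 < n) (hK : ∀ i ∈ K, i + 1 < n) :
    BlockIso e (shrink J) (shrink K) := by
  have key : ∀ {e : Equiv.Perm (Fin n)} {J K : Set ℕ}, BlockIso e J K → (∀ i ∈ J, i + 1 < n) →
      ∀ i : Fin (n - 1), (i : ℕ) ∈ NormBasis.shrink J → ∃ j : Fin (n - 1),
        (j : ℕ) ∈ NormBasis.shrink K ∧ e (lo i) = lo j ∧ e (hi i) = hi j := by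
    intro e J K h hJ i hi'
    obtain ⟨j, hj, h1, h2⟩ := h.1 i hi'.1
    have hlt := hJ _ hi'.2
    obtain ⟨j', hj', h3, h4⟩ := h.1 ⟨(i : ℕ) + 1, by omega⟩ hi'.2
    have h5 : (hi j : Fin n) = lo j' := by rw [← h2, ← h3]; rfl
    refine ⟨j, ⟨hj, ?_⟩, h1, h2⟩
    have h6 : (j : ℕ) + 1 = j' := congrArg Fin.val h5
    rwa [h6]
  refine ⟨key h hJ, fun j hj => ?_⟩
  obtain ⟨i, hi', h1, h2⟩ := key h.symm hK j hj
  exact ⟨i, hi', by rw [← h1]; simp, by rw [← h2]; simp⟩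

theorem conj_coxOf (h : BlockIso e J K) : e * coxOf n J * e⁻¹ = coxOf n K := by
  refine IsCox.unique (J := K) ⟨h.conj_mem _ (isCox_coxOf J).1, fun j hj => ?_⟩ (isCox_coxOf K)
  obtain ⟨i, hi', h1, h2⟩ := h.2 j hj
  rw [Equiv.Perm.mul_apply, Equiv.Perm.mul_apply, ← h1, Equiv.Perm.inv_def, Equiv.symm_apply_apply,
    (isCox_coxOf J).2 i hi', h2]

theorem etaSet_mul (h : BlockIso e J K) (hJ : ∀ i ∈ J, i + 1 < n) (hK : ∀ i ∈ K, i + 1 < n) :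
    etaSet n J * T e⁻¹ = T e⁻¹ * etaSet n K := by
  classical
  have hs := h.shrink hJ hK
  have hmono : ∀ J : Set ℕ, parab n (NormBasis.shrink J) ≤ parab n J := fun J =>
    parab_mono fun i hi' => hi'.1
  rw [etaSet, etaSet, normOne, normOne, Finset.sum_mul, Finset.mul_sum]
  refine Finset.sum_bij (fun u _ => e * u * e⁻¹) ?_ ?_ ?_ ?_
  · intro u hu
    simp only [Finset.mem_filter, Finset.mem_univ, true_and] at hu ⊢
    exact hs.conj_mem u hu
  · intro u _ u' _ huu
    exact mul_left_cancel (mul_right_cancel huu)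
  · intro v hv
    simp only [Finset.mem_filter, Finset.mem_univ, true_and] at hv
    have e1 : e * (e⁻¹ * v * e) * e⁻¹ = v := by group
    refine ⟨e⁻¹ * v * e, ?_, e1⟩
    simp only [Finset.mem_filter, Finset.mem_univ, true_and]
    rw [← hs.conj_mem_iff, e1]
    exact hv
  · intro u hu
    simp only [Finset.mem_filter, Finset.mem_univ, true_and] at hu
    have h1 := hmono J hu
    rw [mul_assoc, h.T_mul_T_inv h1, ← mul_assoc, mul_assoc (T u⁻¹),
      h.T_mul_T_inv (isCox_coxOf J).1, ← mul_assoc, h.T_mul_T_inv ((parab n J).inv_mem h1),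
      h.conj_coxOf, show e * u⁻¹ * e⁻¹ = (e * u * e⁻¹)⁻¹ by group]
    simp only [mul_assoc]

end BlockIso

/-! ### Relative norms -/

open Classical in
/-- The relative norm from the parabolic subgroup of `J` to that of `Λ`. -/
noncomputable def normSet (Λ J : Set ℕ) (h : Hecke n) : Hecke n :=
  ∑ d ∈ Finset.univ.filter (fun d => d ∈ parab n Λ ∧ LeftMin J d), T d⁻¹ * h * T d

theorem relNorm_eq (Λ J : Set ℕ) (h : Hecke n) :
    relNorm (parab n Λ) (parab n J) h = normSet Λ J h := by
  classical
  rw [relNorm, normSet]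
  refine Finset.sum_congr ?_ fun _ _ => rfl
  ext d
  simp only [Finset.mem_filter, Finset.mem_univ, true_and, distinguished_iff]

open Classical in
/-- Expansion of an element with respect to the left module basis `T_d` over the parabolic
subalgebra of `J`. -/
theorem sum_projSet_mul_T {J Λ : Set ℕ} (hJΛ : J ⊆ Λ) {y : Hecke n}
    (hy : y ∈ supported (parab n Λ : Set (Equiv.Perm (Fin n)))) :
    ∑ d ∈ Finset.univ.filter (fun d => d ∈ parab n Λ ∧ LeftMin J d),
      projSet n J (y * T d⁻¹) * T d = y := by
  have h1 : ∀ d ∈ Finset.univ.filter (fun d => d ∈ parab n Λ ∧ LeftMin J d),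
      projSet n J (y * T d⁻¹) * T d =
        ∑ u ∈ Finset.univ.filter (fun u => u ∈ parab n J),
          (basisT n).coord (u * d) y • (T (u * d) : Hecke n) := by
    intro d hd
    simp only [Finset.mem_filter, Finset.mem_univ, true_and] at hd
    rw [projSet_eq_sum, Finset.sum_mul]
    refine Finset.sum_congr rfl fun u hu => ?_
    simp only [Finset.mem_filter, Finset.mem_univ, true_and] at hu
    rw [coord_eq_tau, smul_mul_assoc, hd.2.T_mul hu, mul_assoc,
      hd.2.T_inv_mul ((parab n J).inv_mem hu), mul_inv_rev]
  rw [Finset.sum_congr rfl h1,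
    ← sum_parab_eq hJΛ (fun x => (basisT n).coord x y • (T x : Hecke n)), Finset.sum_filter]
  conv_rhs => rw [← sum_coord_smul_T y]
  refine Finset.sum_congr rfl fun w _ => ?_
  split_ifs with h
  · rfl
  · rw [hy w h, zero_smul]

open Classical in
/-- Expansion of an element with respect to the right module basis `T_{d⁻¹}` over the parabolic
subalgebra of `J`. -/
theorem sum_T_mul_projSet {J Λ : Set ℕ} (hJΛ : J ⊆ Λ) {y : Hecke n}
    (hy : y ∈ supported (parab n Λ : Set (Equiv.Perm (Fin n)))) :
    ∑ d ∈ Finset.univ.filter (fun d => d ∈ parab n Λ ∧ LeftMin J d),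
      T d⁻¹ * projSet n J (T d * y) = y := by
  have h1 : ∀ d ∈ Finset.univ.filter (fun d => d ∈ parab n Λ ∧ LeftMin J d),
      T d⁻¹ * projSet n J (T d * y) =
        ∑ u ∈ Finset.univ.filter (fun u => u ∈ parab n J),
          (basisT n).coord (u * d)⁻¹ y • (T (u * d)⁻¹ : Hecke n) := by
    intro d hd
    simp only [Finset.mem_filter, Finset.mem_univ, true_and] at hd
    rw [projSet_eq_sum, Finset.mul_sum]
    refine Finset.sum_bij (fun u _ => u⁻¹) ?_ (fun _ _ _ _ h => inv_injective h) ?_ ?_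
    · intro u hu
      simpa using hu
    · intro u hu
      exact ⟨u⁻¹, by simpa using hu, inv_inv u⟩
    · intro u hu
      simp only [Finset.mem_filter, Finset.mem_univ, true_and] at hu
      rw [coord_eq_tau, inv_inv, mul_smul_comm, hd.2.T_inv_mul hu, mul_assoc, tau_mul_comm,
        mul_assoc, hd.2.T_mul ((parab n J).inv_mem hu), mul_inv_rev, inv_inv]
  rw [Finset.sum_congr rfl h1,
    ← sum_parab_eq hJΛ (fun x => (basisT n).coord x⁻¹ y • (T x⁻¹ : Hecke n)), Finset.sum_filter]
  conv_rhs => rw [← sum_coord_smul_T y]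
  rw [← Equiv.sum_comp (Equiv.inv (Equiv.Perm (Fin n)))
    (fun w => (basisT n).coord w y • (T w : Hecke n))]
  refine Finset.sum_congr rfl fun w _ => ?_
  simp only [Equiv.inv_apply]
  split_ifs with h
  · rfl
  · rw [hy w⁻¹ (fun h' => h (by simpa using h')), zero_smul]

/-- Conjugation by a block isomorphism is compatible with the projections. -/
theorem BlockIso.projSet_mul {e : Equiv.Perm (Fin n)} {J K : Set ℕ} (h : BlockIso e J K)
    (x : Hecke n) :
    projSet n J (T e⁻¹ * x) * T e⁻¹ = T e⁻¹ * projSet n K (x * T e⁻¹) := by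
  classical
  rw [projSet_eq_sum, projSet_eq_sum, Finset.sum_mul, Finset.mul_sum]
  refine Finset.sum_bij (fun u _ => e * u * e⁻¹) ?_ ?_ ?_ ?_
  · intro u hu
    simp only [Finset.mem_filter, Finset.mem_univ, true_and] at hu ⊢
    exact h.conj_mem u hu
  · intro u _ u' _ huu
    exact mul_left_cancel (mul_right_cancel huu)
  · intro v hv
    simp only [Finset.mem_filter, Finset.mem_univ, true_and] at hv
    have e1 : e * (e⁻¹ * v * e) * e⁻¹ = v := by group
    refine ⟨e⁻¹ * v * e, ?_, e1⟩
    simp only [Finset.mem_filter, Finset.mem_univ, true_and]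
    rw [← h.conj_mem_iff, e1]
    exact hv
  · intro u hu
    simp only [Finset.mem_filter, Finset.mem_univ, true_and] at hu
    rw [smul_mul_assoc, mul_smul_comm, h.T_mul_T_inv hu, mul_assoc x,
      show (e * u * e⁻¹)⁻¹ = e * u⁻¹ * e⁻¹ by group,
      ← h.T_mul_T_inv ((parab n J).inv_mem hu), ← mul_assoc x, tau_mul_comm (x * T u⁻¹),
      mul_assoc (T e⁻¹)]

theorem mul_mem_supported_parab {Λ : Set ℕ} {x y : Equiv.Perm (Fin n)} (hx : x ∈ parab n Λ)
    (hy : y ∈ parab n Λ) :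
    (T x * T y : Hecke n) ∈ supported (parab n Λ : Set (Equiv.Perm (Fin n))) := by
  have key : ∀ x ∈ parab n Λ, ∀ a ∈ supported (parab n Λ : Set (Equiv.Perm (Fin n))),
      (T x * a : Hecke n) ∈ supported (parab n Λ : Set (Equiv.Perm (Fin n))) := by
    refine parab_induction (fun a ha => by rwa [T_one, one_mul]) ?_
    intro i w hi' _ hd ih a ha
    rw [← gen_mul_T_of_not_desc hd, mul_assoc]
    exact gen_mul_mem_supported
      (fun v hv => Subgroup.mul_mem _ (simpleRefl_mem_parab.mpr hi') hv) (ih a ha)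
  exact key x hx _ (T_mem_supported hy)

/-- The relative norm of the Coxeter class element depends only on the parabolic subgroup up to
conjugation: the relative Casimir element does not depend on the choice of dual bases. -/
theorem BlockIso.normSet_eq {e : Equiv.Perm (Fin n)} {J K Λ : Set ℕ} (h : BlockIso e J K)
    (hJ : ∀ i ∈ J, i + 1 < n) (hK : ∀ i ∈ K, i + 1 < n) (he : e ∈ parab n Λ) (hJΛ : J ⊆ Λ)
    (hKΛ : K ⊆ Λ) : (normSet Λ J (etaSet n J) : Hecke n) = normSet Λ K (etaSet n K) := by
  classical
  obtain ⟨V, hUV⟩ := (isUnit_T e⁻¹ : IsUnit (T e⁻¹ : Hecke n)).exists_right_inv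
  obtain ⟨V', hVU'⟩ := (isUnit_T e⁻¹ : IsUnit (T e⁻¹ : Hecke n)).exists_left_inv
  have hVV : V' = V := left_inv_eq_right_inv hVU' hUV
  rw [hVV] at hVU'
  have hVU : V * T e⁻¹ = 1 := hVU'
  have he' := (parab n Λ).inv_mem he
  have heta : etaSet n K = V * etaSet n J * T e⁻¹ := by
    rw [mul_assoc, h.etaSet_mul hJ hK, ← mul_assoc, hVU, one_mul]
  have hproj : ∀ x : Hecke n,
      V * projSet n J (T e⁻¹ * x) = projSet n K (x * T e⁻¹) * V := fun x => by
    have h1 := congrArg (fun y => V * y * V) (h.projSet_mul x)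
    simp only [mul_assoc] at h1
    rwa [hUV, mul_one, ← mul_assoc V (T e⁻¹), hVU, one_mul] at h1
  have hcomm : ∀ x : Hecke n, Commute (projSet n J x) (etaSet n J) := fun x => by
    rw [projSet_eq_sum]
    refine Commute.sum_left _ _ _ fun w hw => ?_
    simp only [Finset.mem_filter, Finset.mem_univ, true_and] at hw
    exact (commute_etaSet hJ w hw).smul_left _
  symm
  calc normSet Λ K (etaSet n K)
      = ∑ d' ∈ Finset.univ.filter (fun d => d ∈ parab n Λ ∧ LeftMin K d),
          ∑ d ∈ Finset.univ.filter (fun d => d ∈ parab n Λ ∧ LeftMin J d),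
            T d'⁻¹ * projSet n K (T d' * (T d⁻¹ * T e⁻¹)) * (V * etaSet n J * T d) := by
        rw [normSet]
        refine Finset.sum_congr rfl fun d' hd' => ?_
        simp only [Finset.mem_filter, Finset.mem_univ, true_and] at hd'
        have h1 := sum_projSet_mul_T hJΛ (mul_mem_supported_parab he' hd'.1)
        rw [heta]
        calc T d'⁻¹ * (V * etaSet n J * T e⁻¹) * T d'
            = T d'⁻¹ * V * etaSet n J * (T e⁻¹ * T d') := by simp only [mul_assoc]
          _ = _ := by
            rw [← h1, Finset.mul_sum]
            refine Finset.sum_congr rfl fun d _ => ?_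
            rw [← mul_assoc (T d') (T d⁻¹), mul_assoc (T e⁻¹)]
            calc T d'⁻¹ * V * etaSet n J * (projSet n J (T e⁻¹ * (T d' * T d⁻¹)) * T d)
                = T d'⁻¹ * V * (etaSet n J * projSet n J (T e⁻¹ * (T d' * T d⁻¹))) * T d := by
                  simp only [mul_assoc]
              _ = T d'⁻¹ * (V * projSet n J (T e⁻¹ * (T d' * T d⁻¹))) * etaSet n J * T d := by
                  rw [← (hcomm _).eq]; simp only [mul_assoc]
              _ = _ := by rw [hproj]; simp only [mul_assoc]
    _ = ∑ d ∈ Finset.univ.filter (fun d => d ∈ parab n Λ ∧ LeftMin J d),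
          T d⁻¹ * T e⁻¹ * (V * etaSet n J * T d) := by
        rw [Finset.sum_comm]
        refine Finset.sum_congr rfl fun d hd => ?_
        simp only [Finset.mem_filter, Finset.mem_univ, true_and] at hd
        rw [← Finset.sum_mul, sum_T_mul_projSet hKΛ
          (mul_mem_supported_parab ((parab n Λ).inv_mem hd.1) he')]
    _ = _ := by
        rw [normSet]
        refine Finset.sum_congr rfl fun d _ => ?_
        calc T d⁻¹ * T e⁻¹ * (V * etaSet n J * T d)
            = T d⁻¹ * (T e⁻¹ * V) * etaSet n J * T d := by simp only [mul_assoc]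
          _ = _ := by rw [hUV, mul_one]

/-! ### The Mackey formula -/

theorem len_mul_le (x y : Equiv.Perm (Fin n)) : len (x * y) ≤ len x + len y := by
  obtain ⟨l, h1, h2⟩ := exists_reduced x
  obtain ⟨l', h1', h2'⟩ := exists_reduced y
  have := len_le (l := l ++ l') (w := x * y) (by rw [wordProd_append, h1, h1'])
  rwa [List.length_append, h2, h2'] at this

/-- In a product `d y` with additive lengths, minimality from the left passes to the factor `d`. -/
theorem LeftMin.of_mul {J Λ : Set ℕ} {d y : Equiv.Perm (Fin n)} (h : LeftMin J (d * y))
    (hd : LeftMin Λ d⁻¹) (hy : y ∈ parab n Λ) : LeftMin J d := by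
  intro i hi' hdesc
  refine h i hi' (desc_of_len ?_)
  have h1 := hd.len_inv_mul hy
  rw [inv_inv] at h1
  have h2 := len_mul_le (simpleRefl i * d) y
  have h3 := hdesc.len_eq
  rw [← mul_assoc, h1]
  omega

open Classical in
/-- Every distinguished coset representative factors uniquely as `x = d y`, where `d` is a
distinguished double coset representative and `y` lies in the parabolic subgroup of `Λ`. -/
theorem sum_leftMin_eq {M : Type*} [AddCommMonoid M] (J Λ : Set ℕ)
    (F : Equiv.Perm (Fin n) → M) :
    ∑ x ∈ Finset.univ.filter (fun x => LeftMin J x), F x =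
      ∑ d ∈ Finset.univ.filter (fun d => LeftMin J d ∧ LeftMin Λ d⁻¹),
        ∑ y ∈ Finset.univ.filter (fun y => y ∈ parab n Λ ∧ LeftMin J (d * y)), F (d * y) := by
  rw [Finset.sum_sigma']
  symm
  refine Finset.sum_bij (fun p _ => p.1 * p.2) ?_ ?_ ?_ ?_
  · rintro ⟨d, y⟩ h
    simp only [Finset.mem_sigma, Finset.mem_filter, Finset.mem_univ, true_and] at h ⊢
    exact h.2.2
  · rintro ⟨d, y⟩ h ⟨d', y'⟩ h' e
    simp only [Finset.mem_sigma, Finset.mem_filter, Finset.mem_univ, true_and] at h h'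
    have e' : y⁻¹ * d⁻¹ = y'⁻¹ * d'⁻¹ := by rw [← mul_inv_rev, ← mul_inv_rev]; exact congrArg _ e
    obtain ⟨h1, h2⟩ := h.1.2.eq_of_mul_eq h'.1.2 ((parab n Λ).inv_mem h.2.1)
      ((parab n Λ).inv_mem h'.2.1) e'
    rw [inv_injective h1, inv_injective h2]
  · intro x hx
    simp only [Finset.mem_filter, Finset.mem_univ, true_and] at hx
    obtain ⟨u, hu, d, hd, hud⟩ := exists_leftMin_mul Λ x⁻¹
    have hx' : d⁻¹ * u⁻¹ = x := by rw [← mul_inv_rev, hud, inv_inv]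
    have hd' : LeftMin Λ (d⁻¹)⁻¹ := by rwa [inv_inv]
    have hu' := (parab n Λ).inv_mem hu
    refine ⟨⟨d⁻¹, u⁻¹⟩, ?_, hx'⟩
    simp only [Finset.mem_sigma, Finset.mem_filter, Finset.mem_univ, true_and]
    rw [← hx'] at hx
    exact ⟨⟨hx.of_mul hd' hu', hd'⟩, hu', hx⟩
  · intro p _
    rfl

open Classical in
/-- Only the group element `d⁻¹ w d` contributes to the projection of `T_{d⁻¹} T_w T_d`. The
coefficient at `v` is the trace of `T_{d⁻¹} T_w T_d T_{v⁻¹}`, which is the trace of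
`T_{d⁻¹ w} T_{d v⁻¹}`, because the lengths are additive on both sides. -/
theorem projSet_conj_T {J Λ : Set ℕ} {d w : Equiv.Perm (Fin n)} (hJ : LeftMin J d)
    (hΛ : LeftMin Λ d⁻¹) (hw : w ∈ parab n J) :
    projSet n Λ (T d⁻¹ * T w * T d) =
      if d⁻¹ * w * d ∈ parab n Λ then T (d⁻¹ * w * d) else 0 := by
  refine ext_coord fun v => ?_
  by_cases hv : v ∈ parab n Λ
  · have h1 := hΛ.T_inv_mul ((parab n Λ).inv_mem hv)
    rw [inv_inv] at h1
    rw [coord_projSet_of_mem hv, hJ.T_inv_mul hw, coord_eq_tau, mul_assoc, h1, tau_T_mul_T,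
      apply_ite ((basisT n).coord v), map_zero, coord_T]
    have h2 : d⁻¹ * w * (d * v⁻¹) = 1 ↔ d⁻¹ * w * d = v := by
      rw [← mul_assoc, mul_inv_eq_one]
    by_cases h3 : d⁻¹ * w * d = v
    · rw [if_pos (h2.mpr h3), if_pos (h3 ▸ hv), if_pos h3]
    · rw [if_neg (mt h2.mp h3), if_neg h3, ite_self]
  · rw [coord_projSet_of_notMem hv]
    split_ifs with h
    · rw [coord_T, if_neg]
      rintro rfl
      exact hv h
    · rw [map_zero]

/-- The set of simple reflections `d⁻¹ s_i d` with `i ∈ J`, for a `d` for which these are simple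
reflections. -/
def conjSet (d : Equiv.Perm (Fin n)) (J : Set ℕ) : Set ℕ :=
  {j | ∃ i : Fin (n - 1), (i : ℕ) ∈ J ∧ ((d⁻¹ (lo i) : Fin n) : ℕ) = j}

/-- If `d` is a distinguished double coset representative with `d⁻¹ W_J d ⊆ W_Λ`, then `d⁻¹ W_J d`
is a standard parabolic subgroup and the conjugation preserves the order within the blocks. -/
theorem blockIso_conjSet {J Λ : Set ℕ} {d : Equiv.Perm (Fin n)} (hJ : LeftMin J d)
    (hΛ : LeftMin Λ d⁻¹)
    (hd : ∀ i : Fin (n - 1), (i : ℕ) ∈ J → SameBlock Λ (d⁻¹ (lo i)) (d⁻¹ (hi i))) :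
    BlockIso d⁻¹ J (conjSet d J) ∧ conjSet d J ⊆ Λ ∧ ∀ i ∈ conjSet d J, i + 1 < n := by
  have key : ∀ i : Fin (n - 1), (i : ℕ) ∈ J →
      ((d⁻¹ (hi i) : Fin n) : ℕ) = (d⁻¹ (lo i) : Fin n) + 1 := by
    intro i hi'
    have h1 := (not_desc_iff _ _).mp (hJ i hi')
    have h1' : ((d⁻¹ (lo i) : Fin n) : ℕ) < (d⁻¹ (hi i) : Fin n) := h1
    by_contra hne
    -- a point strictly between would be sent by `d` strictly between `i` and `i + 1`
    obtain ⟨m, hm⟩ : ∃ m : Fin n, (m : ℕ) = (d⁻¹ (lo i) : Fin n) + 1 :=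
      ⟨⟨(d⁻¹ (lo i) : Fin n) + 1, by have := (d⁻¹ (hi i)).2; omega⟩, rfl⟩
    have hsb := (sameBlock_iff_of_le h1.le).mp (hd i hi')
    have h2 : d⁻¹ (lo i) < m := by rw [Fin.lt_def]; omega
    have h3 : m < d⁻¹ (hi i) := by rw [Fin.lt_def]; omega
    have h4 := hΛ.lt h2 ((sameBlock_iff_of_le h2.le).mpr fun k hk1 hk2 => hsb k hk1 (by omega))
    have h5 := hΛ.lt h3 ((sameBlock_iff_of_le h3.le).mpr fun k hk1 hk2 => hsb k (by omega) hk2)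
    have e1 : ∀ x, d (d⁻¹ x) = x := fun x => by simp
    rw [inv_inv, e1] at h4 h5
    have h6 : (i : ℕ) < d m := h4
    have h7 : (d m : ℕ) < i + 1 := h5
    omega
  have hlt : ∀ i : Fin (n - 1), (i : ℕ) ∈ J → ((d⁻¹ (lo i) : Fin n) : ℕ) + 1 < n :=
    fun i hi' => by rw [← key i hi']; exact (d⁻¹ (hi i)).2
  refine ⟨⟨fun i hi' => ?_, ?_⟩, ?_, ?_⟩
  · have := hlt i hi'
    exact ⟨⟨(d⁻¹ (lo i) : Fin n), by omega⟩, ⟨i, hi', rfl⟩, rfl, Fin.ext (key i hi')⟩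
  · rintro j ⟨i, hi', hij⟩
    refine ⟨i, hi', Fin.ext hij, Fin.ext ?_⟩
    rw [key i hi', hij, hi_val]
  · rintro j ⟨i, hi', rfl⟩
    have h1 := (not_desc_iff _ _).mp (hJ i hi')
    refine (sameBlock_iff_of_le h1.le).mp (hd i hi') _ le_rfl ?_
    rw [key i hi']
    omega
  · rintro j ⟨i, hi', rfl⟩
    exact hlt i hi'

/-- An element of full support of the parabolic subgroup of `J` is conjugated by `d` into that of
`Λ` only if the whole parabolic subgroup is. -/
theorem sameBlock_of_conj_mem {J Λ : Set ℕ} {d w : Equiv.Perm (Fin n)} (hJ : LeftMin J d)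
    (hw : w ∈ parab n J) (hs : ∀ i ∈ J, ¬ Stab i w) (hc : d⁻¹ * w * d ∈ parab n Λ)
    (i : Fin (n - 1)) (hi' : (i : ℕ) ∈ J) : SameBlock Λ (d⁻¹ (lo i)) (d⁻¹ (hi i)) := by
  have h1 := (not_desc_iff _ _).mp (hJ i hi')
  rw [sameBlock_iff_of_le h1.le]
  intro m hm1 hm2
  by_contra hm
  -- `w` preserves the set of those `x` with `d⁻¹ x ≤ m`
  have hP : ∀ x : Fin n, ((d⁻¹ x : Fin n) : ℕ) ≤ m ↔ ((d⁻¹ (w x) : Fin n) : ℕ) ≤ m := fun x => by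
    have := hc (d⁻¹ x) m hm
    simpa using this
  have hB : ∀ x : Fin n, SameBlock J x (lo i) →
      ((x : ℕ) ≤ i ↔ ((d⁻¹ x : Fin n) : ℕ) ≤ m) := by
    intro x hx
    constructor
    · intro hle
      rcases lt_or_eq_of_le (show x ≤ lo i from hle) with h2 | h2
      · have : ((d⁻¹ x : Fin n) : ℕ) < d⁻¹ (lo i) := hJ.lt h2 hx
        omega
      · rw [h2]; exact hm1
    · intro hle
      by_contra hgt
      have h3 : hi i ≤ x := by rw [Fin.le_def, hi_val]; omega
      rcases lt_or_eq_of_le h3 with h2 | h2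
      · have : ((d⁻¹ (hi i) : Fin n) : ℕ) < d⁻¹ x :=
          hJ.lt h2 ((hx.trans (sameBlock_lo_hi.mpr hi')).symm)
        omega
      · rw [← h2] at hle; omega
  refine hs i hi' fun x => ?_
  by_cases hx : SameBlock J x (lo i)
  · rw [hB x hx, hB (w x) ((hw x).symm.trans hx), hP x]
  · constructor
    · intro hle
      by_contra hgt
      refine hx ((sameBlock_iff_of_le (show x ≤ lo i from hle)).mpr fun k hk1 hk2 => ?_)
      have h2 : x ≤ w x := by rw [Fin.le_def]; omega
      rw [lo_val] at hk2
      exact (sameBlock_iff_of_le h2).mp (hw x) k hk1 (by omega)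
    · intro hle
      by_contra hgt
      have h2 : w x ≤ x := by rw [Fin.le_def]; omega
      refine hx ((hw x).trans
        ((sameBlock_iff_of_le (show w x ≤ lo i from hle)).mpr fun k hk1 hk2 => ?_))
      rw [lo_val] at hk2
      exact (sameBlock_iff_of_le h2).mp (hw x).symm k hk1 (by omega)

theorem projSet_conj_etaSet {J Λ : Set ℕ} {d : Equiv.Perm (Fin n)} (hJn : ∀ i ∈ J, i + 1 < n)
    (hJ : LeftMin J d) (hΛ : LeftMin Λ d⁻¹)
    (hd : ∀ i : Fin (n - 1), (i : ℕ) ∈ J → SameBlock Λ (d⁻¹ (lo i)) (d⁻¹ (hi i))) :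
    projSet n Λ (T d⁻¹ * etaSet n J * T d) = etaSet n (conjSet d J) := by
  classical
  obtain ⟨hiso, hsub, hn⟩ := blockIso_conjSet hJ hΛ hd
  refine (isUnit_T d).mul_left_cancel ?_
  have h1 := hiso.etaSet_mul hJn hn
  rw [inv_inv] at h1
  rw [← h1]
  -- both sides are linear in `etaSet n J`, which lies in the subalgebra of `J`
  have h2 : ∀ a ∈ supported (parab n J : Set (Equiv.Perm (Fin n))),
      T d * projSet n Λ (T d⁻¹ * a * T d) = a * T d := by
    intro a ha
    refine eq_of_supported (f := LinearMap.mul (Polynomial ℤ) (Hecke n) (T d) ∘ₗ projSet n Λ ∘ₗ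
        (LinearMap.mul (Polynomial ℤ) (Hecke n)).flip (T d) ∘ₗ
        LinearMap.mul (Polynomial ℤ) (Hecke n) (T d⁻¹))
      (g := (LinearMap.mul (Polynomial ℤ) (Hecke n)).flip (T d)) (fun w hw => ?_) ha
    change T d * projSet n Λ (T d⁻¹ * T w * T d) = T w * T d
    have h4 := hiso.conj_mem w hw
    rw [inv_inv] at h4
    have h5 := hiso.T_mul_T_inv hw
    rw [inv_inv] at h5
    rw [projSet_conj_T hJ hΛ hw, if_pos (parab_mono hsub h4), h5]
  exact h2 _ (supported_mono (fun w hw => hw.1) (etaSet_mem_supported hJn))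

theorem projSet_conj_etaSet_eq_zero {J Λ : Set ℕ} {d : Equiv.Perm (Fin n)}
    (hJn : ∀ i ∈ J, i + 1 < n) (hJ : LeftMin J d) (hΛ : LeftMin Λ d⁻¹)
    (hd : ¬ ∀ i : Fin (n - 1), (i : ℕ) ∈ J → SameBlock Λ (d⁻¹ (lo i)) (d⁻¹ (hi i))) :
    projSet n Λ (T d⁻¹ * etaSet n J * T d) = 0 := by
  refine eq_of_supported (f := projSet n Λ ∘ₗ
        (LinearMap.mul (Polynomial ℤ) (Hecke n)).flip (T d) ∘ₗ
        LinearMap.mul (Polynomial ℤ) (Hecke n) (T d⁻¹))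
      (g := 0) (fun w hw => ?_) (etaSet_mem_supported hJn)
  change projSet n Λ (T d⁻¹ * T w * T d) = 0
  rw [projSet_conj_T hJ hΛ hw.1, if_neg]
  exact fun hc => hd fun i hi' => sameBlock_of_conj_mem hJ hw.1 hw.2 hc i hi'

/-- `d` is a distinguished double coset representative with `d⁻¹ W_J d ⊆ W_Λ`, where `W_J` and `W_Λ`
are the parabolic subgroups of `J` and `Λ`. -/
def GoodRep (J Λ : Set ℕ) (d : Equiv.Perm (Fin n)) : Prop :=
  LeftMin J d ∧ LeftMin Λ d⁻¹ ∧
    ∀ i : Fin (n - 1), (i : ℕ) ∈ J → SameBlock Λ (d⁻¹ (lo i)) (d⁻¹ (hi i))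

open Classical in
/-- The Mackey formula for the projection of a normed Coxeter class element. The double coset
representatives outside of `GoodRep` do not contribute. -/
theorem projSet_normSet {J Λ : Set ℕ} (hJn : ∀ i ∈ J, i + 1 < n) :
    projSet n Λ (normSet Set.univ J (etaSet n J)) =
      ∑ d ∈ Finset.univ.filter (fun d : Equiv.Perm (Fin n) => GoodRep J Λ d),
        normSet Λ (conjSet d J) (etaSet n (conjSet d J)) := by
  have h1 : ∀ x : Equiv.Perm (Fin n), x ∈ parab n Set.univ := fun x => by
    rw [parab_univ]; trivial
  simp only [normSet, h1, true_and]
  rw [sum_leftMin_eq J Λ, map_sum]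
  have h2 : (Finset.univ.filter fun d : Equiv.Perm (Fin n) => GoodRep J Λ d) =
      (Finset.univ.filter fun d : Equiv.Perm (Fin n) => LeftMin J d ∧ LeftMin Λ d⁻¹).filter
        fun d => ∀ i : Fin (n - 1), (i : ℕ) ∈ J → SameBlock Λ (d⁻¹ (lo i)) (d⁻¹ (hi i)) := by
    ext d
    simp only [Finset.mem_filter, Finset.mem_univ, true_and]
    rw [GoodRep, and_assoc]
  conv_rhs => rw [h2, Finset.sum_filter]
  refine Finset.sum_congr rfl fun d hd => ?_
  simp only [Finset.mem_filter, Finset.mem_univ, true_and] at hd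
  have h3 : ∀ y ∈ Finset.univ.filter (fun y => y ∈ parab n Λ ∧ LeftMin J (d * y)),
      projSet n Λ (T (d * y)⁻¹ * etaSet n J * T (d * y)) =
        T y⁻¹ * projSet n Λ (T d⁻¹ * etaSet n J * T d) * T y := by
    intro y hy
    simp only [Finset.mem_filter, Finset.mem_univ, true_and] at hy
    have hy' := (parab n Λ).inv_mem hy.1
    have e1 := hd.2.T_inv_mul hy.1
    have e2 := hd.2.T_mul hy'
    rw [inv_inv] at e1
    rw [mul_inv_rev, ← e1, ← e2, ← projSet_T_mul _ _ hy', ← projSet_mul_T _ hy.1]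
    simp only [mul_assoc]
  rw [map_sum, Finset.sum_congr rfl h3]
  split_ifs with hgood
  · rw [projSet_conj_etaSet hJn hd.1 hd.2 hgood]
    refine Finset.sum_congr ?_ fun _ _ => rfl
    ext y
    simp only [Finset.mem_filter, Finset.mem_univ, true_and]
    refine and_congr_right fun _ => ?_
    obtain ⟨hiso, -, -⟩ := blockIso_conjSet hd.1 hd.2 hgood
    constructor
    · intro h j hj
      obtain ⟨i, hi', h4, h5⟩ := hiso.2 j hj
      have := h i hi'
      rwa [not_desc_iff, mul_inv_rev, Equiv.Perm.mul_apply, Equiv.Perm.mul_apply, h4, h5,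
        ← not_desc_iff] at this
    · intro h i hi'
      obtain ⟨j, hj, h4, h5⟩ := hiso.1 i hi'
      rw [not_desc_iff, mul_inv_rev, Equiv.Perm.mul_apply, Equiv.Perm.mul_apply, h4, h5,
        ← not_desc_iff]
      exact h j hj
  · rw [projSet_conj_etaSet_eq_zero hJn hd.1 hd.2 hgood]
    simp

/-! ### Blocks of compositions -/

theorem index_monotone (c : Composition n) {x y : Fin n} (h : x ≤ y) : c.index x ≤ c.index y := by
  by_contra hlt
  rw [not_le] at hlt
  have h1 := c.lt_sizeUpTo_index_succ y
  have h2 := c.sizeUpTo_index_le x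
  have h3 : c.sizeUpTo (c.index y).succ ≤ c.sizeUpTo (c.index x) := by
    refine c.monotone_sizeUpTo ?_
    rw [Fin.val_succ]
    exact hlt
  have h4 : (x : ℕ) ≤ y := h
  omega

theorem sameBlock_interior_iff (c : Composition n) (x y : Fin n) :
    SameBlock (interior c) x y ↔ c.index x = c.index y := by
  wlog hxy : x ≤ y generalizing x y
  · rw [eq_comm, ← this y x (le_of_not_ge hxy)]
    exact ⟨SameBlock.symm, SameBlock.symm⟩
  rw [sameBlock_iff_of_le hxy]
  have hx := c.sizeUpTo_index_le x
  have hx' := c.lt_sizeUpTo_index_succ x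
  have hy := c.sizeUpTo_index_le y
  have hy' := c.lt_sizeUpTo_index_succ y
  rw [Fin.val_succ] at hx' hy'
  constructor
  · intro h
    refine le_antisymm (index_monotone c hxy) ?_
    by_contra hlt
    rw [not_le] at hlt
    have h3 : c.sizeUpTo ((c.index x : ℕ) + 1) ≤ c.sizeUpTo (c.index y) :=
      c.monotone_sizeUpTo hlt
    refine (h (c.sizeUpTo ((c.index x : ℕ) + 1) - 1) (by omega) (by omega)).2
      ((c.index x : ℕ) + 1) ?_
    omega
  · intro h i h1 h2
    rw [← h] at hy hy'
    have := y.2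
    refine ⟨by omega, fun j hj => ?_⟩
    rcases Nat.lt_or_ge (c.index x) j with h3 | h3
    · have : c.sizeUpTo ((c.index x : ℕ) + 1) ≤ c.sizeUpTo j := c.monotone_sizeUpTo h3
      omega
    · have : c.sizeUpTo j ≤ c.sizeUpTo (c.index x) := c.monotone_sizeUpTo h3
      omega

/-- A size-preserving bijection between the blocks of two compositions is induced by a block
isomorphism. -/
theorem exists_blockIso (c c' : Composition n) (σ : Fin c.length ≃ Fin c'.length)
    (hσ : ∀ i, c.blocksFun i = c'.blocksFun (σ i)) :
    ∃ p : Equiv.Perm (Fin n), BlockIso p (interior c) (interior c') ∧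
      ∀ x, c'.index (p x) = σ (c.index x) := by
  obtain ⟨p, hp⟩ : ∃ p : Equiv.Perm (Fin n), ∀ x,
      p x = c'.embedding (σ (c.index x)) (Fin.cast (hσ _) (c.invEmbedding x)) :=
    ⟨(c.blocksFinEquiv.symm.trans (Equiv.sigmaCongr σ fun i => finCongr (hσ i))).trans
      c'.blocksFinEquiv, fun x => rfl⟩
  have hidx : ∀ x, c'.index (p x) = σ (c.index x) := fun x => by
    rw [hp, Composition.index_embedding]
  have hval : ∀ x, ((p x : Fin n) : ℕ) + c.sizeUpTo (c.index x) =
      c'.sizeUpTo (σ (c.index x)) + x := fun x => by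
    have := c.sizeUpTo_index_le x
    rw [hp, Composition.coe_embedding, Fin.val_cast, Composition.coe_invEmbedding]
    omega
  have hadj : ∀ x y : Fin n, c.index x = c.index y → ((y : ℕ) = x + 1 ↔
      ((p y : Fin n) : ℕ) = (p x : Fin n) + 1) := fun x y h => by
    have h1 := hval x
    have h2 := hval y
    rw [← h] at h2
    omega
  have hmem : ∀ (c : Composition n) (i : Fin (n - 1)),
      (i : ℕ) ∈ interior c ↔ c.index (lo i) = c.index (hi i) := fun c i => by
    rw [← sameBlock_lo_hi, sameBlock_interior_iff]
  refine ⟨p, ⟨fun i hi' => ?_, fun j hj => ?_⟩, hidx⟩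
  · rw [hmem] at hi'
    have h1 := (hadj _ _ hi').mp rfl
    have hlt : ((p (lo i) : Fin n) : ℕ) < n - 1 := by have := (p (hi i)).2; omega
    have e1 : p (lo i) = lo ⟨_, hlt⟩ := rfl
    have e2 : p (hi i) = hi ⟨_, hlt⟩ := Fin.ext h1
    refine ⟨⟨_, hlt⟩, ?_, e1, e2⟩
    rw [hmem, ← e1, ← e2, hidx, hidx, hi']
  · rw [hmem] at hj
    obtain ⟨x, hx⟩ := p.surjective (lo j)
    obtain ⟨y, hy⟩ := p.surjective (hi j)
    rw [← hx, ← hy, hidx, hidx] at hj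
    have hxy := σ.injective hj
    have h1 : (y : ℕ) = x + 1 := (hadj _ _ hxy).mpr (by rw [hx, hy]; rfl)
    have hlt : (x : ℕ) < n - 1 := by have := y.2; omega
    have e1 : x = lo ⟨_, hlt⟩ := rfl
    have e2 : y = hi ⟨_, hlt⟩ := Fin.ext h1
    refine ⟨⟨_, hlt⟩, ?_, by rw [← e1, hx], by rw [← e2, hy]⟩
    rw [hmem, ← e1, ← e2, hxy]

theorem exists_equiv_of_map_eq {ι ι' γ : Type*} [Fintype ι] [Fintype ι'] [DecidableEq γ]
    (f : ι → γ) (f' : ι' → γ)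
    (h : (Finset.univ : Finset ι).val.map f = (Finset.univ : Finset ι').val.map f') :
    ∃ σ : ι ≃ ι', ∀ i, f i = f' (σ i) := by
  have hcard : ∀ c, Fintype.card {i // f i = c} = Fintype.card {i // f' i = c} := fun c => by
    have h1 := congrArg (Multiset.count c) h
    rw [Multiset.count_map, Multiset.count_map] at h1
    rw [Fintype.card_subtype, Fintype.card_subtype]
    simpa [Finset.card, Finset.filter_val, eq_comm] using h1
  refine ⟨Equiv.ofFiberEquiv fun c => Fintype.equivOfCardEq (hcard c), fun i => ?_⟩
  exact (Equiv.ofFiberEquiv_map (g := f') (fun c => Fintype.equivOfCardEq (hcard c)) i).symm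

theorem map_blocksFun (c : Composition n) :
    (Finset.univ : Finset (Fin c.length)).val.map c.blocksFun = (c.blocks : Multiset ℕ) := by
  rw [Fin.univ_val_map, Composition.ofFn_blocksFun]

theorem coe_blocks_ofPartition (p : n.Partition) :
    ((ofPartition p).blocks : Multiset ℕ) = p.parts :=
  Multiset.sort_eq _ _

section Append

variable {k l : ℕ}

theorem length_append (c : Composition k) (d : Composition l) :
    (append c d).length = c.length + d.length := by
  simp [append, Composition.length]

/-- The blocks of a juxtaposition of two compositions. -/
def appendEquiv (c : Composition k) (d : Composition l) :
    Fin c.length ⊕ Fin d.length ≃ Fin (append c d).length :=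
  finSumFinEquiv.trans (finCongr (length_append c d).symm)

theorem appendEquiv_inl_val (c : Composition k) (d : Composition l) (i : Fin c.length) :
    (appendEquiv c d (Sum.inl i) : ℕ) = i := by
  simp [appendEquiv]

theorem appendEquiv_inr_val (c : Composition k) (d : Composition l) (i : Fin d.length) :
    (appendEquiv c d (Sum.inr i) : ℕ) = c.length + i := by
  simp [appendEquiv]

theorem blocksFun_appendEquiv_inl (c : Composition k) (d : Composition l) (i : Fin c.length) :
    (append c d).blocksFun (appendEquiv c d (Sum.inl i)) = c.blocksFun i := by
  have h1 : (i : ℕ) < c.blocks.length := i.2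
  simp only [Composition.blocksFun, List.get_eq_getElem, appendEquiv_inl_val]
  simp [append, List.getElem_append_left h1]

theorem blocksFun_appendEquiv_inr (c : Composition k) (d : Composition l) (i : Fin d.length) :
    (append c d).blocksFun (appendEquiv c d (Sum.inr i)) = d.blocksFun i := by
  simp only [Composition.blocksFun, List.get_eq_getElem, appendEquiv_inr_val]
  simp only [append, Composition.length]
  rw [List.getElem_append_right (by omega)]
  simp

theorem sizeUpTo_append_length (c : Composition k) (d : Composition l) :
    (append c d).sizeUpTo c.length = k := by
  simp [Composition.sizeUpTo, append, Composition.length, c.blocks_sum]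

theorem lt_iff_index_append (c : Composition k) (d : Composition l) (x : Fin (k + l)) :
    (x : ℕ) < k ↔ ((append c d).index x : ℕ) < c.length := by
  have h1 := (append c d).lt_sizeUpTo_index_succ x
  have h2 := (append c d).sizeUpTo_index_le x
  rw [Fin.val_succ] at h1
  have h3 := sizeUpTo_append_length c d
  constructor
  · intro h
    by_contra hge
    have := (append c d).monotone_sizeUpTo (not_lt.mp hge)
    omega
  · intro h
    have : (append c d).sizeUpTo (((append c d).index x : ℕ) + 1) ≤
        (append c d).sizeUpTo c.length := (append c d).monotone_sizeUpTo h
    omega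

theorem mem_interior_twoBlocks (hk : 0 < k) (hl : 0 < l) (i : ℕ) :
    i ∈ interior (twoBlocks k l hk hl) ↔ i + 1 < k + l ∧ i + 1 ≠ k := by
  have hs : ∀ j, (twoBlocks k l hk hl).sizeUpTo j = if j = 0 then 0 else if j = 1 then k
      else k + l := by
    intro j
    rcases j with _ | _ | j
    · simp
    · simp [twoBlocks, append, Composition.sizeUpTo, Composition.single]
    · simp [twoBlocks, append, Composition.sizeUpTo, Composition.single]
  refine and_congr_right fun h => ⟨fun h' => ?_, fun h' j => ?_⟩
  · have := h' 1
    rw [hs] at this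
    simpa [eq_comm] using this
  · rw [hs]
    split_ifs <;> omega

theorem sameBlock_twoBlocks (hk : 0 < k) (hl : 0 < l) (x y : Fin (k + l)) :
    SameBlock (interior (twoBlocks k l hk hl)) x y ↔ ((x : ℕ) < k ↔ (y : ℕ) < k) := by
  constructor
  · intro h
    have := h (k - 1) (by rw [mem_interior_twoBlocks]; omega)
    omega
  · intro h i hi'
    rw [mem_interior_twoBlocks] at hi'
    have := x.2
    have := y.2
    by_cases h1 : i + 1 < k + l
    · have : i + 1 = k := by by_contra h2; exact hi' ⟨h1, h2⟩
      omega
    · omega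

theorem interior_append_subset (hk : 0 < k) (hl : 0 < l) (c : Composition k)
    (d : Composition l) : interior (append c d) ⊆ interior (twoBlocks k l hk hl) := by
  intro i hi'
  rw [mem_interior_twoBlocks]
  refine ⟨hi'.1, fun h => hi'.2 c.length ?_⟩
  rw [sizeUpTo_append_length, h]

theorem coe_blocks_derived (θ : k.Partition × l.Partition) :
    ((derived θ).blocks : Multiset ℕ) = θ.1.parts + θ.2.parts := by
  rw [← coe_blocks_ofPartition, ← coe_blocks_ofPartition, Multiset.coe_add]
  rfl

/-- A set of blocks of total size `k` gives rise to a multipartition: the sizes of these blocks are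
the parts of its first component, those of the other blocks the parts of the second one. -/
theorem exists_multipartition (c : Composition (k + l)) (P : Fin c.length → Prop)
    [DecidablePred P] (hP : ∑ i : {i // P i}, c.blocksFun i = k) :
    ∃ θ : k.Partition × l.Partition, θ.1.parts + θ.2.parts = (c.blocks : Multiset ℕ) ∧
      ∃ σ : Fin c.length ≃ Fin (append (ofPartition θ.1) (ofPartition θ.2)).length,
        (∀ i, c.blocksFun i = (append (ofPartition θ.1) (ofPartition θ.2)).blocksFun (σ i)) ∧
        ∀ i, (σ i : ℕ) < (ofPartition θ.1).length ↔ P i := by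
  have hsum : ∑ i : {i // P i}, c.blocksFun i + ∑ i : {i // ¬ P i}, c.blocksFun i = k + l := by
    rw [Fintype.sum_subtype_add_sum_subtype, c.sum_blocksFun]
  have hpos : ∀ {Q : Fin c.length → Prop} [DecidablePred Q] {i : ℕ},
      i ∈ (Finset.univ : Finset {i // Q i}).val.map (fun i : {i // Q i} => c.blocksFun i) →
        0 < i := by
    intro Q _ i hi'
    obtain ⟨j, -, rfl⟩ := Multiset.mem_map.mp hi'
    exact c.blocks_pos (c.blocksFun_mem_blocks _)
  obtain ⟨μ, hμ⟩ : ∃ μ : k.Partition,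
      μ.parts = (Finset.univ : Finset {i // P i}).val.map (fun i : {i // P i} => c.blocksFun i) :=
    ⟨⟨_, hpos, hP⟩, rfl⟩
  obtain ⟨ν, hν⟩ : ∃ ν : l.Partition,
      ν.parts = (Finset.univ : Finset {i // ¬ P i}).val.map
        (fun i : {i // ¬ P i} => c.blocksFun i) :=
    ⟨⟨_, hpos, by
      have : ∑ i : {i // ¬ P i}, c.blocksFun i = l := by omega
      exact this⟩, rfl⟩
  obtain ⟨σ₁, h₁⟩ := exists_equiv_of_map_eq (fun i : {i // P i} => c.blocksFun i)
    (ofPartition μ).blocksFun (by rw [map_blocksFun, coe_blocks_ofPartition, hμ])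
  obtain ⟨σ₂, h₂⟩ := exists_equiv_of_map_eq (fun i : {i // ¬ P i} => c.blocksFun i)
    (ofPartition ν).blocksFun (by rw [map_blocksFun, coe_blocks_ofPartition, hν])
  obtain ⟨σ, hσ⟩ : ∃ σ : Fin c.length ≃ Fin (append (ofPartition μ) (ofPartition ν)).length,
      ∀ s, σ (Equiv.sumCompl P s) = appendEquiv _ _ (Equiv.sumCongr σ₁ σ₂ s) :=
    ⟨((Equiv.sumCompl P).symm.trans (Equiv.sumCongr σ₁ σ₂)).trans (appendEquiv _ _),
      fun s => by rw [Equiv.trans_apply, Equiv.trans_apply, Equiv.symm_apply_apply]⟩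
  have hs1 : ∀ i : {i // P i}, σ i = appendEquiv _ _ (Sum.inl (σ₁ i)) := fun i => hσ (Sum.inl i)
  have hs2 : ∀ i : {i // ¬ P i}, σ i = appendEquiv _ _ (Sum.inr (σ₂ i)) := fun i =>
    hσ (Sum.inr i)
  have hsize : ∀ i, c.blocksFun i = (append (ofPartition μ) (ofPartition ν)).blocksFun (σ i) :=
      fun i => by
    by_cases hi' : P i
    · rw [hs1 ⟨i, hi'⟩]
      exact (h₁ ⟨i, hi'⟩).trans (blocksFun_appendEquiv_inl _ _ _).symm
    · rw [hs2 ⟨i, hi'⟩]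
      exact (h₂ ⟨i, hi'⟩).trans (blocksFun_appendEquiv_inr _ _ _).symm
  refine ⟨(μ, ν), ?_, σ, hsize, fun i => ?_⟩
  · have h3 : c.blocksFun = (append (ofPartition μ) (ofPartition ν)).blocksFun ∘ σ := funext hsize
    rw [← coe_blocks_derived, derived, ← map_blocksFun, ← map_blocksFun, h3, ← Multiset.map_map]
    congr 1
    exact (congrArg Finset.val (Finset.map_univ_equiv σ)).symm
  · by_cases hi' : P i
    · rw [hs1 ⟨i, hi'⟩, appendEquiv_inl_val]
      simp [hi']
    · rw [hs2 ⟨i, hi'⟩, appendEquiv_inr_val]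
      simp [hi']

/-- The number of points in blocks of size `r` of the first of two juxtaposed compositions. -/
theorem card_left_append (c : Composition k) (d : Composition l) (r : ℕ) :
    (Finset.univ.filter fun x : Fin (k + l) =>
      (x : ℕ) < k ∧ (append c d).blocksFun ((append c d).index x) = r).card =
      r * c.blocks.count r := by
  rw [Finset.card_filter, ← Equiv.sum_comp (append c d).blocksFinEquiv, Fintype.sum_sigma]
  have h1 : ∀ (i : Fin (append c d).length) (t : Fin ((append c d).blocksFun i)),
      (if ((((append c d).blocksFinEquiv ⟨i, t⟩ : Fin (k + l)) : ℕ) < k ∧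
        (append c d).blocksFun ((append c d).index ((append c d).blocksFinEquiv ⟨i, t⟩)) = r)
        then 1 else 0) =
      if ((i : ℕ) < c.length ∧ (append c d).blocksFun i = r) then 1 else 0 := by
    intro i t
    have h2 : (append c d).index ((append c d).blocksFinEquiv ⟨i, t⟩) = i :=
      (append c d).index_embedding i t
    refine if_congr ?_ rfl rfl
    rw [lt_iff_index_append c d, h2]
  simp only [h1]
  rw [← Equiv.sum_comp (appendEquiv c d), Fintype.sum_sum_type]
  simp only [appendEquiv_inl_val, appendEquiv_inr_val, Fin.is_lt, true_and,
    Finset.sum_const, Finset.card_univ, Fintype.card_fin, smul_eq_mul,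
    blocksFun_appendEquiv_inl, not_lt_of_ge (Nat.le_add_right _ _), false_and, if_false, mul_zero,
    add_zero]
  have h3 : c.blocks.count r =
      (Finset.univ.filter fun i : Fin c.length => c.blocksFun i = r).card := by
    rw [← Multiset.coe_count, ← map_blocksFun, Multiset.count_map]
    simp [Finset.card, Finset.filter_val, eq_comm]
  rw [h3, Finset.card_filter, Finset.mul_sum]
  refine Finset.sum_congr rfl fun i _ => ?_
  split_ifs with h
  · rw [h]
  · simp

end Append

/-! ### Conjugacy of parabolic subgroups -/

/-- The permutation `g` carries the blocks of `K` to the blocks of `J`, equivalently it conjugates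
the parabolic subgroup of `K` to that of `J`. -/
def CarriesBlocks (g : Equiv.Perm (Fin n)) (K J : Set ℕ) : Prop :=
  ∀ x y, SameBlock K x y ↔ SameBlock J (g x) (g y)

namespace CarriesBlocks

variable {g h : Equiv.Perm (Fin n)} {J K M : Set ℕ}

theorem mul (hg : CarriesBlocks g K J) (hh : CarriesBlocks h M K) : CarriesBlocks (g * h) M J :=
  fun x y => (hh x y).trans (hg (h x) (h y))

theorem inv (hg : CarriesBlocks g K J) : CarriesBlocks g⁻¹ J K := fun x y => by
  rw [hg (g⁻¹ x) (g⁻¹ y)]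
  simp

end CarriesBlocks

theorem sameBlock_iff_swap_mem {J : Set ℕ} {x y : Fin n} :
    SameBlock J x y ↔ Equiv.swap x y ∈ parab n J := by
  refine ⟨swap_mem_parab, fun h => ?_⟩
  simpa using h x

theorem BlockIso.carriesBlocks {e : Equiv.Perm (Fin n)} {J K : Set ℕ} (h : BlockIso e J K) :
    CarriesBlocks e J K := fun x y => by
  rw [sameBlock_iff_swap_mem, sameBlock_iff_swap_mem, Equiv.swap_apply_apply, h.conj_mem_iff]

theorem carriesBlocks_of_mem {J : Set ℕ} {u : Equiv.Perm (Fin n)} (hu : u ∈ parab n J) :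
    CarriesBlocks u J J := fun x y =>
  ⟨fun h => ((hu x).symm.trans h).trans (hu y), fun h => ((hu x).trans h).trans (hu y).symm⟩

theorem mem_normalizer_parab {J : Set ℕ} {g : Equiv.Perm (Fin n)} :
    g ∈ Subgroup.normalizer (parab n J : Set (Equiv.Perm (Fin n))) ↔ CarriesBlocks g J J := by
  rw [Subgroup.mem_normalizer_iff]
  constructor
  · intro h x y
    rw [sameBlock_iff_swap_mem, sameBlock_iff_swap_mem, Equiv.swap_apply_apply]
    exact h _
  · intro h w
    rw [mem_parab, mem_parab]
    constructor
    · intro hw x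
      have := (h _ _).mp (hw (g⁻¹ x))
      simpa using this
    · intro hw x
      have := hw (g x)
      rw [h]
      simpa using this

theorem IsCox.sameCycle_iff {J : Set ℕ} {w : Equiv.Perm (Fin n)} (hw : IsCox J w)
    (x y : Fin n) : w.SameCycle x y ↔ SameBlock J x y := by
  constructor
  · rintro ⟨i, rfl⟩
    exact (parab n J).zpow_mem hw.1 i x
  · intro h
    wlog hxy : x ≤ y generalizing x y
    · exact (this y x h.symm (le_of_not_ge hxy)).symm
    obtain ⟨x, hx⟩ := x
    obtain ⟨y, hy⟩ := y
    rw [sameBlock_iff_of_le hxy] at h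
    simp only [Fin.mk_le_mk] at hxy h
    induction y with
    | zero =>
      have : x = 0 := by omega
      subst this
      exact Equiv.Perm.SameCycle.refl _ _
    | succ y ih =>
      rcases Nat.lt_or_ge y x with h2 | h2
      · have : x = y + 1 := by omega
        subst this
        exact Equiv.Perm.SameCycle.refl _ _
      · have h3 := ih (by omega) (fun i h3 h4 => h i h3 (by omega)) h2
        have h4 := hw.2 ⟨y, by omega⟩ (h y h2 (by omega))
        have h5 : (⟨y + 1, hy⟩ : Fin n) = w ⟨y, by omega⟩ := h4.symm
        rw [h5]
        exact h3.trans (Equiv.Perm.sameCycle_apply_right.mpr (Equiv.Perm.SameCycle.refl _ _))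

open Classical in
/-- The number of points in the block of a point. -/
noncomputable def blockSize (J : Set ℕ) (x : Fin n) : ℕ :=
  (Finset.univ.filter fun y => SameBlock J x y).card

theorem blockSize_interior (c : Composition n) (x : Fin n) :
    blockSize (interior c) x = c.blocksFun (c.index x) := by
  classical
  have h1 : ∀ (i : Fin c.length) (t : Fin (c.blocksFun i)),
      (if c.index x = c.index (c.blocksFinEquiv ⟨i, t⟩) then 1 else 0) =
        if c.index x = i then 1 else 0 := by
    intro i t
    have h2 : c.index (c.blocksFinEquiv ⟨i, t⟩) = i := c.index_embedding i t
    rw [h2]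
  simp only [blockSize, sameBlock_interior_iff]
  rw [Finset.card_filter, ← Equiv.sum_comp c.blocksFinEquiv, Fintype.sum_sigma]
  simp only [h1]
  simp

theorem CarriesBlocks.blockSize_eq {g : Equiv.Perm (Fin n)} {K J : Set ℕ}
    (h : CarriesBlocks g K J) (x : Fin n) : blockSize J (g x) = blockSize K x := by
  classical
  rw [blockSize, blockSize]
  refine (Finset.card_bij (fun y _ => g y) ?_ (fun _ _ _ _ e => g.injective e) ?_).symm
  · intro y hy
    simpa [← h x y] using hy
  · intro y hy
    refine ⟨g⁻¹ y, ?_, by simp⟩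
    simp only [Finset.mem_filter, Finset.mem_univ, true_and] at hy ⊢
    rw [h]
    simpa using hy

section Multipartitions

variable {k l : ℕ}

/-- Parabolic subgroups attached to different multipartitions of `α` are not conjugate in the
parabolic subgroup of `(k, l)`: the number of points of `{x | x < k}` in blocks of a given size is
an invariant. -/
theorem eq_of_carriesBlocks (hk : 0 < k) (hl : 0 < l) {α : (k + l).Partition}
    {θ θ' : k.Partition × l.Partition} (hθ : θ ∈ multipartitions k l α)
    (hθ' : θ' ∈ multipartitions k l α) {g : Equiv.Perm (Fin (k + l))}
    (hg : g ∈ parab (k + l) (interior (twoBlocks k l hk hl)))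
    (h : CarriesBlocks g (interior (derived θ)) (interior (derived θ'))) : θ = θ' := by
  classical
  simp only [multipartitions, Finset.mem_filter, Finset.mem_univ, true_and] at hθ hθ'
  have hleft : ∀ x : Fin (k + l), (x : ℕ) < k ↔ ((g x : Fin (k + l)) : ℕ) < k := fun x =>
    (sameBlock_twoBlocks hk hl _ _).mp (hg x)
  have hcount : ∀ θ : k.Partition × l.Partition, ∀ r : ℕ,
      (Finset.univ.filter fun x : Fin (k + l) =>
        (x : ℕ) < k ∧ blockSize (interior (derived θ)) x = r).card = r * θ.1.parts.count r := by
    intro θ r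
    rw [← coe_blocks_ofPartition θ.1, Multiset.coe_count,
      ← card_left_append _ (ofPartition θ.2)]
    simp only [blockSize_interior]
    rfl
  have h1 : θ.1.parts = θ'.1.parts := by
    ext r
    rcases Nat.eq_zero_or_pos r with rfl | hr
    · rw [Multiset.count_eq_zero_of_notMem fun h0 => lt_irrefl 0 (θ.1.parts_pos h0),
        Multiset.count_eq_zero_of_notMem fun h0 => lt_irrefl 0 (θ'.1.parts_pos h0)]
    · refine Nat.eq_of_mul_eq_mul_left hr ?_
      rw [← hcount, ← hcount]
      refine Finset.card_bij (fun x _ => g x) ?_ (fun _ _ _ _ e => g.injective e) ?_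
      · intro x hx
        simpa [← hleft, h.blockSize_eq] using hx
      · intro y hy
        refine ⟨g⁻¹ y, ?_, by simp⟩
        simp only [Finset.mem_filter, Finset.mem_univ, true_and] at hy ⊢
        rw [hleft, ← h.blockSize_eq]
        simpa using hy
  have h2 : θ.2.parts = θ'.2.parts := by
    rw [← hθ', h1] at hθ
    exact add_left_cancel hθ
  exact Prod.ext (Nat.Partition.ext h1) (Nat.Partition.ext h2)

/-! ### The specialization at `ξ = 0` -/

/-- The coefficient of `T_v` specialized at `ξ = 0`. -/
noncomputable def evalCoord (v : Equiv.Perm (Fin n)) : Hecke n →+ ℤ :=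
  (Polynomial.evalRingHom (0 : ℤ)).toAddMonoidHom.comp ((basisT n).coord v).toAddMonoidHom

theorem evalCoord_apply (v : Equiv.Perm (Fin n)) (a : Hecke n) :
    evalCoord v a = ((basisT n).coord v a).eval 0 := rfl

theorem evalCoord_T (v w : Equiv.Perm (Fin n)) :
    evalCoord v (T w) = if w = v then 1 else 0 := by
  rw [evalCoord_apply, coord_T]
  split_ifs <;> simp

theorem coord_gen_mul (i : Fin (n - 1)) (v : Equiv.Perm (Fin n)) (a : Hecke n) :
    (basisT n).coord v (gen i * a) = (basisT n).coord (simpleRefl i * v) a +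
      (if Desc i v then Polynomial.X else 0) * (basisT n).coord v a := by
  have : (basisT n).coord v ∘ₗ LinearMap.mul (Polynomial ℤ) (Hecke n) (gen i) =
      (basisT n).coord (simpleRefl i * v) +
        (if Desc i v then Polynomial.X else 0 : Polynomial ℤ) • (basisT n).coord v := by
    refine linearMap_ext_T (M := Polynomial ℤ) fun w => ?_
    have e : simpleRefl i * w = v ↔ w = simpleRefl i * v := by
      constructor
      · rintro rfl; rw [simpleRefl_mul_cancel]
      · rintro rfl; rw [simpleRefl_mul_cancel]
    rw [LinearMap.comp_apply, LinearMap.mul_apply', LinearMap.add_apply, LinearMap.smul_apply,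
      coord_T, coord_T]
    by_cases hd : Desc i w
    · rw [gen_mul_T_of_desc hd, map_add, map_smul, coord_T, coord_T]
      by_cases hw : w = v
      · subst hw; simp [hd, e]
      · simp [hw, e]
    · rw [gen_mul_T_of_not_desc hd, coord_T]
      by_cases hw : w = v
      · subst hw; simp [hd, e]
      · simp [hw, e]
  exact congrArg (fun f => f a) this

/-- At `ξ = 0` the elements `T_y` multiply as the group elements `y`. -/
theorem evalCoord_T_mul (y v : Equiv.Perm (Fin n)) (a : Hecke n) :
    evalCoord v (T y * a) = evalCoord (y⁻¹ * v) a := by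
  have key : ∀ y ∈ parab n Set.univ, ∀ v, evalCoord v (T y * a) = evalCoord (y⁻¹ * v) a := by
    refine parab_induction (fun v => by rw [T_one, one_mul, inv_one, one_mul]) ?_
    intro i w _ _ hd ih v
    have h : evalCoord v (gen i * (T w * a)) = evalCoord (simpleRefl i * v) (T w * a) := by
      rw [evalCoord_apply, coord_gen_mul, evalCoord_apply]
      split_ifs <;> simp
    rw [← gen_mul_T_of_not_desc hd, mul_assoc, h, ih, mul_inv_rev, simpleRefl_inv, mul_assoc]
  exact key y (by rw [parab_univ]; trivial) v

theorem evalCoord_mul_T (y v : Equiv.Perm (Fin n)) (a : Hecke n) :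
    evalCoord v (a * T y) = evalCoord (v * y⁻¹) a := by
  have h : ∀ b : Hecke n, evalCoord v b = evalCoord 1 (T v⁻¹ * b) := fun b => by
    rw [evalCoord_T_mul, inv_inv, mul_one]
  have h2 : ∀ a b : Hecke n, evalCoord 1 (a * b) = evalCoord 1 (b * a) := fun a b =>
    congrArg (Polynomial.eval 0) (tau_mul_comm a b)
  rw [h, ← mul_assoc, h2, evalCoord_T_mul, evalCoord_T_mul]
  simp

theorem evalCoord_conj (x v : Equiv.Perm (Fin n)) (a : Hecke n) :
    evalCoord v (T x⁻¹ * a * T x) = evalCoord (x * v * x⁻¹) a := by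
  rw [evalCoord_mul_T, evalCoord_T_mul, inv_inv, mul_assoc]

open Classical in
theorem evalCoord_normSet (Λ J : Set ℕ) (v : Equiv.Perm (Fin n)) :
    evalCoord v (normSet Λ J (etaSet n J)) =
      ∑ d ∈ Finset.univ.filter (fun d => d ∈ parab n Λ ∧ LeftMin J d),
        ∑ u ∈ Finset.univ.filter (fun u => u ∈ parab n (shrink J)),
          if coxOf n J = (u * d) * v * (u * d)⁻¹ then (1 : ℤ) else 0 := by
  rw [normSet, map_sum]
  refine Finset.sum_congr rfl fun d _ => ?_
  rw [evalCoord_conj, etaSet, normOne, map_sum]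
  refine Finset.sum_congr rfl fun u _ => ?_
  rw [evalCoord_conj, evalCoord_T]
  refine if_congr ?_ rfl rfl
  rw [mul_inv_rev]
  simp only [mul_assoc]

theorem evalCoord_normSet_pos (Λ J : Set ℕ) :
    0 < evalCoord (coxOf n J) (normSet Λ J (etaSet n J)) := by
  classical
  rw [evalCoord_normSet]
  have hnn : ∀ d u : Equiv.Perm (Fin n),
      (0 : ℤ) ≤ if coxOf n J = (u * d) * coxOf n J * (u * d)⁻¹ then (1 : ℤ) else 0 := fun d u => by
    split_ifs <;> simp
  -- the term with `d = 1` and `u = 1` equals one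
  refine lt_of_lt_of_le zero_lt_one (le_trans ?_ (Finset.single_le_sum
    (fun d _ => Finset.sum_nonneg fun u _ => hnn d u) (a := 1) ?_))
  · refine le_trans ?_ (Finset.single_le_sum (fun u _ => hnn 1 u) (a := 1) ?_)
    · simp
    · simp
  · simp only [Finset.mem_filter, Finset.mem_univ, true_and]
    refine ⟨one_mem _, fun i _ => ?_⟩
    rw [not_desc_iff]
    exact lo_lt_hi i

/-- A conjugate of the Coxeter element of `J` is the Coxeter element of `K` only if the conjugation
carries the orbits of the latter, which are the blocks of `K`, to the blocks of `J`. -/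
theorem evalCoord_normSet_eq_zero {Λ J K : Set ℕ} (hJ : J ⊆ Λ)
    (h : ∀ g ∈ parab n Λ, ¬ CarriesBlocks g K J) :
    evalCoord (coxOf n K) (normSet Λ J (etaSet n J)) = 0 := by
  classical
  rw [evalCoord_normSet]
  refine Finset.sum_eq_zero fun d hd => Finset.sum_eq_zero fun u hu => ?_
  simp only [Finset.mem_filter, Finset.mem_univ, true_and] at hd hu
  rw [if_neg]
  intro he
  have hu' : u ∈ parab n Λ := parab_mono (fun i hi' => hJ hi'.1) hu
  refine h (u * d) (Subgroup.mul_mem _ hu' hd.1) fun x y => ?_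
  rw [← (isCox_coxOf K).sameCycle_iff, ← (isCox_coxOf J).sameCycle_iff, he,
    Equiv.Perm.sameCycle_conj]
  simp

/-! ### Double coset representatives and normalizers -/

/-- `d⁻¹ W_J d` is conjugate to `W_K` under `W_Λ`, where `W_J`, `W_K` and `W_Λ` are the parabolic
subgroups of `J`, `K` and `Λ`. -/
def HasType (J Λ K : Set ℕ) (d : Equiv.Perm (Fin n)) : Prop :=
  ∃ g ∈ parab n Λ, CarriesBlocks (d * g) K J

/-- The representatives `d` of a given type correspond to the cosets of the normalizer in the
parabolic subgroup of `Λ` in the full normalizer: with `g₀` carrying `K` to `J`, they are the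
shortest elements of the cosets `g₀ m W_Λ`, where `m` normalizes the parabolic subgroup of `K`. -/
theorem card_hasType {J Λ K : Set ℕ} (hK : K ⊆ Λ) {g₀ : Equiv.Perm (Fin n)}
    (hg₀ : CarriesBlocks g₀ K J) :
    Nat.card {d : Equiv.Perm (Fin n) // GoodRep J Λ d ∧ HasType J Λ K d} =
      (normalizerIn (parab n Λ) (parab n K)).relIndex (normalizerIn ⊤ (parab n K)) := by
  have hN : ∀ m : Equiv.Perm (Fin n), m ∈ normalizerIn ⊤ (parab n K) ↔ CarriesBlocks m K K :=
    fun m => by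
      rw [normalizerIn, inf_top_eq, mem_normalizer_parab]
  have hN' : ∀ m : Equiv.Perm (Fin n), m ∈ normalizerIn (parab n Λ) (parab n K) ↔
      CarriesBlocks m K K ∧ m ∈ parab n Λ := fun m => by
    rw [normalizerIn, Subgroup.mem_inf, mem_normalizer_parab]
  rw [Subgroup.relIndex, Subgroup.index]
  have hrep : ∀ d : {d : Equiv.Perm (Fin n) // GoodRep J Λ d ∧ HasType J Λ K d},
      ∃ m : normalizerIn ⊤ (parab n K), ∃ g ∈ parab n Λ,
        (m : Equiv.Perm (Fin n)) = g₀⁻¹ * (d * g) := by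
    rintro ⟨d, -, g, hg, hd⟩
    exact ⟨⟨_, (hN _).mpr (hg₀.inv.mul hd)⟩, g, hg, rfl⟩
  choose m g hg hm using hrep
  refine Nat.card_eq_of_bijective
    (fun d => (QuotientGroup.mk (m d) : _ ⧸ (normalizerIn (parab n Λ) (parab n K)).subgroupOf
      (normalizerIn ⊤ (parab n K)))) ⟨?_, ?_⟩
  · intro d d' h
    have h1 := QuotientGroup.eq.mp h
    rw [Subgroup.mem_subgroupOf, hN'] at h1
    have h2 := h1.2
    rw [Subgroup.coe_mul, Subgroup.coe_inv, hm, hm] at h2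
    have e1 : (g₀⁻¹ * (d * g d))⁻¹ * (g₀⁻¹ * (d' * g d')) =
        (g d)⁻¹ * ((d : Equiv.Perm (Fin n))⁻¹ * d') * g d' := by group
    rw [e1, Subgroup.mul_mem_cancel_right _ (hg d'),
      Subgroup.mul_mem_cancel_left _ (Subgroup.inv_mem _ (hg d))] at h2
    have h3 := d.2.1.2.1.eq_of_mul_eq (d'.2.1.2.1) (one_mem _) h2
      (by group : (1 : Equiv.Perm (Fin n)) * (d : Equiv.Perm (Fin n))⁻¹ =
        ((d : Equiv.Perm (Fin n))⁻¹ * d') * (d' : Equiv.Perm (Fin n))⁻¹)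
    exact Subtype.ext (inv_injective h3.2)
  · intro q
    obtain ⟨b, rfl⟩ := QuotientGroup.mk_surjective q
    have hb := (hN _).mp b.2
    obtain ⟨u, hu, d₀, hd₀, hud⟩ := exists_leftMin_mul Λ (g₀ * (b : Equiv.Perm (Fin n)))⁻¹
    obtain ⟨d, hd⟩ : ∃ d, d = d₀⁻¹ := ⟨_, rfl⟩
    have hdu : d * u⁻¹ = g₀ * (b : Equiv.Perm (Fin n)) := by
      rw [hd, ← mul_inv_rev, hud, inv_inv]
    have hdΛ : LeftMin Λ d⁻¹ := by rw [hd, inv_inv]; exact hd₀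
    have hu' := (parab n Λ).inv_mem hu
    have hcar : CarriesBlocks (d * u⁻¹) K J := hdu ▸ hg₀.mul hb
    have hsb : ∀ i : Fin (n - 1), (i : ℕ) ∈ J → SameBlock Λ (d⁻¹ (lo i)) (d⁻¹ (hi i)) := by
      intro i hi'
      have h1 := (hcar.inv (lo i) (hi i)).mp (sameBlock_lo_hi.mpr hi')
      have h2 := h1.mono hK
      rw [mul_inv_rev, inv_inv] at h2
      exact (carriesBlocks_of_mem hu _ _).mpr h2
    have hgood : GoodRep J Λ d := by
      refine ⟨fun i hi' hdesc => ?_, hdΛ, hsb⟩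
      have h1 := hdΛ.lt hdesc (hsb i hi').symm
      have e1 : ∀ x, d (d⁻¹ x) = x := fun x => by simp
      rw [inv_inv, e1, e1] at h1
      exact absurd h1 (not_lt.mpr (lo_lt_hi i).le)
    refine ⟨⟨d, hgood, u⁻¹, hu', hcar⟩, ?_⟩
    refine QuotientGroup.eq.mpr ?_
    rw [Subgroup.mem_subgroupOf, hN']
    refine ⟨(hN _).mp (Subtype.prop _), ?_⟩
    rw [Subgroup.coe_mul, Subgroup.coe_inv, hm]
    have e1 : (b : Equiv.Perm (Fin n)) = g₀⁻¹ * (d * u⁻¹) := by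
      rw [hdu, inv_mul_cancel_left]
    obtain ⟨g', hg'⟩ : ∃ g', g' = g ⟨d, hgood, u⁻¹, hu', hcar⟩ := ⟨_, rfl⟩
    have hgm : g' ∈ parab n Λ := hg' ▸ hg _
    rw [← hg', e1]
    have e2 : (g₀⁻¹ * (d * g'))⁻¹ * (g₀⁻¹ * (d * u⁻¹)) = g'⁻¹ * u⁻¹ := by group
    rw [e2]
    exact Subgroup.mul_mem _ (Subgroup.inv_mem _ hgm) hu'

theorem exists_blockIso_derived {α : (k + l).Partition} {θ : k.Partition × l.Partition}
    (hθ : θ ∈ multipartitions k l α) :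
    ∃ p : Equiv.Perm (Fin (k + l)),
      BlockIso p (interior (ofPartition α)) (interior (derived θ)) := by
  simp only [multipartitions, Finset.mem_filter, Finset.mem_univ, true_and] at hθ
  obtain ⟨σ, hσ⟩ := exists_equiv_of_map_eq (ofPartition α).blocksFun (derived θ).blocksFun
    (by rw [map_blocksFun, map_blocksFun, coe_blocks_ofPartition, coe_blocks_derived, hθ])
  obtain ⟨p, hp, -⟩ := exists_blockIso _ _ σ hσ
  exact ⟨p, hp⟩

/-- Every `d` satisfying `GoodRep` has the type of a multipartition: `d⁻¹` moves every block of `α`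
either into `{x | x < k}` or into its complement. -/
theorem exists_hasType (hk : 0 < k) (hl : 0 < l) {α : (k + l).Partition}
    {d : Equiv.Perm (Fin (k + l))}
    (hd : GoodRep (interior (ofPartition α)) (interior (twoBlocks k l hk hl)) d) :
    ∃ θ ∈ multipartitions k l α, ∃ p : Equiv.Perm (Fin (k + l)),
      BlockIso p (interior (ofPartition α)) (interior (derived θ)) ∧
      p * d ∈ parab (k + l) (interior (twoBlocks k l hk hl)) := by
  classical
  obtain ⟨c, hc⟩ : ∃ c, c = ofPartition α := ⟨_, rfl⟩
  rw [← hc] at hd ⊢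
  obtain ⟨hiso, hsub, -⟩ := blockIso_conjSet hd.1 hd.2.1 hd.2.2
  have hleft : ∀ x y, c.index x = c.index y →
      (((d⁻¹ x : Fin (k + l)) : ℕ) < k ↔ ((d⁻¹ y : Fin (k + l)) : ℕ) < k) := by
    intro x y h
    rw [← sameBlock_interior_iff] at h
    exact (sameBlock_twoBlocks hk hl _ _).mp (((hiso.carriesBlocks x y).mp h).mono hsub)
  -- `P i` says that `d⁻¹` moves the block with index `i` into `{x | x < k}`
  obtain ⟨P, hP⟩ : ∃ P : Fin c.length → Prop,
      ∀ x, P (c.index x) ↔ ((d⁻¹ x : Fin (k + l)) : ℕ) < k := by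
    refine ⟨fun i => ∃ x, c.index x = i ∧ ((d⁻¹ x : Fin (k + l)) : ℕ) < k, fun x => ?_⟩
    constructor
    · rintro ⟨y, hy, hlt⟩
      exact (hleft y x hy).mp hlt
    · intro h
      exact ⟨x, rfl, h⟩
  have hsum : ∑ i : {i // P i}, c.blocksFun i = k := by
    have h1 : (Finset.univ.filter fun x : Fin (k + l) => P (c.index x)).card = k := by
      simp only [hP]
      have h2 : (Finset.univ.filter fun x : Fin (k + l) => (x : ℕ) < k).card = k := by
        rw [Fin.card_filter_val_lt]
        omega
      refine Eq.trans (Finset.card_bij (fun x _ => d⁻¹ x) ?_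
        (fun _ _ _ _ e => d⁻¹.injective e) ?_) h2
      · intro x hx
        simpa using hx
      · intro y hy
        exact ⟨d y, by simpa using hy, by simp⟩
    refine Eq.trans ?_ h1
    rw [Finset.card_filter, ← Equiv.sum_comp c.blocksFinEquiv, Fintype.sum_sigma]
    have h2 : ∀ (i : Fin c.length) (t : Fin (c.blocksFun i)),
        c.index (c.blocksFinEquiv ⟨i, t⟩) = i := fun i t => c.index_embedding i t
    simp only [h2, Finset.sum_const, Finset.card_univ, Fintype.card_fin, smul_eq_mul, mul_ite,
      mul_one, mul_zero]
    rw [← Finset.sum_filter]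
    exact (Finset.sum_subtype _ (by simp) _).symm
  obtain ⟨θ, hθ, σ, hσ, hσP⟩ := exists_multipartition c P hsum
  obtain ⟨p, hp, hidx⟩ := exists_blockIso _ _ σ hσ
  refine ⟨θ, ?_, p, hp, fun x => ?_⟩
  · rw [hc, coe_blocks_ofPartition] at hθ
    simpa [multipartitions] using hθ
  · rw [sameBlock_twoBlocks, Equiv.Perm.mul_apply,
      lt_iff_index_append (ofPartition θ.1) (ofPartition θ.2) (p (d x)), hidx, hσP, hP]
    simp

end Multipartitions

end NormBasis

open NormBasis in
theorem mainTheorem3 (k l : ℕ) (hk : 0 < k) (hl : 0 < l) (α : (k + l).Partition) :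
    (∃ z : k.Partition × l.Partition → ℕ,
      NormBasis.proj (NormBasis.twoBlocks k l hk hl) (NormBasis.normElement α) =
        ∑ θ ∈ NormBasis.multipartitions k l α,
          z θ • NormBasis.relNorm (NormBasis.parabolic (NormBasis.twoBlocks k l hk hl))
            (NormBasis.parabolic (NormBasis.derived θ))
            (NormBasis.eta (NormBasis.derived θ))) ∧
    ∀ z : k.Partition × l.Partition → ℕ,
      NormBasis.proj (NormBasis.twoBlocks k l hk hl) (NormBasis.normElement α) =
        ∑ θ ∈ NormBasis.multipartitions k l α,
          z θ • NormBasis.relNorm (NormBasis.parabolic (NormBasis.twoBlocks k l hk hl))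
            (NormBasis.parabolic (NormBasis.derived θ))
            (NormBasis.eta (NormBasis.derived θ)) →
      ∀ θ ∈ NormBasis.multipartitions k l α,
        z θ = (NormBasis.normalizerIn (NormBasis.parabolic (NormBasis.twoBlocks k l hk hl))
            (NormBasis.parabolic (NormBasis.derived θ))).relIndex
          (NormBasis.normalizerIn ⊤ (NormBasis.parabolic (NormBasis.derived θ))) := by
  classical
  obtain ⟨Λ, hΛ⟩ : ∃ Λ, Λ = interior (twoBlocks k l hk hl) := ⟨_, rfl⟩
  obtain ⟨J, hJ⟩ : ∃ J, J = interior (ofPartition α) := ⟨_, rfl⟩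
  simp only [parabolic_eq, eta_eq, proj_eq, normElement, ← parab_univ, relNorm_eq, ← hΛ, ← hJ]
  have hJn : ∀ i ∈ J, i + 1 < k + l := fun i hi' => by rw [hJ] at hi'; exact hi'.1
  have hsub : ∀ θ : k.Partition × l.Partition, interior (derived θ) ⊆ Λ := fun θ => by
    rw [hΛ]; exact interior_append_subset hk hl _ _
  rw [projSet_normSet hJn]
  -- the multipartition attached to a double coset representative is unique
  have huniq : ∀ d : Equiv.Perm (Fin (k + l)), ∀ θ ∈ multipartitions k l α,
      ∀ θ' ∈ multipartitions k l α, HasType J Λ (interior (derived θ)) d →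
        HasType J Λ (interior (derived θ')) d → θ = θ' := by
    rintro d θ hθ θ' hθ' ⟨g, hg, h⟩ ⟨g', hg', h'⟩
    rw [hΛ] at hg hg'
    have h1 := h'.inv.mul h
    rw [mul_inv_rev, mul_assoc, inv_mul_cancel_left] at h1
    exact eq_of_carriesBlocks hk hl hθ hθ' (Subgroup.mul_mem _ (Subgroup.inv_mem _ hg') hg) h1
  -- each term of the Mackey formula is the relative norm of the multipartition giving its type
  have hterm : ∀ d ∈ Finset.univ.filter (fun d : Equiv.Perm (Fin (k + l)) => GoodRep J Λ d),
      normSet Λ (conjSet d J) (etaSet (k + l) (conjSet d J)) =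
        ∑ θ ∈ multipartitions k l α, if HasType J Λ (interior (derived θ)) d then
          (normSet Λ (interior (derived θ)) (etaSet _ (interior (derived θ))) : Hecke (k + l))
        else 0 := by
    intro d hd
    simp only [Finset.mem_filter, Finset.mem_univ, true_and] at hd
    obtain ⟨hiso, hconj, hn⟩ := blockIso_conjSet hd.1 hd.2.1 hd.2.2
    have hd' := hd
    rw [hJ, hΛ] at hd'
    obtain ⟨θ, hθ, p, hp, hpd⟩ := exists_hasType hk hl hd'
    rw [← hJ] at hp
    rw [← hΛ] at hpd
    have htype : HasType J Λ (interior (derived θ)) d := by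
      refine ⟨(p * d)⁻¹, Subgroup.inv_mem _ hpd, ?_⟩
      rw [mul_inv_rev, mul_inv_cancel_left]
      exact hp.carriesBlocks.inv
    rw [Finset.sum_eq_single_of_mem θ hθ, if_pos htype]
    · have hiso' := hiso.symm.trans hp
      rw [inv_inv] at hiso'
      exact hiso'.normSet_eq hn (fun i hi' => hi'.1) hpd hconj (hsub θ)
    · intro θ' hθ' hne
      rw [if_neg]
      exact fun h => hne (huniq d θ' hθ' θ hθ h htype)
  -- the number of representatives of a given type is the index of the normalizers
  have hmain : (∑ d ∈ Finset.univ.filter (fun d : Equiv.Perm (Fin (k + l)) => GoodRep J Λ d),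
      normSet Λ (conjSet d J) (etaSet (k + l) (conjSet d J)) : Hecke (k + l)) =
      ∑ θ ∈ multipartitions k l α,
        ((normalizerIn (parab (k + l) Λ) (parab (k + l) (interior (derived θ)))).relIndex
          (normalizerIn (parab (k + l) Set.univ) (parab (k + l) (interior (derived θ))))) •
        (normSet Λ (interior (derived θ)) (etaSet _ (interior (derived θ))) : Hecke (k + l)) := by
    rw [Finset.sum_congr rfl hterm, Finset.sum_comm]
    refine Finset.sum_congr rfl fun θ hθ => ?_
    obtain ⟨p, hp⟩ := exists_blockIso_derived hθ
    rw [← hJ] at hp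
    rw [parab_univ, ← card_hasType (hsub θ) hp.carriesBlocks.inv, ← Finset.sum_filter,
      Finset.sum_const, Finset.filter_filter, Nat.card_eq_fintype_card, Fintype.card_subtype]
  rw [hmain]
  refine ⟨⟨_, rfl⟩, fun z hz θ hθ => ?_⟩
  -- compare the coefficients at the Coxeter element of `θ` after the specialization `ξ = 0`
  have h0 : ∀ θ' ∈ multipartitions k l α, θ' ≠ θ → evalCoord (coxOf (k + l) (interior (derived θ)))
      (normSet Λ (interior (derived θ')) (etaSet _ (interior (derived θ')))) = 0 := by
    intro θ' hθ' hne
    refine evalCoord_normSet_eq_zero (hsub θ') fun g hg hc => hne ?_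
    rw [hΛ] at hg
    exact (eq_of_carriesBlocks hk hl hθ hθ' hg hc).symm
  have h1 : ∀ y : k.Partition × l.Partition → ℕ,
      evalCoord (coxOf (k + l) (interior (derived θ))) (∑ θ' ∈ multipartitions k l α, y θ' •
        (normSet Λ (interior (derived θ')) (etaSet _ (interior (derived θ'))) : Hecke (k + l))) =
      y θ * evalCoord (coxOf (k + l) (interior (derived θ)))
        (normSet Λ (interior (derived θ)) (etaSet _ (interior (derived θ)))) := by
    intro y
    rw [map_sum, Finset.sum_eq_single_of_mem θ hθ, map_nsmul, nsmul_eq_mul]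
    intro θ' hθ' hne
    rw [map_nsmul, h0 θ' hθ' hne, smul_zero]
  have h2 := congrArg (evalCoord (coxOf (k + l) (interior (derived θ)))) hz
  rw [h1, h1] at h2
  have h3 := mul_right_cancel₀ (evalCoord_normSet_pos Λ (interior (derived θ))).ne' h2
  exact (Nat.cast_injective h3).symm
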